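/- Let $X$ be a connected complex projective manifold of dimension $n\ge 1$, $L$ a holomorphic line bundle on $X$ and $p\in X$. For an $\mathbb{R}$-line bundle $F$ (a finite formal real combination of holomorphic line bundles) on a projective manifold $M$, a singular positive metric is a family of plurisubharmonic local weights transforming by the corresponding combination of $\ln|g|^2$ of the transition functions; it is strictly positive if its curvature current dominates a Kähler form. $F$ is pseudoeffective if it has a singular positive metric that is not identically $-\infty$, and big if $F-\varepsilon A$ is pseudoeffective for some ample line bundle $A$ and some $\varepsilon>0$. The ample locus $\mathrm{Amp}(F)$ is the set of points near which some singular strictly positive metric of $F$ is smooth, and $\mathbb{B}_+(F)=M\setminus \mathrm{Amp}(F)$ is the augmented base locus. Let $\pi:\mathrm{Bl}_pX\to X$ be the blowup of $X$ at $p$ with exceptional divisor $E$, and let $C_{\max}$ be the supremum of the $\lambda\in\mathbb{R}$ such that $\pi^*L-\lambda E$ is pseudoeffective. Let $\Pi:\mathcal{X}\to X\times\mathbb{P}^1$ be the blowup of $(p,0)$, with exceptional divisor $\mathcal{E}=\mathbb{P}(T_pX\oplus\mathbb{C})$, let $\tilde X\subset\mathcal{X}$ be the strict transform of $X\times\{0\}$,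 let $\pi_X,\pi_{\mathbb{P}^1}$ be the projections of $X\times\mathbb{P}^1$, and put $$\mathcal{L}:=\Pi^*\bigl(\pi_X^*L+(C_{\max}+1)\,\pi_{\mathbb{P}^1}^*\mathcal{O}(1)\bigr)-C_{\max}\,\mathcal{E}.$$ If $L$ is ample, or if $L$ is big and $p\in\mathrm{Amp}(L)$, then the $\mathbb{R}$-line bundle $\mathcal{L}$ is big and $$\mathbb{B}_+(\mathcal{L})=\tilde X\cup(\pi_X\circ\Pi)^{-1}(\mathbb{B}_+(L)).$$ In particular $T_pX\subset\mathcal{E}$, embedded by $v\mapsto[v:1]$, is contained in $\mathrm{Amp}(\mathcal{L})$. -/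

import Mathlib

open Set Filter Topology
open scoped Manifold ContDiff LinearAlgebra.Projectivization

namespace CxGeom

section Core
variable {E : Type*} [NormedAddCommGroup E] [NormedSpace ℂ E] {M : Type*}

/-- A family of charts on a set `M` with values in `E`, with open transition domains and
holomorphic transition maps, covering `M`. -/
@[reducible] def coreOfCharts {ι : Type*} (A : ι → PartialEquiv M E) (idx : M → ι)
    (hmem : ∀ x, x ∈ (A (idx x)).source)
    (hopen : ∀ i j, IsOpen ((A i).symm.trans (A j)).source)
    (hhol : ∀ i j, ContDiffOn ℂ ω ((A i).symm.trans (A j)) ((A i).symm.trans (A j)).source) :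
    ChartedSpaceCore E M where
  atlas := Set.range A
  chartAt x := A (idx x)
  mem_chart_source := hmem
  chart_mem_atlas x := ⟨_, rfl⟩
  open_source := by
    rintro _ _ ⟨i, rfl⟩ ⟨j, rfl⟩
    exact hopen i j
  continuousOn_toFun := by
    rintro _ _ ⟨i, rfl⟩ ⟨j, rfl⟩
    exact (hhol i j).continuousOn

theorem isManifold_of_core (c : ChartedSpaceCore E M)
    (h : ∀ e ∈ c.atlas, ∀ e' ∈ c.atlas,
      ContDiffOn ℂ ω (e.symm.trans e') (e.symm.trans e').source) :
    @IsManifold ℂ _ E _ _ E _ 𝓘(ℂ, E) ω M c.toTopologicalSpace c.toChartedSpace := by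
  let := c.toTopologicalSpace
  let := c.toChartedSpace
  refine isManifold_of_contDiffOn 𝓘(ℂ, E) ω M ?_
  intro e e' he he'
  obtain ⟨f, hf, rfl⟩ := mem_iUnion₂.1 he
  obtain ⟨f', hf', rfl⟩ := mem_iUnion₂.1 he'
  simp only [modelWithCornersSelf_coe, modelWithCornersSelf_coe_symm, Function.id_comp,
    Function.comp_id, preimage_id, range_id, inter_univ]
  exact h f hf f' hf'

/-- Holomorphy on the manifold built from a core is checked in the charts of the core. -/
theorem contMDiffOn_of_core (c : ChartedSpaceCore E M)
    (h : ∀ e ∈ c.atlas, ∀ e' ∈ c.atlas,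
      ContDiffOn ℂ ω (e.symm.trans e') (e.symm.trans e').source)
    {E' : Type*} [NormedAddCommGroup E'] [NormedSpace ℂ E'] {N : Type*} [TopologicalSpace N]
    [ChartedSpace E' N] (f : M → N) (U : Set M)
    (hf : ∀ e ∈ c.atlas, ContMDiffOn 𝓘(ℂ, E) 𝓘(ℂ, E') ω (f ∘ e.symm)
      (e.target ∩ e.symm ⁻¹' U)) :
    letI := c.toTopologicalSpace
    letI := c.toChartedSpace
    ContMDiffOn 𝓘(ℂ, E) 𝓘(ℂ, E') ω f U := by
  let := c.toTopologicalSpace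
  let := c.toChartedSpace
  have := isManifold_of_core c h
  intro x hx
  have hm := c.chart_mem_atlas x
  set e := chartAt E x with he
  have hee : ∀ y, e y = c.chartAt x y := fun _ => rfl
  have hes : ∀ y, e.symm y = (c.chartAt x).symm y := fun _ => rfl
  have hsrc : e.source = (c.chartAt x).source := rfl
  have htgt : e.target = (c.chartAt x).target := rfl
  have h1 : ContMDiffOn 𝓘(ℂ, E) 𝓘(ℂ, E) ω e e.source :=
    contMDiffOn_of_mem_maximalAtlas (IsManifold.chart_mem_maximalAtlas x)
  have h2 : ContMDiffOn 𝓘(ℂ, E) 𝓘(ℂ, E') ω ((f ∘ (c.chartAt x).symm) ∘ e) (e.source ∩ U) := by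
    refine (hf _ hm).comp (h1.mono inter_subset_left) ?_
    rintro y ⟨hy, hyU⟩
    refine ⟨e.map_source hy, ?_⟩
    change (c.chartAt x).symm (c.chartAt x y) ∈ U
    rwa [(c.chartAt x).left_inv hy]
  have h3 : ContMDiffWithinAt 𝓘(ℂ, E) 𝓘(ℂ, E') ω f (e.source ∩ U) x := by
    refine (h2 x ⟨mem_chart_source E x, hx⟩).congr ?_ ?_
    · rintro y ⟨hy, -⟩
      change f y = f ((c.chartAt x).symm (c.chartAt x y))
      rw [(c.chartAt x).left_inv hy]
    · change f x = f ((c.chartAt x).symm (c.chartAt x x))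
      rw [(c.chartAt x).left_inv (c.mem_chart_source x)]
  rw [inter_comm] at h3
  exact (contMDiffWithinAt_inter (e.open_source.mem_nhds (mem_chart_source E x))).1 h3

end Core

/-! ### The projective line -/

/-- The complex projective line. -/
def ProjLine : Type := ℙ ℂ (ℂ × ℂ)

namespace ProjLine

theorem fst_ne (l : ProjLine) (h : (Projectivization.rep l).2 = 0) :
    (Projectivization.rep l).1 ≠ 0 := fun h1 =>
  (Projectivization.rep_nonzero l) (Prod.ext h1 h)

/-- The two homogeneous coordinates (of a chosen representative; only their ratio matters). -/
noncomputable def hom (l : ProjLine) : Bool → ℂ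
  | false => (Projectivization.rep l).2
  | true => (Projectivization.rep l).1

/-- The point with homogeneous coordinates `[z : 1]`, resp. `[1 : z]`. -/
noncomputable def ofCoord (b : Bool) (z : ℂ) : ProjLine :=
  match b with
  | false => Projectivization.mk ℂ (z, 1) (fun h => one_ne_zero (Prod.mk.inj h).2)
  | true => Projectivization.mk ℂ (1, z) (fun h => one_ne_zero (Prod.mk.inj h).1)

theorem hom_ofCoord (b : Bool) (z : ℂ) : ∃ a : ℂ, a ≠ 0 ∧
    hom (ofCoord b z) b = a ∧ hom (ofCoord b z) (!b) = a * z := by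
  cases b
  · obtain ⟨a, ha⟩ := Projectivization.exists_smul_eq_mk_rep ℂ ((z, 1) : ℂ × ℂ)
      (fun h => one_ne_zero (Prod.mk.inj h).2)
    refine ⟨a, a.ne_zero, ?_, ?_⟩
    · change (Projectivization.rep (Projectivization.mk ℂ (z, (1:ℂ)) _)).2 = _
      rw [← ha]; simp [Units.smul_def]
    · change (Projectivization.rep (Projectivization.mk ℂ (z, (1:ℂ)) _)).1 = _
      rw [← ha]; simp [Units.smul_def]
  · obtain ⟨a, ha⟩ := Projectivization.exists_smul_eq_mk_rep ℂ ((1, z) : ℂ × ℂ)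
      (fun h => one_ne_zero (Prod.mk.inj h).1)
    refine ⟨a, a.ne_zero, ?_, ?_⟩
    · change (Projectivization.rep (Projectivization.mk ℂ ((1:ℂ), z) _)).1 = _
      rw [← ha]; simp [Units.smul_def]
    · change (Projectivization.rep (Projectivization.mk ℂ ((1:ℂ), z) _)).2 = _
      rw [← ha]; simp [Units.smul_def]

/-- The two affine charts: `[x : y] ↦ x / y` on `y ≠ 0` and `[x : y] ↦ y / x` on `x ≠ 0`. -/
noncomputable def chart (b : Bool) : PartialEquiv ProjLine ℂ where
  toFun l := hom l (!b) / hom l b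
  invFun z := ofCoord b z
  source := {l | hom l b ≠ 0}
  target := univ
  map_source' _ _ := mem_univ _
  map_target' z _ := by
    obtain ⟨a, ha, h1, -⟩ := hom_ofCoord b z
    simpa [h1] using ha
  left_inv' l hl := by
    conv_rhs => rw [← Projectivization.mk_rep l]
    cases b
    · refine (Projectivization.mk_eq_mk_iff' ℂ _ _ _ _).2 ⟨(hom l false)⁻¹, ?_⟩
      have : (Projectivization.rep l).2 ≠ 0 := hl
      ext <;> simp [hom, this, div_eq_inv_mul]
    · refine (Projectivization.mk_eq_mk_iff' ℂ _ _ _ _).2 ⟨(hom l true)⁻¹, ?_⟩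
      have : (Projectivization.rep l).1 ≠ 0 := hl
      ext <;> simp [hom, this, div_eq_inv_mul]
  right_inv' z _ := by
    obtain ⟨a, ha, h1, h2⟩ := hom_ofCoord b z
    rw [h1, h2]; field_simp

theorem chart_source (i j : Bool) :
    ((chart i).symm.trans (chart j)).source = if i = j then univ else {0}ᶜ := by
  ext z
  obtain ⟨a, ha, h1, h2⟩ := hom_ofCoord i z
  rw [PartialEquiv.trans_source]
  have : (z ∈ (chart i).symm.source ∩ (chart i).symm ⁻¹' (chart j).source) ↔
    hom (ofCoord i z) j ≠ 0 := by simp [chart]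
  rw [this]
  cases i <;> cases j <;> simp_all

theorem chart_trans (i j : Bool) (z : ℂ) :
    ((chart i).symm.trans (chart j)) z = if i = j then z else z⁻¹ := by
  obtain ⟨a, ha, h1, h2⟩ := hom_ofCoord i z
  have : ((chart i).symm.trans (chart j)) z = hom (ofCoord i z) (!j) / hom (ofCoord i z) j := rfl
  rw [this]
  cases i <;> cases j <;> simp_all <;> field_simp

theorem chart_open (i j : Bool) : IsOpen ((chart i).symm.trans (chart j)).source := by
  rw [chart_source]; split_ifs
  · exact isOpen_univ
  · exact isOpen_compl_singleton

theorem chart_hol (i j : Bool) : ContDiffOn ℂ ω ((chart i).symm.trans (chart j))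
    ((chart i).symm.trans (chart j)).source := by
  have : ⇑((chart i).symm.trans (chart j)) = fun z => if i = j then z else z⁻¹ :=
    funext (chart_trans i j)
  rw [chart_source, this]
  split_ifs
  · exact contDiffOn_id
  · exact contDiffOn_inv ℂ

open Classical in
theorem chart_cover (l : ProjLine) :
    l ∈ (chart (if hom l false ≠ 0 then false else true)).source := by
  by_cases h : hom l false = 0
  · rw [if_neg (not_not.2 h)]
    exact fst_ne l h
  · rw [if_pos h]; exact h

open Classical in
/-- The complex structure of the projective line. -/
noncomputable def core : ChartedSpaceCore ℂ ProjLine :=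
  coreOfCharts chart (fun l => if hom l false ≠ 0 then false else true)
    chart_cover chart_open chart_hol

noncomputable instance : TopologicalSpace ProjLine := core.toTopologicalSpace
noncomputable instance : ChartedSpace ℂ ProjLine := core.toChartedSpace

theorem core_hol : ∀ e ∈ core.atlas, ∀ e' ∈ core.atlas,
    ContDiffOn ℂ ω (e.symm.trans e') (e.symm.trans e').source := by
  rintro _ ⟨i, rfl⟩ _ ⟨j, rfl⟩
  exact chart_hol i j

instance : IsManifold 𝓘(ℂ, ℂ) ω ProjLine := isManifold_of_core core core_hol

/-- The point `0 = [0 : 1]`, where the affine coordinate `τ = x / y` vanishes. -/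
noncomputable def zero : ProjLine := ofCoord false 0

end ProjLine

/-! ### The blowup of a complex manifold at a point -/

/-- The points of the blowup at `q` of a complex manifold modelled on `E`: the points other than
`q`, together with the complex lines in the tangent space at `q`. The tangent space is `E` itself,
through the preferred chart at `q`. -/
inductive Blowup (E : Type*) [NormedAddCommGroup E] [NormedSpace ℂ E] {M : Type*} (q : M)
  | off (x : M) (hx : x ≠ q) : Blowup E q
  | exc (l : Projectivization ℂ E) : Blowup E q

/-- A linear form `f` and a vector `w` with `f w = 1`: the lines on which `f` does not vanish are
parametrized by the affine hyperplane `w + ker f`. -/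
def AffDir (E : Type*) [NormedAddCommGroup E] [NormedSpace ℂ E] : Type _ :=
  {a : (E →L[ℂ] ℂ) × E // a.1 a.2 = 1}

section Blowup

variable {E : Type*} [NormedAddCommGroup E] [NormedSpace ℂ E]

namespace AffDir

/-- The linear form. -/
def f (a : AffDir E) : E →L[ℂ] ℂ := a.1.1

/-- The vector. -/
def w (a : AffDir E) : E := a.1.2

theorem f_w (a : AffDir E) : a.f a.w = 1 := a.2

/-- The projection of `E` to the affine hyperplane `f = 1` along `w`. -/
noncomputable def lift (a : AffDir E) (y : E) : E := y + (1 - a.f y) • a.w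

@[simp] theorem f_lift (a : AffDir E) (y : E) : a.f (a.lift y) = 1 := by
  simp [lift, f_w]

theorem lift_ne (a : AffDir E) (y : E) : a.lift y ≠ 0 := fun h => by
  have := a.f_lift y
  rw [h] at this
  simp at this

theorem contDiff_lift (a : AffDir E) : ContDiff ℂ ω a.lift :=
  contDiff_id.add ((contDiff_const.sub a.f.contDiff).smul contDiff_const)

theorem exists_of_ne {v : E} (hv : v ≠ 0) : ∃ a : AffDir E, a.f v ≠ 0 := by
  obtain ⟨f, hf⟩ := SeparatingDual.exists_eq_one (R := ℂ) hv
  exact ⟨⟨(f, v), hf⟩, by change f v ≠ 0; simp [hf]⟩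

end AffDir

namespace Blowup

variable {M : Type*} {q : M}

/-- The blowdown map, contracting the exceptional divisor to `q`. -/
def down : Blowup E q → M
  | off x _ => x
  | exc _ => q

variable (E) in
/-- The exceptional divisor. -/
def excDiv (q : M) : Set (Blowup E q) := down ⁻¹' {q}

theorem ext_of_down {b b' : Blowup E q} (h : down b = down b') (hq : down b ≠ q) : b = b' := by
  cases b <;> cases b' <;> simp_all [down]

variable [TopologicalSpace M] [ChartedSpace E M]

variable (E) in
/-- Coordinates of `M` centered at `q`. -/
noncomputable def coord (q : M) (x : M) : E := chartAt E q x - chartAt E q q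

/-- A vector spanning the line attached to a point of the blowup (near the exceptional divisor):
the coordinate vector of the point, or a vector of the line in the tangent space. -/
noncomputable def dir : Blowup E q → E
  | off x _ => coord E q x
  | exc l => l.rep

variable (E) in
@[simp] theorem coord_self (q : M) : coord E q q = 0 := sub_self _

theorem dir_of_ne {b : Blowup E q} (h : down b ≠ q) : dir b = coord E q (down b) := by
  cases b <;> simp_all [down, dir]

/-- The point of `M` under the point with coordinate `y` in the chart attached to `a`. -/
noncomputable def base (q : M) (a : AffDir E) (y : E) : M :=
  (chartAt E q).symm (a.f y • a.lift y + chartAt E q q)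

/-- The domain of the coordinates attached to `a`. -/
def dom (q : M) (a : AffDir E) : Set E :=
  {y | a.f y • a.lift y + chartAt E q q ∈ (chartAt E q).target}

open Classical in
/-- The point with coordinate `y` in the chart attached to `a`. -/
noncomputable def point (q : M) (a : AffDir E) (y : E) : Blowup E q :=
  if h : base q a y = q then exc (Projectivization.mk ℂ (a.lift y) (a.lift_ne y))
  else off (base q a y) h

theorem down_point (a : AffDir E) (y : E) : down (point q a y) = base q a y := by
  unfold point
  split_ifs with h
  · exact h.symm
  · rfl

theorem base_mem {a : AffDir E} {y : E} (hy : y ∈ dom q a) :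
    base q a y ∈ (chartAt E q).source := (chartAt E q).map_target hy

theorem coord_base {a : AffDir E} {y : E} (hy : y ∈ dom q a) :
    coord E q (base q a y) = a.f y • a.lift y := by
  unfold coord base
  rw [(chartAt E q).right_inv hy]
  simp

theorem base_eq_iff {a : AffDir E} {y : E} (hy : y ∈ dom q a) : base q a y = q ↔ a.f y = 0 := by
  constructor
  · intro h
    have := coord_base hy
    rw [h, coord_self] at this
    exact (smul_eq_zero.1 this.symm).resolve_right (a.lift_ne y)
  · intro h
    simp [base, h]

theorem dir_point {a : AffDir E} {y : E} (hy : y ∈ dom q a) :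
    ∃ k : ℂ, k ≠ 0 ∧ dir (point q a y) = k • a.lift y := by
  by_cases h : base q a y = q
  · obtain ⟨k, hk⟩ := Projectivization.exists_smul_eq_mk_rep ℂ (a.lift y) (a.lift_ne y)
    refine ⟨k, k.ne_zero, ?_⟩
    rw [point, dif_pos h]
    exact hk.symm
  · refine ⟨a.f y, fun h0 => h ((base_eq_iff hy).2 h0), ?_⟩
    rw [point, dif_neg h]
    exact coord_base hy

theorem dir_point_of_ne {a : AffDir E} {y : E} (hy : y ∈ dom q a) (h : a.f y ≠ 0) :
    dir (point q a y) = a.f y • a.lift y := by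
  have hb : base q a y ≠ q := fun hb => h ((base_eq_iff hy).1 hb)
  rw [dir_of_ne (by rwa [down_point]), down_point, coord_base hy]

/-- The charts around the exceptional divisor: the point on the line spanned by `u`, `f u = 1`,
with coordinate vector `t • u`, has the coordinate `u + (t - 1) • w`. -/
noncomputable def excChart (q : M) (a : AffDir E) : PartialEquiv (Blowup E q) E where
  toFun b := (a.f (dir b))⁻¹ • dir b + (a.f (coord E q (down b)) - 1) • a.w
  invFun y := point q a y
  source := {b | down b ∈ (chartAt E q).source ∧ a.f (dir b) ≠ 0}
  target := dom q a
  map_source' := by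
    rintro b ⟨hb, hd⟩
    have h1 : a.f ((a.f (dir b))⁻¹ • dir b + (a.f (coord E q (down b)) - 1) • a.w) =
        a.f (coord E q (down b)) := by simp [a.f_w, hd]
    have h2 : a.lift ((a.f (dir b))⁻¹ • dir b + (a.f (coord E q (down b)) - 1) • a.w) =
        (a.f (dir b))⁻¹ • dir b := by
      rw [AffDir.lift, h1, add_assoc, ← add_smul]; simp
    change a.f _ • a.lift _ + _ ∈ (chartAt E q).target
    rw [h1, h2]
    have h3 : a.f (coord E q (down b)) • (a.f (dir b))⁻¹ • dir b = coord E q (down b) := by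
      cases b with
      | off x hx => exact smul_inv_smul₀ hd _
      | exc l => simp [down]
    rw [h3, coord, sub_add_cancel]
    exact (chartAt E q).map_source hb
  map_target' y hy := by
    obtain ⟨k, hk, hd⟩ := dir_point hy
    refine ⟨by rw [down_point]; exact base_mem hy, ?_⟩
    rw [hd]; simpa using hk
  left_inv' := by
    rintro b ⟨hb, hd⟩
    have h1 : a.f ((a.f (dir b))⁻¹ • dir b + (a.f (coord E q (down b)) - 1) • a.w) =
        a.f (coord E q (down b)) := by simp [a.f_w, hd]
    have h2 : a.lift ((a.f (dir b))⁻¹ • dir b + (a.f (coord E q (down b)) - 1) • a.w) =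
        (a.f (dir b))⁻¹ • dir b := by
      rw [AffDir.lift, h1, add_assoc, ← add_smul]; simp
    have h3 : a.f (coord E q (down b)) • (a.f (dir b))⁻¹ • dir b = coord E q (down b) := by
      cases b with
      | off x hx => exact smul_inv_smul₀ hd _
      | exc l => simp [down]
    have h4 : base q a ((a.f (dir b))⁻¹ • dir b + (a.f (coord E q (down b)) - 1) • a.w) =
        down b := by
      rw [base, h1, h2, h3, coord, sub_add_cancel, (chartAt E q).left_inv hb]
    cases b with
    | off x hx =>
      exact ext_of_down (by rw [down_point, h4]) (by rw [down_point, h4]; exact hx)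
    | exc l =>
      have h5 : base q a ((a.f (dir (exc l)))⁻¹ • dir (exc l) +
          (a.f (coord E q (down (exc l))) - 1) • a.w) = q := h4
      rw [point, dif_pos h5]
      congr 1
      conv_rhs => rw [← Projectivization.mk_rep l]
      exact (Projectivization.mk_eq_mk_iff' ℂ _ _ _ _).2 ⟨_, h2.symm⟩
  right_inv' y hy := by
    obtain ⟨k, hk, hd⟩ := dir_point hy
    rw [hd, down_point, coord_base hy, map_smul, map_smul, a.f_lift, smul_eq_mul, mul_one,
      smul_smul, inv_mul_cancel₀ hk, one_smul, smul_eq_mul, mul_one, AffDir.lift, add_assoc,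
      ← add_smul]
    simp

open Classical in
/-- The charts away from the exceptional divisor: the charts of `M`. -/
noncomputable def offChart (z : {z : M // z ≠ q}) : PartialEquiv (Blowup E q) E where
  toFun b := chartAt E z.1 (down b)
  invFun y := if h : (chartAt E z.1).symm y = q then off z.1 z.2 else off ((chartAt E z.1).symm y) h
  source := {b | down b ∈ (chartAt E z.1).source ∧ down b ≠ q}
  target := {y | y ∈ (chartAt E z.1).target ∧ (chartAt E z.1).symm y ≠ q}
  map_source' := by
    rintro b ⟨hb, hq⟩
    exact ⟨(chartAt E z.1).map_source hb, by rwa [(chartAt E z.1).left_inv hb]⟩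
  map_target' := by
    rintro y ⟨hy, hq⟩
    rw [dif_neg hq]
    exact ⟨(chartAt E z.1).map_target hy, hq⟩
  left_inv' := by
    rintro b ⟨hb, hq⟩
    have h : (chartAt E z.1).symm (chartAt E z.1 (down b)) = down b := (chartAt E z.1).left_inv hb
    rw [dif_neg (by rwa [h])]
    exact ext_of_down h (by rw [down, h]; exact hq)
  right_inv' := by
    rintro y ⟨hy, hq⟩
    rw [dif_neg hq]
    exact (chartAt E z.1).right_inv hy

open Classical in
theorem down_offChart_symm {z : {z : M // z ≠ q}} {y : E} (hy : y ∈ (offChart (E := E) z).target) :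
    down ((offChart z).symm y) = (chartAt E z.1).symm y := by
  change down (if h : (chartAt E z.1).symm y = q then off z.1 z.2
    else off ((chartAt E z.1).symm y) h) = _
  rw [dif_neg hy.2]; rfl

variable (E) in
/-- All the charts. -/
noncomputable def chart (q : M) : AffDir E ⊕ {z : M // z ≠ q} → PartialEquiv (Blowup E q) E
  | .inl a => excChart q a
  | .inr z => offChart z

theorem isOpen_ne (E : Type*) [NormedAddCommGroup E] {M : Type*} [TopologicalSpace M]
    [ChartedSpace E M] (q : M) : IsOpen {x : M | x ≠ q} := by
  refine isOpen_iff_mem_nhds.2 fun x hx => ?_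
  by_cases hq : q ∈ (chartAt E x).source
  · have hc : ContinuousAt (chartAt E x) x :=
      (chartAt E x).continuousAt (mem_chart_source E x)
    have hne : chartAt E x x ≠ chartAt E x q := fun h =>
      hx ((chartAt E x).injOn (mem_chart_source E x) hq h)
    filter_upwards [hc.eventually_ne hne] with y hy h
    exact hy (by rw [h])
  · filter_upwards [(chartAt E x).open_source.mem_nhds (mem_chart_source E x)] with y hy h
    exact hq (h ▸ hy)

theorem contMDiffOn_down_symm [IsManifold 𝓘(ℂ, E) ω M] (i : AffDir E ⊕ {z : M // z ≠ q}) :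
    IsOpen (chart E q i).target ∧
    ContMDiffOn 𝓘(ℂ, E) 𝓘(ℂ, E) ω (fun y => down ((chart E q i).symm y)) (chart E q i).target := by
  cases i with
  | inl a =>
    have h1 : ContDiff ℂ ω (fun y => a.f y • a.lift y + chartAt E q q) :=
      (a.f.contDiff.smul a.contDiff_lift).add contDiff_const
    refine ⟨(chartAt E q).open_target.preimage h1.continuous, ?_⟩
    have h2 : ContMDiffOn 𝓘(ℂ, E) 𝓘(ℂ, E) ω (chartAt E q).symm (chartAt E q).target :=
      contMDiffOn_symm_of_mem_maximalAtlas (IsManifold.chart_mem_maximalAtlas q)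
    refine (h2.comp h1.contMDiff.contMDiffOn (fun y hy => hy)).congr fun y hy => ?_
    exact down_point a y
  | inr z =>
    have h2 : ContMDiffOn 𝓘(ℂ, E) 𝓘(ℂ, E) ω (chartAt E z.1).symm (chartAt E z.1).target :=
      contMDiffOn_symm_of_mem_maximalAtlas (IsManifold.chart_mem_maximalAtlas z.1)
    refine ⟨(chartAt E z.1).symm.isOpen_inter_preimage (isOpen_ne E q), ?_⟩
    exact (h2.mono fun y hy => hy.1).congr fun y hy => down_offChart_symm hy

theorem contMDiffOn_coord [IsManifold 𝓘(ℂ, E) ω M] :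
    ContMDiffOn 𝓘(ℂ, E) 𝓘(ℂ, E) ω (coord E q) (chartAt E q).source := by
  have h2 : ContMDiffOn 𝓘(ℂ, E) 𝓘(ℂ, E) ω (chartAt E q) (chartAt E q).source :=
    contMDiffOn_of_mem_maximalAtlas (IsManifold.chart_mem_maximalAtlas q)
  exact h2.sub contMDiffOn_const

theorem chart_trans [IsManifold 𝓘(ℂ, E) ω M] (i j : AffDir E ⊕ {z : M // z ≠ q}) :
    IsOpen ((chart E q i).symm.trans (chart E q j)).source ∧
    ContDiffOn ℂ ω ((chart E q i).symm.trans (chart E q j))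
      ((chart E q i).symm.trans (chart E q j)).source := by
  obtain ⟨ho, hd⟩ := contMDiffOn_down_symm i
  have hpre : ∀ {U : Set M}, IsOpen U → IsOpen ((chart E q i).target ∩
      (fun y => down ((chart E q i).symm y)) ⁻¹' U) := fun hU =>
    hd.continuousOn.isOpen_inter_preimage ho hU
  cases j with
  | inr z =>
    have hs : ((chart E q i).symm.trans (chart E q (.inr z))).source = (chart E q i).target ∩
      (fun y => down ((chart E q i).symm y)) ⁻¹' ((chartAt E z.1).source ∩ {x | x ≠ q}) := rfl
    refine ⟨hs ▸ hpre ((chartAt E z.1).open_source.inter (isOpen_ne E q)), ?_⟩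
    have h2 : ContMDiffOn 𝓘(ℂ, E) 𝓘(ℂ, E) ω (chartAt E z.1) (chartAt E z.1).source :=
      contMDiffOn_of_mem_maximalAtlas (IsManifold.chart_mem_maximalAtlas z.1)
    rw [hs]
    exact (h2.comp (hd.mono inter_subset_left) fun y hy => hy.2.1).contDiffOn
  | inl a' =>
    have key : ∀ (d : E → E) (V : Set E), IsOpen V → ContDiffOn ℂ ω d V →
        (∀ y ∈ (chart E q i).target, down ((chart E q i).symm y) ∈ (chartAt E q).source →
          y ∈ V ∧ ∃ k : ℂ, k ≠ 0 ∧ dir ((chart E q i).symm y) = k • d y) →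
        IsOpen ((chart E q i).symm.trans (chart E q (.inl a'))).source ∧
        ContDiffOn ℂ ω ((chart E q i).symm.trans (chart E q (.inl a')))
          ((chart E q i).symm.trans (chart E q (.inl a'))).source := by
      intro d V hV hdV h
      have hfd : ContDiffOn ℂ ω (fun y => a'.f (d y)) V := a'.f.contDiff.comp_contDiffOn hdV
      have hs : ((chart E q i).symm.trans (chart E q (.inl a'))).source =
          ((chart E q i).target ∩ (fun y => down ((chart E q i).symm y)) ⁻¹'
            (chartAt E q).source) ∩ (V ∩ (fun y => a'.f (d y)) ⁻¹' {0}ᶜ) := by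
        ext y
        constructor
        · rintro ⟨h1, h2, h3⟩
          obtain ⟨hy, k, hk, hdk⟩ := h y h1 h2
          refine ⟨⟨h1, h2⟩, hy, fun h0 => h3 ?_⟩
          have h0 : a'.f (d y) = 0 := h0
          change a'.f (dir ((chart E q i).symm y)) = 0
          rw [hdk, map_smul, h0, smul_zero]
        · rintro ⟨⟨h1, h2⟩, hy, h3⟩
          obtain ⟨-, k, hk, hdk⟩ := h y h1 h2
          refine ⟨h1, h2, ?_⟩
          change a'.f (dir ((chart E q i).symm y)) ≠ 0
          rw [hdk, map_smul]
          exact smul_ne_zero hk h3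
      rw [hs]
      refine ⟨(hpre (chartAt E q).open_source).inter
        (hfd.continuousOn.isOpen_inter_preimage hV isOpen_compl_singleton), ?_⟩
      have hco : ContDiffOn ℂ ω (fun y => coord E q (down ((chart E q i).symm y)))
          ((chart E q i).target ∩ (fun y => down ((chart E q i).symm y)) ⁻¹'
            (chartAt E q).source) :=
        (contMDiffOn_coord.comp (hd.mono inter_subset_left) fun y hy => hy.2).contDiffOn
      have h4 : ContDiffOn ℂ ω (fun y => (a'.f (d y))⁻¹ • d y +
          (a'.f (coord E q (down ((chart E q i).symm y))) - 1) • a'.w)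
          (((chart E q i).target ∩ (fun y => down ((chart E q i).symm y)) ⁻¹'
            (chartAt E q).source) ∩ (V ∩ (fun y => a'.f (d y)) ⁻¹' {0}ᶜ)) := by
        refine (ContDiffOn.smul ((hfd.mono fun y hy => hy.2.1).inv fun y hy => hy.2.2)
          (hdV.mono fun y hy => hy.2.1)).add (ContDiffOn.smul ?_ contDiffOn_const)
        exact (a'.f.contDiff.comp_contDiffOn (hco.mono inter_subset_left)).sub contDiffOn_const
      refine h4.congr ?_
      rintro y ⟨⟨h1, h2⟩, hy, h3⟩
      obtain ⟨-, k, hk, hdk⟩ := h y h1 h2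
      change (a'.f (dir ((chart E q i).symm y)))⁻¹ • dir ((chart E q i).symm y) + _ = _
      rw [hdk, map_smul, smul_eq_mul, mul_inv, smul_smul, mul_right_comm, inv_mul_cancel₀ hk,
        one_mul]
      rfl
    cases i with
    | inl a =>
      refine key a.lift univ isOpen_univ a.contDiff_lift.contDiffOn fun y hy _ => ⟨mem_univ _, ?_⟩
      exact dir_point hy
    | inr z =>
      refine key (fun y => coord E q (down ((chart E q (.inr z)).symm y)))
        ((chart E q (.inr z)).target ∩ (fun y => down ((chart E q (.inr z)).symm y)) ⁻¹'
            (chartAt E q).source) (hpre (chartAt E q).open_source)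
        (contMDiffOn_coord.comp (hd.mono inter_subset_left) fun y hy => hy.2).contDiffOn ?_
      intro y hy h
      refine ⟨⟨hy, h⟩, 1, one_ne_zero, ?_⟩
      rw [one_smul]
      refine dir_of_ne ?_
      rw [chart, down_offChart_symm hy]
      exact hy.2

open Classical in
/-- A chart around a given point. -/
noncomputable def idx : Blowup E q → AffDir E ⊕ {z : M // z ≠ q}
  | off x hx => .inr ⟨x, hx⟩
  | exc l => .inl (AffDir.exists_of_ne l.rep_nonzero).choose

theorem mem_idx (b : Blowup E q) : b ∈ (chart E q (idx b)).source := by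
  cases b with
  | off x hx => exact ⟨mem_chart_source E x, hx⟩
  | exc l => exact ⟨mem_chart_source E q, (AffDir.exists_of_ne l.rep_nonzero).choose_spec⟩

variable (E) in
/-- The complex structure of the blowup. -/
noncomputable def core [IsManifold 𝓘(ℂ, E) ω M] (q : M) : ChartedSpaceCore E (Blowup E q) :=
  coreOfCharts (chart E q) idx mem_idx (fun i j => (chart_trans i j).1)
    (fun i j => (chart_trans i j).2)

variable [IsManifold 𝓘(ℂ, E) ω M]

noncomputable instance : TopologicalSpace (Blowup E q) := (core E q).toTopologicalSpace
noncomputable instance : ChartedSpace E (Blowup E q) := (core E q).toChartedSpace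

theorem core_hol : ∀ e ∈ (core E q).atlas, ∀ e' ∈ (core E q).atlas,
    ContDiffOn ℂ ω (e.symm.trans e') (e.symm.trans e').source := by
  rintro _ ⟨i, rfl⟩ _ ⟨j, rfl⟩
  exact (chart_trans i j).2

instance : IsManifold 𝓘(ℂ, E) ω (Blowup E q) := isManifold_of_core (core E q) core_hol

theorem contMDiff_down : ContMDiff 𝓘(ℂ, E) 𝓘(ℂ, E) ω (down : Blowup E q → M) := by
  rw [← contMDiffOn_univ]
  refine contMDiffOn_of_core (core E q) core_hol _ _ ?_
  rintro _ ⟨i, rfl⟩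
  exact (contMDiffOn_down_symm i).2.mono inter_subset_left

/-- The strict transform of a subset of `M`. -/
def strictTransform (Z : Set M) : Set (Blowup E q) := closure (down ⁻¹' (Z \ {q}))

end Blowup
end Blowup

/-! ### Holomorphic line bundles -/

/-- A holomorphic line bundle on a complex manifold `M` modelled on `E`, given by an open cover and
holomorphic transition functions. -/
structure HolLineBundle (E : Type*) [NormedAddCommGroup E] [NormedSpace ℂ E] (M : Type*)
    [TopologicalSpace M] [ChartedSpace E M] where
  /-- The index set of the cover. -/
  ι : Type
  /-- The open sets of the cover. -/
  U : ι → Set M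
  /-- The transition functions. -/
  g : ι → ι → M → ℂ
  isOpen_U : ∀ i, IsOpen (U i)
  iUnion_U : ⋃ i, U i = univ
  hol_g : ∀ i j, ContMDiffOn 𝓘(ℂ, E) 𝓘(ℂ, ℂ) ω (g i j) (U i ∩ U j)
  g_ne_zero : ∀ i j, ∀ x ∈ U i ∩ U j, g i j x ≠ 0
  cocycle : ∀ i j k, ∀ x ∈ U i ∩ U j ∩ U k, g i j x * g j k x = g i k x

section LineBundle

variable {E : Type*} [NormedAddCommGroup E] [NormedSpace ℂ E] {M : Type*}
  [TopologicalSpace M] [ChartedSpace E M]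
  {E' : Type*} [NormedAddCommGroup E'] [NormedSpace ℂ E'] {N : Type*}
  [TopologicalSpace N] [ChartedSpace E' N]

namespace HolLineBundle

/-- The pullback of a line bundle by a holomorphic map. -/
def pullback (L : HolLineBundle E' N) (f : M → N) (hf : ContMDiff 𝓘(ℂ, E) 𝓘(ℂ, E') ω f) :
    HolLineBundle E M where
  ι := L.ι
  U i := f ⁻¹' L.U i
  g i j x := L.g i j (f x)
  isOpen_U i := (L.isOpen_U i).preimage hf.continuous
  iUnion_U := by rw [← preimage_iUnion, L.iUnion_U, preimage_univ]
  hol_g i j := (L.hol_g i j).comp hf.contMDiffOn fun _ hx => hx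
  g_ne_zero i j x hx := L.g_ne_zero i j (f x) hx
  cocycle i j k x hx := L.cocycle i j k (f x) hx

/-- The holomorphic sections of the power `L ^ m`, in the local trivializations. -/
structure PowSection (L : HolLineBundle E M) (m : ℕ) where
  /-- The local representatives of the section. -/
  s : L.ι → M → ℂ
  hol : ∀ i, ContMDiffOn 𝓘(ℂ, E) 𝓘(ℂ, ℂ) ω (s i) (L.U i)
  trans : ∀ i j, ∀ x ∈ L.U i ∩ L.U j, s i x = L.g i j x ^ m * s j x

/-- Finitely many sections of `L ^ m` define an embedding `x ↦ [s₀(x) : ... : s_N(x)]` of a compact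
complex manifold in a projective space: they have no common zero, separate points, and separate
tangent vectors. -/
structure IsEmbedding (L : HolLineBundle E M) {m k : ℕ} (s : Fin k → L.PowSection m) : Prop where
  base_point_free : ∀ i, ∀ x ∈ L.U i, ∃ a, (s a).s i x ≠ 0
  injective : ∀ i j, ∀ x ∈ L.U i, ∀ y ∈ L.U j,
    (∃ c : ℂ, ∀ a, (s a).s j y = c * (s a).s i x) → x = y
  immersive : ∀ i, ∀ x ∈ L.U i, ∀ v : TangentSpace 𝓘(ℂ, E) x,
    (∃ c : ℂ, ∀ a, mfderiv 𝓘(ℂ, E) 𝓘(ℂ, ℂ) ((s a).s i) x v = c * (s a).s i x) → v = 0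

/-- A line bundle on a compact complex manifold is ample if the sections of some positive power
embed the manifold in a projective space. -/
def IsAmple (L : HolLineBundle E M) : Prop :=
  ∃ m : ℕ, 0 < m ∧ ∃ (k : ℕ) (s : Fin k → L.PowSection m), L.IsEmbedding s

end HolLineBundle

variable (E M) in
/-- A compact complex manifold is projective if it can be embedded in a projective space, that is,
if it carries an ample line bundle. -/
def IsProjective : Prop := ∃ A : HolLineBundle E M, A.IsAmple

variable (E M) in
/-- `ℝ`-line bundles: finite formal real combinations of holomorphic line bundles. -/
structure RLineBundle where
  /-- The index set of the combination. -/
  κ : Type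
  [fintype : Fintype κ]
  /-- The coefficients. -/
  coeff : κ → ℝ
  /-- The line bundles. -/
  bundle : κ → HolLineBundle E M

attribute [instance] RLineBundle.fintype

namespace RLineBundle

/-- A line bundle as an `ℝ`-line bundle. -/
def of (L : HolLineBundle E M) : RLineBundle E M := ⟨Unit, fun _ => 1, fun _ => L⟩

instance : Add (RLineBundle E M) :=
  ⟨fun F G => ⟨F.κ ⊕ G.κ, Sum.elim F.coeff G.coeff, Sum.elim F.bundle G.bundle⟩⟩

instance : SMul ℝ (RLineBundle E M) := ⟨fun r F => ⟨F.κ, fun k => r * F.coeff k, F.bundle⟩⟩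

instance : Sub (RLineBundle E M) := ⟨fun F G => F + (-1 : ℝ) • G⟩

/-- The pullback of an `ℝ`-line bundle by a holomorphic map. -/
def pullback (F : RLineBundle E' N) (f : M → N) (hf : ContMDiff 𝓘(ℂ, E) 𝓘(ℂ, E') ω f) :
    RLineBundle E M := ⟨F.κ, F.coeff, fun k => (F.bundle k).pullback f hf⟩

/-- The choice of a local trivialization of each of the line bundles. -/
def Triv (F : RLineBundle E M) : Type := ∀ k, (F.bundle k).ι

/-- The common domain of the trivializations. -/
def dom (F : RLineBundle E M) (i : F.Triv) : Set M := ⋂ k, (F.bundle k).U (i k)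

/-- The function `∑ a_k ln |g_k|²` by which the local weights of metrics differ. -/
noncomputable def logTrans (F : RLineBundle E M) (i j : F.Triv) (x : M) : ℝ :=
  ∑ k, F.coeff k * Real.log (‖(F.bundle k).g (i k) (j k) x‖ ^ 2)

end RLineBundle

/-! ### Plurisubharmonic functions and Kähler forms -/

variable (E) in
/-- `γ` is (the germ of) a holomorphic disc centered at `x`. -/
def IsHolDisc (γ : ℂ → M) (x : M) : Prop :=
  ContMDiffAt 𝓘(ℂ, ℂ) 𝓘(ℂ, E) ω γ 0 ∧ γ 0 = x

variable (E) in
/-- Plurisubharmonic functions on an open set, with values in `[-∞, ∞)`: upper semicontinuous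
functions with the local submean value property along holomorphic discs. The mean value of `u` along
a circle is the limit as `N → -∞` of the mean values of the bounded functions `max u N`. The function
which is identically `-∞` is allowed. -/
structure PSHOn (u : M → EReal) (U : Set M) : Prop where
  usc : UpperSemicontinuousOn u U
  lt_top : ∀ x ∈ U, u x < ⊤
  submean : ∀ x ∈ U, ∀ γ : ℂ → M, IsHolDisc E γ x → ∃ ρ > 0, ∀ r, 0 < r → r < ρ → ∀ N : ℝ,
    u x ≤ (Real.circleAverage (fun ζ => (max (u (γ ζ)) (N : EReal)).toReal) 0 r : ℝ)

/-- The value at the velocity vector of a holomorphic disc `γ` of (four times) the Levi form of a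
smooth function `f`. -/
noncomputable def levi (f : M → ℝ) (γ : ℂ → M) : ℝ := Laplacian.laplacian (f ∘ γ) 0

variable (E M) in
/-- A Kähler form, given by local potentials: smooth strictly plurisubharmonic functions, whose
`ddᶜ` agree on the overlaps. -/
structure KahlerForm where
  /-- The index set of the cover. -/
  ι : Type
  /-- The open sets of the cover. -/
  V : ι → Set M
  /-- The local potentials. -/
  pot : ι → M → ℝ
  isOpen_V : ∀ a, IsOpen (V a)
  iUnion_V : ⋃ a, V a = univ
  smooth : ∀ a, ContMDiffOn 𝓘(ℝ, E) 𝓘(ℝ, ℝ) ∞ (pot a) (V a)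
  strict : ∀ a, ∀ x ∈ V a, ∀ γ : ℂ → M, IsHolDisc E γ x →
    mfderiv 𝓘(ℂ, ℂ) 𝓘(ℂ, E) γ 0 ≠ 0 → 0 < levi (pot a) γ
  compat : ∀ a b, ∀ x ∈ V a ∩ V b, ∀ γ : ℂ → M, IsHolDisc E γ x →
    levi (pot a) γ = levi (pot b) γ

/-! ### Singular positive metrics -/

namespace RLineBundle

/-- A singular positive metric of an `ℝ`-line bundle: plurisubharmonic local weights `φ i`, with
`φ i = φ j + ∑ a_k ln |g_k|²` on the overlaps. -/
structure SingPosMetric (F : RLineBundle E M) where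
  /-- The local weights. -/
  φ : F.Triv → M → EReal
  psh : ∀ i, PSHOn E (φ i) (F.dom i)
  trans : ∀ i j, ∀ x ∈ F.dom i ∩ F.dom j, φ i x = φ j x + (F.logTrans i j x : EReal)

namespace SingPosMetric

variable {F : RLineBundle E M}

/-- The metric is strictly positive: its curvature current dominates a Kähler form. -/
def IsStrictlyPositive (h : F.SingPosMetric) : Prop :=
  ∃ θ : KahlerForm E M, ∀ i a, PSHOn E (fun x => h.φ i x - (θ.pot a x : EReal)) (F.dom i ∩ θ.V a)

/-- The metric is smooth (in particular finite) in a neighbourhood of `x`. -/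
def IsSmoothNear (h : F.SingPosMetric) (x : M) : Prop :=
  ∃ W : Set M, IsOpen W ∧ x ∈ W ∧ ∀ i, ∃ f : M → ℝ,
    ContMDiffOn 𝓘(ℝ, E) 𝓘(ℝ, ℝ) ∞ f (W ∩ F.dom i) ∧ ∀ y ∈ W ∩ F.dom i, h.φ i y = f y

end SingPosMetric

/-- `F` has a singular positive metric which is not identically `-∞`. -/
def IsPseudoeffective (F : RLineBundle E M) : Prop :=
  ∃ h : F.SingPosMetric, ∃ i, ∃ x ∈ F.dom i, h.φ i x ≠ ⊥

/-- `F - ε A` is pseudoeffective for some ample `A` and some `ε > 0`. -/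
def IsBig (F : RLineBundle E M) : Prop :=
  ∃ A : HolLineBundle E M, A.IsAmple ∧ ∃ ε : ℝ, 0 < ε ∧ (F - ε • of A).IsPseudoeffective

/-- The ample locus: the points near which some singular strictly positive metric is smooth. -/
def ampleLocus (F : RLineBundle E M) : Set M :=
  {x | ∃ h : F.SingPosMetric, h.IsStrictlyPositive ∧ h.IsSmoothNear x}

/-- The augmented base locus. -/
def augBaseLocus (F : RLineBundle E M) : Set M := F.ampleLocusᶜ

end RLineBundle

end LineBundle

/-! ### The line bundles `𝒪(1)` on the projective line and `𝒪(E)` on the blowup -/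

theorem ProjLine.isOpen_hom (b : Bool) : IsOpen {l : ProjLine | hom l b ≠ 0} :=
  ProjLine.core.open_source' ⟨b, rfl⟩

/-- The line bundle `𝒪(1)` on the projective line, trivialized by each of the homogeneous coordinates
where it does not vanish. -/
noncomputable def hyperplaneBundle : HolLineBundle ℂ ProjLine where
  ι := Bool
  U b := {l | ProjLine.hom l b ≠ 0}
  g i j l := ProjLine.hom l j / ProjLine.hom l i
  isOpen_U := ProjLine.isOpen_hom
  iUnion_U := eq_univ_of_forall fun l => mem_iUnion.2 ⟨_, ProjLine.chart_cover l⟩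
  hol_g i j := by
    refine contMDiffOn_of_core ProjLine.core ProjLine.core_hol _ _ ?_
    rintro _ ⟨k, rfl⟩
    have hz : ∀ z, z ∈ (ProjLine.chart k).target ∩ (ProjLine.chart k).symm ⁻¹'
        ({l | ProjLine.hom l i ≠ 0} ∩ {l | ProjLine.hom l j ≠ 0}) →
        (k ≠ i ∨ k ≠ j → z ≠ 0) ∧ ProjLine.hom ((ProjLine.chart k).symm z) j /
        ProjLine.hom ((ProjLine.chart k).symm z) i =
          (if j = k then 1 else z) * (if i = k then 1 else z⁻¹) := by
      rintro z ⟨-, h1, h2⟩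
      obtain ⟨a, ha, h3, h4⟩ := ProjLine.hom_ofCoord k z
      change ProjLine.hom (ProjLine.ofCoord k z) i ≠ 0 at h1
      change ProjLine.hom (ProjLine.ofCoord k z) j ≠ 0 at h2
      change _ ∧ ProjLine.hom (ProjLine.ofCoord k z) j / ProjLine.hom (ProjLine.ofCoord k z) i = _
      cases i <;> cases j <;> cases k <;> simp_all <;> field_simp
    refine ContDiffOn.contMDiffOn ?_
    refine ContDiffOn.congr (f := fun z => (if j = k then 1 else z) * (if i = k then 1 else z⁻¹))
      ?_ fun z h => (hz z h).2
    refine ContDiffOn.mul ?_ ?_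
    · by_cases h : j = k
      · exact (contDiffOn_const (c := (1 : ℂ))).congr fun z _ => if_pos h
      · exact contDiffOn_id.congr fun z _ => if_neg h
    · by_cases h : i = k
      · exact (contDiffOn_const (c := (1 : ℂ))).congr fun z _ => if_pos h
      · simp only [if_neg h]
        exact contDiffOn_id.inv fun z hz0 => (hz z hz0).1 (Or.inl fun hk => h hk.symm)
  g_ne_zero i j l h := div_ne_zero h.2 h.1
  cocycle i j k l h := by
    have h1 : ProjLine.hom l i ≠ 0 := h.1.1
    have h2 : ProjLine.hom l j ≠ 0 := h.1.2
    field_simp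

namespace Blowup

variable {E : Type} [NormedAddCommGroup E] [NormedSpace ℂ E] {M : Type*} [TopologicalSpace M]
  [ChartedSpace E M] {q : M}

variable (E) in
/-- The domains of the local equations of the exceptional divisor. -/
def excDom (q : M) : Option (AffDir E) → Set (Blowup E q)
  | none => {b | down b ≠ q}
  | some a => {b | down b ∈ (chartAt E q).source ∧ a.f (dir b) ≠ 0}

/-- The local factors of the transition functions. -/
noncomputable def excFactor (b : Blowup E q) : Option (AffDir E) → ℂ
  | none => 1
  | some a => a.f (dir b)

theorem excFactor_ne {b : Blowup E q} {i : Option (AffDir E)} (h : b ∈ excDom E q i) :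
    excFactor b i ≠ 0 := by
  cases i with
  | none => exact one_ne_zero
  | some a => exact h.2

variable [IsManifold 𝓘(ℂ, E) ω M]

theorem excFactor_hol (i j : Option (AffDir E)) :
    ContMDiffOn 𝓘(ℂ, E) 𝓘(ℂ, ℂ) ω (fun b : Blowup E q => excFactor b i / excFactor b j)
      (excDom E q i ∩ excDom E q j) := by
  refine contMDiffOn_of_core (core E q) core_hol _ _ ?_
  rintro _ ⟨k, rfl⟩
  obtain ⟨ho, hd⟩ := contMDiffOn_down_symm k
  set T := (chart E q k).target ∩ (chart E q k).symm ⁻¹' (excDom E q i ∩ excDom E q j) with hT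
  have off : ∀ l : Option (AffDir E), (∀ y ∈ T, (chart E q k).symm y ∈ excDom E q l) →
      (∀ y ∈ T, down ((chart E q k).symm y) ≠ q) →
      ContMDiffOn 𝓘(ℂ, E) 𝓘(ℂ, ℂ) ω (fun y => excFactor ((chart E q k).symm y) l) T := by
    intro l hl hne
    cases l with
    | none => exact contMDiffOn_const
    | some a =>
      have h1 : ContMDiffOn 𝓘(ℂ, E) 𝓘(ℂ, E) ω
          (fun y => coord E q (down ((chart E q k).symm y))) T :=
        contMDiffOn_coord.comp (hd.mono inter_subset_left) fun y hy => (hl y hy).1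
      refine (a.f.contMDiff.comp_contMDiffOn h1).congr fun y hy => ?_
      change a.f (dir _) = a.f (coord E q _)
      rw [dir_of_ne (hne y hy)]
  have quot : (∀ y ∈ T, down ((chart E q k).symm y) ≠ q) →
      ContMDiffOn 𝓘(ℂ, E) 𝓘(ℂ, ℂ) ω
        (fun y => excFactor ((chart E q k).symm y) i / excFactor ((chart E q k).symm y) j) T := by
    intro hne
    have h1 := (off i (fun y hy => hy.2.1) hne).contDiffOn
    have h2 := (off j (fun y hy => hy.2.2) hne).contDiffOn
    exact (h1.div h2 fun y hy => excFactor_ne hy.2.2).contMDiffOn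
  cases k with
  | inr z =>
    refine quot fun y hy => ?_
    rw [chart, down_offChart_symm hy.1]
    exact hy.1.2
  | inl a =>
    cases i with
    | none => exact quot fun y hy => hy.2.1
    | some a₁ =>
      cases j with
      | none => exact quot fun y hy => hy.2.2
      | some a₂ =>
        have key : ∀ y ∈ T, a₂.f (a.lift y) ≠ 0 ∧
            a₁.f (dir ((chart E q (.inl a)).symm y)) / a₂.f (dir ((chart E q (.inl a)).symm y)) =
            a₁.f (a.lift y) / a₂.f (a.lift y) := by
          intro y hy
          obtain ⟨c, hc, hdir⟩ := dir_point (q := q) (a := a) (y := y) hy.1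
          have h2 : a₂.f (dir (point q a y)) ≠ 0 := hy.2.2.2
          change _ ∧ a₁.f (dir (point q a y)) / a₂.f (dir (point q a y)) = _
          rw [hdir, map_smul, smul_eq_mul] at h2
          rw [hdir, map_smul, map_smul, smul_eq_mul, smul_eq_mul, mul_div_mul_left _ _ hc]
          exact ⟨right_ne_zero_of_mul h2, rfl⟩
        have hf : ∀ a' : AffDir E, ContDiffOn ℂ ω (fun y => a'.f (a.lift y)) T := fun a' =>
          (a'.f.contDiff.comp a.contDiff_lift).contDiffOn
        exact (((hf a₁).div (hf a₂) fun y hy => (key y hy).1).congr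
          fun y hy => (key y hy).2).contMDiffOn

variable (E) in
/-- The line bundle `𝒪(E)` of the exceptional divisor, given by its local equations: `1` away from
the divisor, and `a.f (coord E q (down b))` on the domain attached to `a`. The transition functions
are the quotients of the local equations, `excFactor b i / excFactor b j`. -/
noncomputable def excBundle (q : M) : HolLineBundle E (Blowup E q) where
  ι := Option (AffDir E)
  U := excDom E q
  g i j b := excFactor b i / excFactor b j
  isOpen_U i := by
    cases i with
    | none => exact (isOpen_ne E q).preimage contMDiff_down.continuous
    | some a => exact (core E q).open_source' ⟨.inl a, rfl⟩
  iUnion_U := eq_univ_of_forall fun b => by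
    cases b with
    | off x hx => exact mem_iUnion.2 ⟨none, hx⟩
    | exc l =>
      obtain ⟨a, ha⟩ := AffDir.exists_of_ne l.rep_nonzero
      exact mem_iUnion.2 ⟨some a, mem_chart_source E q, ha⟩
  hol_g := excFactor_hol
  g_ne_zero i j b h := div_ne_zero (excFactor_ne h.1) (excFactor_ne h.2)
  cocycle i j k b h := by
    have h1 := excFactor_ne h.1.2
    have h2 := excFactor_ne h.2
    field_simp

end Blowup

/-! ### The blowup of `X × ℙ¹` at `(p, 0)` and the line bundle on it -/

section Main

variable {E : Type} [NormedAddCommGroup E] [NormedSpace ℂ E] {X : Type*} [TopologicalSpace X]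
  [ChartedSpace E X]

noncomputable instance : ChartedSpace (E × ℂ) (X × ProjLine) := prodChartedSpace E X ℂ ProjLine

instance [IsManifold 𝓘(ℂ, E) ω X] : IsManifold 𝓘(ℂ, E × ℂ) ω (X × ProjLine) := by
  rw [modelWithCornersSelf_prod]
  exact IsManifold.prod X ProjLine

theorem contMDiff_prFst : ContMDiff 𝓘(ℂ, E × ℂ) 𝓘(ℂ, E) ω (Prod.fst : X × ProjLine → X) := by
  rw [modelWithCornersSelf_prod]
  exact contMDiff_fst

theorem contMDiff_prSnd : ContMDiff 𝓘(ℂ, E × ℂ) 𝓘(ℂ, ℂ) ω (Prod.snd : X × ProjLine → ProjLine) := by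
  rw [modelWithCornersSelf_prod]
  exact contMDiff_snd

variable [IsManifold 𝓘(ℂ, E) ω X]

/-- The supremum of the real `c` such that `π^*L - c E` is pseudoeffective on the blowup `π` of `X`
at `p` with exceptional divisor `E`. -/
noncomputable def cMax (L : HolLineBundle E X) (p : X) : ℝ :=
  sSup {c : ℝ | (RLineBundle.of (L.pullback (Blowup.down : Blowup E p → X) Blowup.contMDiff_down) -
    c • RLineBundle.of (Blowup.excBundle E p)).IsPseudoeffective}

variable (E) in
/-- The blowup of `X × ℙ¹` at `(p, 0)`. -/
abbrev TotalSpace (p : X) : Type _ := Blowup (E × ℂ) ((p, ProjLine.zero) : X × ProjLine)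

/-- The `ℝ`-line bundle `pr₁^* L + (C_max + 1) pr₂^* 𝒪(1)` on `X × ℙ¹`. -/
noncomputable def baseBundle (L : HolLineBundle E X) (p : X) :
    RLineBundle (E × ℂ) (X × ProjLine) :=
  RLineBundle.of (L.pullback Prod.fst contMDiff_prFst) +
    (cMax L p + 1) • RLineBundle.of (hyperplaneBundle.pullback Prod.snd contMDiff_prSnd)

/-- Its pullback to the blowup, minus `C_max` times the exceptional divisor. -/
noncomputable def totalBundle (L : HolLineBundle E X) (p : X) :
    RLineBundle (E × ℂ) (TotalSpace E p) :=
  (baseBundle L p).pullback Blowup.down Blowup.contMDiff_down -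
    cMax L p • RLineBundle.of (Blowup.excBundle (E × ℂ) (p, ProjLine.zero))

variable (E) in
/-- The strict transform of the fiber `X × {0}`. -/
def fiberTransform (p : X) : Set (TotalSpace E p) :=
  Blowup.strictTransform {z | z.2 = ProjLine.zero}

variable (E) in
/-- The inclusion of the tangent space at `p` in the exceptional divisor, the projective space of
lines in `T_p X ⊕ ℂ`, by `v ↦ [v : 1]`. -/
noncomputable def tangentInclusion (p : X) (v : TangentSpace 𝓘(ℂ, E) p) : TotalSpace E p :=
  Blowup.exc (Projectivization.mk ℂ ((v, 1) : E × ℂ) fun h => one_ne_zero (Prod.mk.inj h).2)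

end Main

end CxGeom

open CxGeom

/-!
Write `C` for `C_max`, `π` for the blowdown map and `X̃` for the strict transform of `X × {0}`. An
ample line bundle has a smooth positive metric (`HolLineBundle.IsAmple.exists_metric`), so in both
cases `L` has a singular strictly positive metric `h` which is smooth near `p`. The theorem is proved
by exhibiting one metric of `totalBundle L p`, and by restricting metrics to submanifolds.

*Positive metrics on blowups.* If sections embed `X` by a line bundle `B`, then the combinations that
vanish at `p` are sections of `π^*B - E`, and their products with all sections embed `Bl_pX` by
`2π^*B - E` (`Blowup.blowBundle_embedsBy`). The potentials `log ∑ |s_a|²` provide a metric `α` of `B`,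
a metric `η` of `E` and a positive metric `σ = 2π^*α - η` (`Blowup.exists_metrics`). The same applies to
the blowup of `X × ℙ¹`, which is embedded by `B ⊠ 𝒪(1)`. A function with positive Levi form has
pluriharmonic supports from below (`LeviPosAt.supportedAt`), and adding such a function preserves
plurisubharmonicity (`PSHOn.add_supported`). With compactness this shows that a strictly positive
metric stays plurisubharmonic after adding a small multiple of any smooth metric
(`RLineBundle.SingPosMetric.IsStrictlyPositive.exists_psh_add`).

*The number `C` is positive and finite.* The metric `(h - 2δα) + δσ` of `π^*L - δE` shows that `C > 0`
(`exists_pseudoeffective`). If `π^*L - cE` were pseudoeffective for arbitrarily large `c`, normalize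
the weights away from `p` to have supremum zero on the complement of a ball around `p`. By the maximum
principle on the lifts of the lines through `p`, they are bounded by `c log |z|²` up to constants, and
tend to `-∞` uniformly near `p` (`offWeight_le_of_sphere`). Hadamard's three circles theorem
(`PSHOn.three_circles`, `PSHOn.propagate`) carries this along the connected manifold `X`
(`tendsto_bot_of_near`), which contradicts the normalization (`bddAbove_pseudoeffective`).

*The upper bound of the augmented base locus.* The coordinate of `ℙ¹` vanishing at `0` defines a
section `w` of `𝒪(1) - 𝓔` whose zero set is exactly `X̃` (`stSection_eq_zero_iff`,
`fiberTransform_eq`). With the Fubini–Study metric `φ` of `𝒪(1)`, the weight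
`h + (1 + δ)φ - δη + (C - δ) log |w|²` is a metric of `totalBundle L p`. Since it equals
`(h - 2δα) + (1 - δ)φ + δσ + (C - δ) log |w|²`, it dominates `δσ` for small `δ > 0`; it is smooth off
`X̃` where `h` is (`totalPhi_psh_sub`, `exists_total_metric`). Hence `totalBundle L p` is big, and the
points off `X̃` over the ample locus of `L` are in its ample locus. The tangent space `T_pX` does not
meet `X̃` (`tangentInclusion_not_mem`).

*The lower bound.* A strictly positive metric restricts to a strictly positive metric of `L` on
`X × {τ}`, `τ ≠ 0` (`fst_mem_ampleLocus`), and of `π^*L - CE` on `X̃ ≅ Bl_pX`. In the second case it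
cannot be finite at any point, since otherwise `π^*L - (C + ε)E` would be pseudoeffective for some
`ε > 0` (`stMap_not_mem_ampleLocus`). The points of the exceptional divisor lie over `p`, which is in
the ample locus of `L`.
-/

namespace CxGeom

/-! ### Holomorphic discs, pluriharmonic functions and plurisubharmonic functions -/

section PSH

variable {E : Type*} [NormedAddCommGroup E] [NormedSpace ℂ E] {M : Type*}
  [TopologicalSpace M] [ChartedSpace E M]
  {E' : Type*} [NormedAddCommGroup E'] [NormedSpace ℂ E'] {N : Type*}
  [TopologicalSpace N] [ChartedSpace E' N]

theorem IsHolDisc.comp {γ : ℂ → M} {x : M} (hγ : IsHolDisc E γ x) {f : M → N}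
    (hf : ContMDiffAt 𝓘(ℂ, E) 𝓘(ℂ, E') ω f x) : IsHolDisc E' (f ∘ γ) (f x) := by
  obtain ⟨h, rfl⟩ := hγ
  exact ⟨hf.comp 0 h, rfl⟩

theorem IsHolDisc.continuousAt {γ : ℂ → M} {x : M} (hγ : IsHolDisc E γ x) :
    ContinuousAt γ 0 := hγ.1.continuousAt

theorem IsHolDisc.tendsto {γ : ℂ → M} {x : M} (hγ : IsHolDisc E γ x) :
    Tendsto γ (𝓝 0) (𝓝 x) := by
  have := hγ.continuousAt.tendsto
  rwa [hγ.2] at this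

theorem IsHolDisc.eventually_continuousAt [IsManifold 𝓘(ℂ, E) ω M] {γ : ℂ → M} {x : M}
    (hγ : IsHolDisc E γ x) : ∀ᶠ ζ in 𝓝 (0 : ℂ), ContinuousAt γ ζ :=
  ((contMDiffAt_iff_contMDiffAt_nhds (by simp)).1 hγ.1).mono fun _ h => h.continuousAt

theorem analyticAt_of_contMDiffAt {F : Type*} [NormedAddCommGroup F] [NormedSpace ℂ F]
    {g : ℂ → F} {z : ℂ} (h : ContMDiffAt 𝓘(ℂ, ℂ) 𝓘(ℂ, F) ω g z) : AnalyticAt ℂ g z :=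
  h.contDiffAt.analyticAt

variable (E) in
/-- A real function is pluriharmonic at a point if it is harmonic along all holomorphic discs
through the point. -/
def PluriharmonicAt (h : M → ℝ) (x : M) : Prop :=
  ∀ γ : ℂ → M, IsHolDisc E γ x → InnerProductSpace.HarmonicAt (h ∘ γ) 0

theorem PluriharmonicAt.add {f g : M → ℝ} {x : M} (hf : PluriharmonicAt E f x)
    (hg : PluriharmonicAt E g x) : PluriharmonicAt E (fun y => f y + g y) x :=
  fun γ hγ => (hf γ hγ).add (hg γ hγ)

theorem PluriharmonicAt.const_mul {f : M → ℝ} {x : M} (hf : PluriharmonicAt E f x) (c : ℝ) :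
    PluriharmonicAt E (fun y => c * f y) x :=
  fun γ hγ => (hf γ hγ).const_smul (c := c)

theorem PluriharmonicAt.comp {f : N → ℝ} {F : M → N} {x : M} (hf : PluriharmonicAt E' f (F x))
    (hF : ContMDiffAt 𝓘(ℂ, E) 𝓘(ℂ, E') ω F x) : PluriharmonicAt E (f ∘ F) x :=
  fun γ hγ => hf (F ∘ γ) (hγ.comp hF)

theorem PluriharmonicAt.congr {f g : M → ℝ} {x : M} (hf : PluriharmonicAt E f x)
    (h : f =ᶠ[𝓝 x] g) : PluriharmonicAt E g x := fun γ hγ =>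
  (InnerProductSpace.harmonicAt_congr_nhds (h.comp_tendsto hγ.tendsto)).1 (hf γ hγ)

/-- The logarithm of the modulus of a nowhere vanishing holomorphic function is pluriharmonic, so
changes of trivialization affect weights by pluriharmonic terms only. -/
theorem pluriharmonicAt_log_norm_sq {g : M → ℂ} {x : M}
    (hg : ContMDiffAt 𝓘(ℂ, E) 𝓘(ℂ, ℂ) ω g x) (h0 : g x ≠ 0) :
    PluriharmonicAt E (fun y => Real.log (‖g y‖ ^ 2)) x := by
  rintro γ ⟨h, rfl⟩
  have := (analyticAt_of_contMDiffAt (hg.comp 0 h)).harmonicAt_log_norm h0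
  have h2 := this.const_smul (c := 2)
  convert h2 using 1
  ext z
  simp [Real.log_pow]

variable (E) in
/-- The function `f` is continuous at `x` and has a pluriharmonic support function there: a
pluriharmonic function below `f` near `x` which agrees with `f` at `x`. -/
def SupportedAt (f : M → ℝ) (x : M) : Prop :=
  ContinuousAt f x ∧ ∃ h : M → ℝ, h x = f x ∧ (∀ᶠ y in 𝓝 x, h y ≤ f y) ∧ PluriharmonicAt E h x

theorem SupportedAt.add {f g : M → ℝ} {x : M} (hf : SupportedAt E f x)
    (hg : SupportedAt E g x) : SupportedAt E (fun y => f y + g y) x := by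
  obtain ⟨hc, h, h1, h2, h3⟩ := hf
  obtain ⟨hc', h', h1', h2', h3'⟩ := hg
  refine ⟨hc.add hc', fun y => h y + h' y, by simp [h1, h1'], ?_, h3.add h3'⟩
  filter_upwards [h2, h2'] with y a b using add_le_add a b

theorem SupportedAt.const_mul {f : M → ℝ} {x : M} (hf : SupportedAt E f x) {c : ℝ}
    (hc : 0 ≤ c) : SupportedAt E (fun y => c * f y) x := by
  obtain ⟨hcf, h, h1, h2, h3⟩ := hf
  refine ⟨continuousAt_const.mul hcf, fun y => c * h y, by simp [h1], ?_, h3.const_mul c⟩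
  filter_upwards [h2] with y a using mul_le_mul_of_nonneg_left a hc

theorem SupportedAt.comp {f : N → ℝ} {F : M → N} {x : M} (hf : SupportedAt E' f (F x))
    (hF : ContMDiffAt 𝓘(ℂ, E) 𝓘(ℂ, E') ω F x) : SupportedAt E (f ∘ F) x := by
  obtain ⟨hc, h, h1, h2, h3⟩ := hf
  exact ⟨hc.comp hF.continuousAt, h ∘ F, h1, hF.continuousAt.eventually h2, h3.comp hF⟩

theorem SupportedAt.congr {f g : M → ℝ} {x : M} (hf : SupportedAt E f x)
    (hfg : f =ᶠ[𝓝 x] g) : SupportedAt E g x := by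
  obtain ⟨hc, h, h1, h2, h3⟩ := hf
  refine ⟨hc.congr hfg, h, h1.trans hfg.self_of_nhds, ?_, h3⟩
  filter_upwards [h2, hfg] with y a b using b ▸ a

theorem PluriharmonicAt.supportedAt {f : M → ℝ} {x : M} (hf : PluriharmonicAt E f x)
    (hc : ContinuousAt f x) : SupportedAt E f x :=
  ⟨hc, f, rfl, Eventually.of_forall fun _ => le_rfl, hf⟩

/-- Pluriharmonic functions being their own supports, the coefficient `c` may have any sign. -/
theorem supportedAt_log_norm_sq {g : M → ℂ} {x : M}
    (hg : ContMDiffAt 𝓘(ℂ, E) 𝓘(ℂ, ℂ) ω g x) (h0 : g x ≠ 0) (c : ℝ) :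
    SupportedAt E (fun y => c * Real.log (‖g y‖ ^ 2)) x := by
  refine ((pluriharmonicAt_log_norm_sq hg h0).const_mul c).supportedAt ?_
  refine continuousAt_const.mul (ContinuousAt.log (hg.continuousAt.norm.pow 2) ?_)
  simpa using h0

variable (E) in
/-- Plurisubharmonicity at a point: upper semicontinuity, finiteness from above, and the submean
value property along the holomorphic discs centered at the point. -/
def PSHAt (u : M → EReal) (x : M) : Prop :=
  UpperSemicontinuousAt u x ∧ u x < ⊤ ∧
  ∀ γ : ℂ → M, IsHolDisc E γ x → ∃ ρ > 0, ∀ r, 0 < r → r < ρ → ∀ N : ℝ,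
    u x ≤ (Real.circleAverage (fun ζ => (max (u (γ ζ)) (N : EReal)).toReal) 0 r : ℝ)

/-- Plurisubharmonicity on an open set is a pointwise condition, which depends only on germs. -/
theorem pshOn_iff {u : M → EReal} {U : Set M} (hU : IsOpen U) :
    PSHOn E u U ↔ ∀ x ∈ U, PSHAt E u x := by
  constructor
  · intro h x hx
    refine ⟨fun y hy => ?_, h.lt_top x hx, h.submean x hx⟩
    have := h.usc x hx y hy
    rwa [hU.nhdsWithin_eq hx] at this
  · intro h
    exact ⟨fun x hx => (h x hx).1.upperSemicontinuousWithinAt U, fun x hx => (h x hx).2.1,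
      fun x hx => (h x hx).2.2⟩

theorem PSHOn.eventually {u : M → EReal} {U : Set M} (h : PSHOn E u U) (hU : IsOpen U) {x : M}
    (hx : x ∈ U) : ∀ᶠ y in 𝓝 x, PSHAt E u y := by
  filter_upwards [hU.mem_nhds hx] with y hy using (pshOn_iff hU).1 h y hy

theorem exists_sphere_of_eventually {P : ℂ → Prop} (h : ∀ᶠ z in 𝓝 (0 : ℂ), P z) :
    ∃ ρ > 0, ∀ z, ‖z‖ < ρ → P z := by
  obtain ⟨ρ, hρ, h⟩ := Metric.eventually_nhds_iff.1 h
  exact ⟨ρ, hρ, fun z hz => h (by simpa using hz)⟩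

theorem PSHAt.congr {u v : M → EReal} {x : M} (hu : PSHAt E u x) (h : u =ᶠ[𝓝 x] v) :
    PSHAt E v x := by
  obtain ⟨h1, h2, h3⟩ := hu
  have hx : u x = v x := h.self_of_nhds
  refine ⟨fun y hy => ?_, hx ▸ h2, fun γ hγ => ?_⟩
  · change v x < y at hy
    rw [← hx] at hy
    filter_upwards [h1 y hy, h] with z a b using b ▸ a
  · obtain ⟨ρ, hρ, H⟩ := h3 γ hγ
    obtain ⟨ρ', hρ', H'⟩ := exists_sphere_of_eventually (hγ.tendsto.eventually h)
    refine ⟨min ρ ρ', lt_min hρ hρ', fun r hr hr' N => ?_⟩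
    rw [← hx]
    refine (H r hr (hr'.trans_le (min_le_left _ _)) N).trans_eq ?_
    congr 1
    refine Real.circleAverage_congr_sphere fun z hz => ?_
    have : u (γ z) = v (γ z) := H' z (by
      rw [mem_sphere_zero_iff_norm.1 hz, abs_of_pos hr]
      exact hr'.trans_le (min_le_right _ _))
    simp only [this]

theorem PSHAt.comp {u : N → EReal} {F : M → N} {x : M} (hu : PSHAt E' u (F x))
    (hF : ContMDiffAt 𝓘(ℂ, E) 𝓘(ℂ, E') ω F x) : PSHAt E (u ∘ F) x :=
  ⟨fun y hy => hF.continuousAt.eventually (hu.1 y hy), hu.2.1,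
    fun γ hγ => hu.2.2 (F ∘ γ) (hγ.comp hF)⟩

/-- Truncations of upper semicontinuous functions are integrable on circles. -/
theorem circleIntegrable_trunc {w : ℂ → EReal} {r : ℝ} (hr : 0 ≤ r)
    (hw : ∀ z, ‖z‖ = r → UpperSemicontinuousAt w z)
    (htop : ∀ z, ‖z‖ = r → w z < ⊤) (N : ℝ) :
    CircleIntegrable (fun ζ => (max (w ζ) (N : EReal)).toReal) 0 r := by
  have hn : ∀ θ, ‖circleMap 0 r θ‖ = r := fun θ => by
    simp [abs_of_nonneg hr]
  have husc : UpperSemicontinuous fun θ => w (circleMap 0 r θ) := fun θ y hy =>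
    (continuous_circleMap 0 r).continuousAt.eventually (hw _ (hn θ) y hy)
  have hmeas : Measurable fun θ => (max (w (circleMap 0 r θ)) (N : EReal)).toReal :=
    (husc.measurable.max measurable_const).ereal_toReal
  obtain ⟨z, hz, hmax⟩ := UpperSemicontinuousOn.exists_isMaxOn (s := Metric.sphere (0 : ℂ) r)
    (f := w) (NormedSpace.sphere_nonempty.2 hr) (isCompact_sphere 0 r)
    (fun z hz => (hw z (by simpa using hz)).upperSemicontinuousWithinAt _)
  have hb : ∀ θ, |(max (w (circleMap 0 r θ)) (N : EReal)).toReal| ≤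
      max |(max (w z) (N : EReal)).toReal| |N| := by
    intro θ
    have h1 : w (circleMap 0 r θ) ≤ w z := hmax (by simp [abs_of_nonneg hr])
    have h2 : max (w z) (N : EReal) ≠ ⊤ :=
      (max_lt (htop z (by simpa using hz)) (EReal.coe_lt_top N)).ne
    have h3 : max (w (circleMap 0 r θ)) (N : EReal) ≤ max (w z) (N : EReal) :=
      max_le_max h1 le_rfl
    have h4 : (N : EReal) ≤ max (w (circleMap 0 r θ)) (N : EReal) := le_max_right _ _
    have h5 : max (w (circleMap 0 r θ)) (N : EReal) ≠ ⊥ :=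
      ne_bot_of_le_ne_bot (EReal.coe_ne_bot N) h4
    have h6 := EReal.toReal_le_toReal h3 h5 h2
    have h7 := EReal.toReal_le_toReal h4 (EReal.coe_ne_bot N) (ne_top_of_le_ne_top h2 h3)
    rw [EReal.toReal_coe] at h7
    exact abs_le_max_abs_abs h7 h6 |>.trans_eq (max_comm _ _)
  refine (intervalIntegrable_iff.2 ?_)
  refine MeasureTheory.Measure.integrableOn_of_bounded (M := max |(max (w z) (N : EReal)).toReal| |N|)
    (by simp [ENNReal.mul_eq_top]) hmeas.aestronglyMeasurable ?_
  exact Eventually.of_forall hb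

/-- The sum of a plurisubharmonic function and a function with pluriharmonic supports is
plurisubharmonic: the mean value property holds for the support function, which bounds the second
summand from below. -/
theorem PSHAt.add_supported [IsManifold 𝓘(ℂ, E) ω M] {u : M → EReal} {f : M → ℝ} {x : M}
    (hu : ∀ᶠ y in 𝓝 x, PSHAt E u y) (hf : ∀ᶠ y in 𝓝 x, SupportedAt E f y) :
    PSHAt E (fun y => u y + (f y : EReal)) x := by
  have husc : ∀ y, PSHAt E u y → SupportedAt E f y →
      UpperSemicontinuousAt (fun y => u y + (f y : EReal)) y := fun y h1 h2 => by
    refine h1.1.add' (ContinuousAt.upperSemicontinuousAt ?_) ?_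
    · exact (continuous_coe_real_ereal.continuousAt).comp h2.1
    · exact EReal.continuousAt_add (Or.inr (EReal.coe_ne_bot _)) (Or.inr (EReal.coe_ne_top _))
  have htop : ∀ y, PSHAt E u y → u y + (f y : EReal) < ⊤ := fun y h1 =>
    EReal.add_lt_top h1.2.1.ne (EReal.coe_ne_top _)
  refine ⟨husc x hu.self_of_nhds hf.self_of_nhds, htop x hu.self_of_nhds, fun γ hγ => ?_⟩
  obtain ⟨hfc, h, h1, h2, h3⟩ := hf.self_of_nhds
  obtain ⟨ρ, hρ, H⟩ := hu.self_of_nhds.2.2 γ hγ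
  have hharm := h3 γ hγ
  obtain ⟨ρ', hρ', H'⟩ := exists_sphere_of_eventually
    (((((hγ.tendsto.eventually h2).and (hγ.tendsto.eventually hu)).and
      (hγ.tendsto.eventually hf)).and hγ.eventually_continuousAt).and hharm.eventually)
  -- on small circles both functions are controlled at every point of the circle
  refine ⟨min ρ ρ', lt_min hρ hρ', fun r hr hr' N => ?_⟩
  have hrρ' : r < ρ' := hr'.trans_le (min_le_right _ _)
  have hcont : ContinuousOn (h ∘ γ) (Metric.sphere 0 r) := fun z hz =>
    (H' z (by rwa [mem_sphere_zero_iff_norm.1 hz])).2.1.continuousAt.continuousWithinAt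
  obtain ⟨B, hB⟩ := (isCompact_sphere (0 : ℂ) r).exists_bound_of_continuousOn hcont
  have hmean : Real.circleAverage (h ∘ γ) 0 r = h x := by
    rw [InnerProductSpace.HarmonicOnNhd.circleAverage_eq, Function.comp, hγ.2]
    intro z hz
    refine (H' z ?_).2
    rw [mem_closedBall_zero_iff, abs_of_pos hr] at hz
    exact hz.trans_lt hrρ'
  -- `h ≤ B` on the circle, so truncating `u` at `N - B` bounds the truncation of the sum at `N`
  have key := H r hr (hr'.trans_le (min_le_left _ _)) (N - B)
  have hm : ∀ z, ‖z‖ = r → _ := fun z hz => H' z (hz ▸ hrρ')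
  have hI1 : CircleIntegrable (fun ζ => (max (u (γ ζ)) ((N - B : ℝ) : EReal)).toReal) 0 r :=
    circleIntegrable_trunc (w := u ∘ γ) hr.le
      (fun z hz y hy => (hm z hz).1.2.eventually ((hm z hz).1.1.1.2.1 y hy))
      (fun z hz => (hm z hz).1.1.1.2.2.1) _
  have hI2 : CircleIntegrable (h ∘ γ) 0 r := hcont.circleIntegrable hr.le
  have hI3 : CircleIntegrable
      (fun ζ => (max (u (γ ζ) + (f (γ ζ) : EReal)) (N : EReal)).toReal) 0 r :=
    circleIntegrable_trunc (w := (fun y => u y + (f y : EReal)) ∘ γ) hr.le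
      (fun z hz y hy => (hm z hz).1.2.eventually
        (husc _ (hm z hz).1.1.1.2 (hm z hz).1.1.2 y hy))
      (fun z hz => htop _ (hm z hz).1.1.1.2) _
  have hle : Real.circleAverage (fun ζ => (max (u (γ ζ)) ((N - B : ℝ) : EReal)).toReal) 0 r + h x ≤
      Real.circleAverage (fun ζ => (max (u (γ ζ) + (f (γ ζ) : EReal)) (N : EReal)).toReal) 0 r := by
    rw [← hmean, ← Real.circleAverage_add hI1 hI2]
    refine Real.circleAverage_mono (hI1.add hI2) hI3 fun z hz => ?_
    rw [mem_sphere_zero_iff_norm, abs_of_pos hr] at hz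
    have hBz : h (γ z) ≤ B := (le_abs_self _).trans (hB z (by simpa using hz))
    have hfz : h (γ z) ≤ f (γ z) := (hm z hz).1.1.1.1
    have hut : u (γ z) < ⊤ := (hm z hz).1.1.1.2.2.1
    change (max (u (γ z)) ((N - B : ℝ) : EReal)).toReal + h (γ z) ≤ _
    induction hw : u (γ z) with
    | top => exact absurd hw hut.ne
    | bot =>
      simp only [bot_le, sup_of_le_right, EReal.toReal_coe, EReal.bot_add]
      linarith
    | coe a =>
      rw [← EReal.coe_add, ← EReal.coe_strictMono.monotone.map_max,
        ← EReal.coe_strictMono.monotone.map_max, EReal.toReal_coe, EReal.toReal_coe]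
      rcases le_total a (N - B) with h' | h'
      · rw [max_eq_right h']
        exact le_max_of_le_right (by linarith)
      · rw [max_eq_left h']
        exact le_max_of_le_left (by linarith)
  calc u x + (f x : EReal) = u x + (h x : EReal) := by rw [h1]
    _ ≤ _ + (h x : EReal) := add_le_add_left key _
    _ ≤ _ := by rw [← EReal.coe_add]; exact_mod_cast hle

theorem PSHOn.add_supported [IsManifold 𝓘(ℂ, E) ω M] {u : M → EReal} {f : M → ℝ} {U : Set M}
    (hU : IsOpen U) (hu : PSHOn E u U) (hf : ∀ x ∈ U, SupportedAt E f x) :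
    PSHOn E (fun y => u y + (f y : EReal)) U :=
  (pshOn_iff hU).2 fun _ hx => PSHAt.add_supported (hu.eventually hU hx)
    (by filter_upwards [hU.mem_nhds hx] with y hy using hf y hy)

theorem PSHOn.congr {u v : M → EReal} {U : Set M} (hU : IsOpen U) (hu : PSHOn E u U)
    (h : ∀ x ∈ U, u x = v x) : PSHOn E v U :=
  (pshOn_iff hU).2 fun x hx => ((pshOn_iff hU).1 hu x hx).congr
    (by filter_upwards [hU.mem_nhds hx] with y hy using h y hy)

theorem PSHOn.comp {u : N → EReal} {V : Set N} (hV : IsOpen V) (hu : PSHOn E' u V) {F : M → N}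
    {U : Set M} (hU : IsOpen U) (hF : ContMDiffOn 𝓘(ℂ, E) 𝓘(ℂ, E') ω F U) (hm : MapsTo F U V) :
    PSHOn E (fun x => u (F x)) U :=
  (pshOn_iff hU).2 fun x hx => ((pshOn_iff hV).1 hu (F x) (hm hx)).comp
    (hF.contMDiffAt (hU.mem_nhds hx))

theorem PSHOn.mono {u : M → EReal} {U V : Set M} (hu : PSHOn E u U) (h : V ⊆ U) :
    PSHOn E u V :=
  ⟨hu.usc.mono h, fun x hx => hu.lt_top x (h hx), fun x hx => hu.submean x (h hx)⟩

theorem PSHOn.of_cover {κ : Type*} {u : M → EReal} {U : Set M} {V : κ → Set M} (hU : IsOpen U)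
    (hV : ∀ a, IsOpen (V a)) (hcov : ⋃ a, V a = univ) (h : ∀ a, PSHOn E u (U ∩ V a)) :
    PSHOn E u U :=
  (pshOn_iff hU).2 fun x hx => by
    obtain ⟨a, ha⟩ := mem_iUnion.1 (hcov ▸ mem_univ x)
    exact (pshOn_iff (hU.inter (hV a))).1 (h a) x ⟨hx, ha⟩

open Classical in
/-- `u + c log |w|²`, with the value `-∞` at the zeros of `w`. -/
noncomputable def addLogSq (u : M → EReal) (c : ℝ) (w : M → ℂ) (x : M) : EReal :=
  if w x = 0 then ⊥ else u x + ((c * Real.log (‖w x‖ ^ 2) : ℝ) : EReal)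

/-- Adding the weight `c log |w|²` of a holomorphic section preserves plurisubharmonicity. -/
theorem PSHOn.addLogSq [IsManifold 𝓘(ℂ, E) ω M] {u : M → EReal} {U : Set M} (hU : IsOpen U)
    (hu : PSHOn E u U) {w : M → ℂ} (hw : ContMDiffOn 𝓘(ℂ, E) 𝓘(ℂ, ℂ) ω w U) {c : ℝ} (hc : 0 < c) :
    PSHOn E (addLogSq u c w) U := by
  rw [pshOn_iff hU]
  intro x hx
  have hwx := hw.contMDiffAt (hU.mem_nhds hx)
  by_cases h0 : w x = 0
  · have hval : CxGeom.addLogSq u c w x = ⊥ := if_pos h0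
    refine ⟨fun y hy => ?_, by rw [hval]; exact bot_lt_top, fun γ _ => ⟨1, one_pos, fun r _ _ N => by
      rw [hval]; exact bot_le⟩⟩
    change CxGeom.addLogSq u c w x < y at hy
    rw [hval] at hy
    obtain ⟨B, hB1, -⟩ := EReal.lt_iff_exists_real_btwn.1 ((pshOn_iff hU).1 hu x hx).2.1
    obtain ⟨y', -, hy'⟩ := EReal.lt_iff_exists_real_btwn.1 hy
    -- at a zero of `w` only the upper semicontinuity has a content: the sum tends to `-∞`
    have hlim : Tendsto (fun z => Real.log ‖w z‖) (𝓝 x ⊓ 𝓟 {z | w z ≠ 0}) atBot := by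
      refine Real.tendsto_log_nhdsNE_zero.comp (tendsto_nhdsWithin_iff.2 ⟨?_, ?_⟩)
      · have := hwx.continuousAt.norm.tendsto
        rw [h0, norm_zero] at this
        exact this.mono_left inf_le_left
      · filter_upwards [mem_inf_of_right (mem_principal_self {z | w z ≠ 0})] with z hz
        simpa using hz
    have hev : ∀ᶠ z in 𝓝 x, w z ≠ 0 → Real.log ‖w z‖ < (y' - B) / (2 * c) := by
      have := hlim.eventually_lt_atBot ((y' - B) / (2 * c))
      rwa [Filter.eventually_inf_principal] at this
    filter_upwards [hev, ((pshOn_iff hU).1 hu x hx).1 B hB1] with z h1 h2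
    by_cases hz : w z = 0
    · rw [CxGeom.addLogSq, if_pos hz]; exact hy
    · rw [CxGeom.addLogSq, if_neg hz]
      refine lt_of_le_of_lt ?_ hy'
      have h3 := h1 hz
      rw [lt_div_iff₀ (by positivity)] at h3
      calc u z + ((c * Real.log (‖w z‖ ^ 2) : ℝ) : EReal)
          ≤ (B : EReal) + ((c * Real.log (‖w z‖ ^ 2) : ℝ) : EReal) := by gcongr
        _ ≤ (y' : EReal) := by
          rw [← EReal.coe_add, EReal.coe_le_coe_iff, Real.log_pow]
          push_cast
          nlinarith
  · have hne : ∀ᶠ y in 𝓝 x, w y ≠ 0 := hwx.continuousAt.eventually_ne h0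
    refine PSHAt.congr (PSHAt.add_supported (f := fun y => c * Real.log (‖w y‖ ^ 2))
      (hu.eventually hU hx) ?_) ?_
    · filter_upwards [hne, hU.mem_nhds hx] with y hy hyU
      exact supportedAt_log_norm_sq (hw.contMDiffAt (hU.mem_nhds hyU)) hy c
    · filter_upwards [hne] with y hy
      rw [CxGeom.addLogSq, if_neg hy]

end PSH

/-! ### The Levi form in coordinates -/

section Levi

variable {E : Type*} [NormedAddCommGroup E] [NormedSpace ℂ E] {M : Type*}
  [TopologicalSpace M] [ChartedSpace E M]
  {E' : Type*} [NormedAddCommGroup E'] [NormedSpace ℂ E'] {N : Type*}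
  [TopologicalSpace N] [ChartedSpace E' N]

theorem contMDiffAt_real {f : M → N} {x : M} (h : ContMDiffAt 𝓘(ℂ, E) 𝓘(ℂ, E') ω f x) :
    ContMDiffAt 𝓘(ℝ, E) 𝓘(ℝ, E') ∞ f x := by
  rw [contMDiffAt_iff] at h ⊢
  exact ⟨h.1, (h.2.restrict_scalars ℝ).of_le (by simp)⟩

theorem contDiffAt_comp_disc {f : M → ℝ} {x : M} (hf : ContMDiffAt 𝓘(ℝ, E) 𝓘(ℝ, ℝ) ∞ f x)
    {γ : ℂ → M} (hγ : IsHolDisc E γ x) : ContDiffAt ℝ 2 (f ∘ γ) 0 := by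
  obtain ⟨h, rfl⟩ := hγ
  exact ((hf.comp 0 (contMDiffAt_real h)).contDiffAt).of_le
    (WithTop.coe_le_coe.2 (le_top : (2 : ℕ∞) ≤ ⊤))

theorem levi_add {f g : M → ℝ} {x : M} (hf : ContMDiffAt 𝓘(ℝ, E) 𝓘(ℝ, ℝ) ∞ f x)
    (hg : ContMDiffAt 𝓘(ℝ, E) 𝓘(ℝ, ℝ) ∞ g x) {γ : ℂ → M} (hγ : IsHolDisc E γ x) :
    levi (fun y => f y + g y) γ = levi f γ + levi g γ :=
  (contDiffAt_comp_disc hf hγ).laplacian_add (contDiffAt_comp_disc hg hγ)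

theorem levi_const_mul {f : M → ℝ} {x : M} (hf : ContMDiffAt 𝓘(ℝ, E) 𝓘(ℝ, ℝ) ∞ f x) (c : ℝ)
    {γ : ℂ → M} (hγ : IsHolDisc E γ x) : levi (fun y => c * f y) γ = c * levi f γ :=
  InnerProductSpace.laplacian_smul c (contDiffAt_comp_disc hf hγ)

theorem levi_add_mul {f g : M → ℝ} {x : M} (hf : ContMDiffAt 𝓘(ℝ, E) 𝓘(ℝ, ℝ) ∞ f x)
    (hg : ContMDiffAt 𝓘(ℝ, E) 𝓘(ℝ, ℝ) ∞ g x) (s : ℝ) {γ : ℂ → M} (hγ : IsHolDisc E γ x) :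
    levi (fun y => f y + s * g y) γ = levi f γ + s * levi g γ := by
  have h : ContMDiffAt 𝓘(ℝ, E) 𝓘(ℝ, ℝ) ∞ (fun y => s * g y) x := contMDiffAt_const.mul hg
  rw [levi_add hf h hγ, levi_const_mul hg s hγ]

theorem levi_of_pluriharmonicAt {f : M → ℝ} {x : M} (h : PluriharmonicAt E f x) {γ : ℂ → M}
    (hγ : IsHolDisc E γ x) : levi f γ = 0 := (h γ hγ).2.self_of_nhds

/-- The complex Hessian (up to a factor) of a real function on `E`, as a Hermitian quadratic
form. -/
noncomputable def hessC (g : E → ℝ) (y v : E) : ℝ :=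
  fderiv ℝ (fderiv ℝ g) y v v + fderiv ℝ (fderiv ℝ g) y (Complex.I • v) (Complex.I • v)

/-- The Laplacian of the restriction of a function to a holomorphic disc only involves the velocity
of the disc: the contributions of its second derivative in the directions `1` and `i` cancel. -/
theorem laplacian_comp_holomorphic [CompleteSpace E] {g : E → ℝ} {c : ℂ → E} {z : ℂ}
    (hg : ContDiffAt ℝ 2 g (c z)) (hc : AnalyticAt ℂ c z) :
    Laplacian.laplacian (g ∘ c) z = hessC g (c z) (deriv c z) := by
  rw [InnerProductSpace.laplacian_eq_iteratedFDeriv_complexPlane]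
  simp only [iteratedFDeriv_two_apply, Matrix.cons_val_zero, Matrix.cons_val_one]
  have hF : ContDiffAt ℝ 2 (g ∘ c) z :=
    hg.comp z (hc.contDiffAt.restrict_scalars ℝ)
  have hdF : DifferentiableAt ℝ (fderiv ℝ (g ∘ c)) z :=
    ((hF.fderiv_right (m := 1) (by norm_num)).differentiableAt (by norm_num))
  have hdg : DifferentiableAt ℝ (fderiv ℝ g) (c z) :=
    ((hg.fderiv_right (m := 1) (by norm_num)).differentiableAt (by norm_num))
  have hcz : ∀ᶠ w in 𝓝 z, HasFDerivAt c
      (((ContinuousLinearMap.toSpanSingleton ℂ (deriv c w)).restrictScalars ℝ) : ℂ →L[ℝ] E) w := by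
    filter_upwards [hc.eventually_analyticAt] with w hw
    exact hw.differentiableAt.hasDerivAt.hasFDerivAt.restrictScalars ℝ
  have hgz : ∀ᶠ w in 𝓝 z, DifferentiableAt ℝ g (c w) :=
    hc.continuousAt.eventually ((hg.eventually (by norm_num)).mono
      fun w hw => hw.differentiableAt (by norm_num))
  -- the second term for `k = 1` and `k = i` has opposite signs
  have key : ∀ k : ℂ, fderiv ℝ (fderiv ℝ (g ∘ c)) z k k =
      fderiv ℝ (fderiv ℝ g) (c z) (k • deriv c z) (k • deriv c z) +
        fderiv ℝ g (c z) ((k * k) • deriv (deriv c) z) := by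
    intro k
    have h1 : (fun w => fderiv ℝ (g ∘ c) w k) =ᶠ[𝓝 z]
        fun w => fderiv ℝ g (c w) (k • deriv c w) := by
      filter_upwards [hcz, hgz] with w h1 h2
      rw [(h2.hasFDerivAt.comp w h1).fderiv]
      rfl
    have h2 : HasFDerivAt (fun w => fderiv ℝ (g ∘ c) w k)
        ((fderiv ℝ (fderiv ℝ (g ∘ c)) z).flip k) z := by
      have := hdF.hasFDerivAt.clm_apply (hasFDerivAt_const k z)
      rwa [ContinuousLinearMap.comp_zero, zero_add] at this
    have h3 : HasFDerivAt (fun w => k • deriv c w)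
        (k • ((ContinuousLinearMap.toSpanSingleton ℂ (deriv (deriv c) z)).restrictScalars ℝ
          : ℂ →L[ℝ] E)) z :=
      (hc.deriv.differentiableAt.hasDerivAt.hasFDerivAt.restrictScalars ℝ).const_smul k
    have h4 := ((hdg.hasFDerivAt.comp z hcz.self_of_nhds).clm_apply h3)
    have h5 := (h2.congr_of_eventuallyEq h1.symm).unique h4
    have h6 := congrArg (fun L : ℂ →L[ℝ] ℝ => L k) h5
    simp only [ContinuousLinearMap.flip_apply] at h6
    rw [h6]
    simp [smul_smul, add_comm]
  rw [key, key, hessC]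
  simp
  ring

theorem IsHolDisc.analyticAt_chart [IsManifold 𝓘(ℂ, E) ω M] {γ : ℂ → M} {x : M}
    (hγ : IsHolDisc E γ x) {x₀ : M} (hx : x ∈ (chartAt E x₀).source) :
    AnalyticAt ℂ (chartAt E x₀ ∘ γ) 0 := by
  obtain ⟨h, rfl⟩ := hγ
  have h1 : ContMDiffAt 𝓘(ℂ, E) 𝓘(ℂ, E) ω (chartAt E x₀) (γ 0) :=
    (contMDiffOn_of_mem_maximalAtlas (IsManifold.chart_mem_maximalAtlas x₀)).contMDiffAt
      ((chartAt E x₀).open_source.mem_nhds hx)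
  exact analyticAt_of_contMDiffAt (h1.comp 0 h)

theorem contMDiffAt_chart_symm [IsManifold 𝓘(ℂ, E) ω M] {x₀ : M} {y : E}
    (hy : y ∈ (chartAt E x₀).target) :
    ContMDiffAt 𝓘(ℂ, E) 𝓘(ℂ, E) ω (chartAt E x₀).symm y :=
  (contMDiffOn_symm_of_mem_maximalAtlas (IsManifold.chart_mem_maximalAtlas x₀)).contMDiffAt
    ((chartAt E x₀).open_target.mem_nhds hy)

/-- A disc is nonconstant to first order exactly if its coordinate expression is. The chart need not be
the preferred chart at `x`. -/
theorem mfderiv_disc_ne_zero_iff [IsManifold 𝓘(ℂ, E) ω M] {γ : ℂ → M} {x : M}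
    (hγ : IsHolDisc E γ x) {x₀ : M} (hx : x ∈ (chartAt E x₀).source) :
    mfderiv 𝓘(ℂ, ℂ) 𝓘(ℂ, E) γ 0 ≠ 0 ↔ deriv (chartAt E x₀ ∘ γ) 0 ≠ 0 := by
  have hγ' := hγ
  have han := hγ.analyticAt_chart hx
  obtain ⟨h, rfl⟩ := hγ
  have hd : MDifferentiableAt 𝓘(ℂ, ℂ) 𝓘(ℂ, E) γ 0 := h.mdifferentiableAt (by simp)
  have h1 : ContMDiffAt 𝓘(ℂ, E) 𝓘(ℂ, E) ω (chartAt E x₀) (γ 0) :=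
    (contMDiffOn_of_mem_maximalAtlas (IsManifold.chart_mem_maximalAtlas x₀)).contMDiffAt
      ((chartAt E x₀).open_source.mem_nhds hx)
  refine not_congr ⟨fun h0 => ?_, fun h0 => ?_⟩
  · have h2 : fderiv ℂ (chartAt E x₀ ∘ γ) 0 = 0 := by
      rw [← mfderiv_eq_fderiv, mfderiv_comp 0 (h1.mdifferentiableAt (by simp)) hd, h0]
      exact ContinuousLinearMap.comp_zero _
    rw [← fderiv_apply_one_eq_deriv, h2]
    rfl
  · have h2 : γ =ᶠ[𝓝 0] (chartAt E x₀).symm ∘ (chartAt E x₀ ∘ γ) := by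
      filter_upwards [hγ'.continuousAt.eventually ((chartAt E x₀).open_source.mem_nhds hx)]
        with ζ hζ
      exact ((chartAt E x₀).left_inv hζ).symm
    have h3 : MDifferentiableAt 𝓘(ℂ, E) 𝓘(ℂ, E) (chartAt E x₀).symm ((chartAt E x₀ ∘ γ) 0) :=
      (contMDiffAt_chart_symm ((chartAt E x₀).map_source hx)).mdifferentiableAt (by simp)
    have h4 : mfderiv 𝓘(ℂ, ℂ) 𝓘(ℂ, E) (chartAt E x₀ ∘ γ) 0 = 0 := by
      have h5 : fderiv ℂ (chartAt E x₀ ∘ γ) 0 = 0 := by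
        ext
        simpa using h0
      rw [mfderiv_eq_fderiv, h5]
      rfl
    rw [h2.mfderiv_eq, mfderiv_comp 0 h3 han.differentiableAt.mdifferentiableAt, h4]
    exact ContinuousLinearMap.comp_zero _

/-- In a chart, the Levi form along a disc is the complex Hessian of the coordinate expression,
evaluated at the velocity of the disc. -/
theorem levi_eq_hessC [IsManifold 𝓘(ℂ, E) ω M] [CompleteSpace E] {f : M → ℝ} {x : M}
    (hf : ContMDiffAt 𝓘(ℝ, E) 𝓘(ℝ, ℝ) ∞ f x) {γ : ℂ → M}
    (hγ : IsHolDisc E γ x) {x₀ : M} (hx : x ∈ (chartAt E x₀).source) :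
    ContDiffAt ℝ ∞ (f ∘ (chartAt E x₀).symm) (chartAt E x₀ x) ∧
    levi f γ = hessC (f ∘ (chartAt E x₀).symm) (chartAt E x₀ x) (deriv (chartAt E x₀ ∘ γ) 0) := by
  have han := hγ.analyticAt_chart hx
  have hγ' := hγ
  obtain ⟨h, rfl⟩ := hγ
  set e := chartAt E x₀
  have h2 : (f ∘ γ) =ᶠ[𝓝 0] (f ∘ e.symm) ∘ (e ∘ γ) := by
    filter_upwards [hγ'.continuousAt.eventually (e.open_source.mem_nhds hx)] with ζ hζ
    simp [e.left_inv hζ]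
  have hg : ContDiffAt ℝ ∞ (f ∘ e.symm) (e (γ 0)) := by
    refine ContMDiffAt.contDiffAt ?_
    refine ContMDiffAt.comp (e (γ 0)) (I' := 𝓘(ℝ, E)) ?_
      (contMDiffAt_real (contMDiffAt_chart_symm (e.map_source hx)))
    rwa [e.left_inv hx]
  refine ⟨hg, ?_⟩
  rw [levi, (InnerProductSpace.laplacian_congr_nhds h2).self_of_nhds]
  exact laplacian_comp_holomorphic
    (hg.of_le (WithTop.coe_le_coe.2 (le_top : (2 : ℕ∞) ≤ ⊤))) han

variable (E) in
/-- The disc through `x` with velocity `v` in the chart at `x`. -/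
noncomputable def affineDisc (x : M) (v : E) (ζ : ℂ) : M :=
  (chartAt E x).symm (chartAt E x x + ζ • v)

theorem isHolDisc_affineDisc [IsManifold 𝓘(ℂ, E) ω M] (x : M) (v : E) :
    IsHolDisc E (affineDisc E x v) x ∧ deriv (chartAt E x ∘ affineDisc E x v) 0 = v := by
  have hl : ContDiff ℂ ω (fun ζ : ℂ => chartAt E x x + ζ • v) :=
    contDiff_const.add (contDiff_id.smul contDiff_const)
  have h0 : chartAt E x x + (0 : ℂ) • v = chartAt E x x := by simp
  refine ⟨⟨?_, by simp [affineDisc]⟩, ?_⟩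
  · refine ContMDiffAt.comp (0 : ℂ) (I' := 𝓘(ℂ, E)) ?_ hl.contMDiff.contMDiffAt
    rw [h0]
    exact contMDiffAt_chart_symm (mem_chart_target E x)
  · have h1 : (chartAt E x ∘ affineDisc E x v) =ᶠ[𝓝 0] fun ζ : ℂ => chartAt E x x + ζ • v := by
      have : ∀ᶠ ζ in 𝓝 (0 : ℂ), chartAt E x x + ζ • v ∈ (chartAt E x).target := by
        refine hl.continuous.continuousAt.eventually ((chartAt E x).open_target.mem_nhds ?_)
        simp
      filter_upwards [this] with ζ hζ
      exact (chartAt E x).right_inv hζ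
    rw [h1.deriv_eq]
    have := ((hasDerivAt_id (0 : ℂ)).smul_const v).const_add (chartAt E x x)
    simpa using this.deriv

/-- Only real factors are needed: they suffice to normalize vectors to the unit sphere. -/
theorem hessC_smul (g : E → ℝ) (y v : E) (t : ℝ) :
    hessC g y ((t : ℂ) • v) = t ^ 2 * hessC g y v := by
  simp only [hessC, Complex.coe_smul, smul_comm Complex.I t v, map_smul,
    _root_.smul_apply, smul_eq_mul]
  ring

theorem hessC_zero (g : E → ℝ) (y : E) : hessC g y 0 = 0 := by simp [hessC]

end Levi

section LeviPos

variable {E : Type*} [NormedAddCommGroup E] [NormedSpace ℂ E] {M : Type*}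
  [TopologicalSpace M] [ChartedSpace E M]

variable (E) in
/-- The Levi form of `f` at `x` is positive definite. -/
def LeviPosAt (f : M → ℝ) (x : M) : Prop :=
  ∀ γ : ℂ → M, IsHolDisc E γ x → mfderiv 𝓘(ℂ, ℂ) 𝓘(ℂ, E) γ 0 ≠ 0 → 0 < levi f γ

variable [IsManifold 𝓘(ℂ, E) ω M] [FiniteDimensional ℂ E]

theorem LeviPosAt.hessC_pos {f : M → ℝ} {x : M} (h : LeviPosAt E f x)
    (hf : ContMDiffAt 𝓘(ℝ, E) 𝓘(ℝ, ℝ) ∞ f x) {v : E} (hv : v ≠ 0) :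
    0 < hessC (f ∘ (chartAt E x).symm) (chartAt E x x) v := by
  have := FiniteDimensional.complete ℂ E
  obtain ⟨h1, h2⟩ := isHolDisc_affineDisc x v
  have h3 := h _ h1 ((mfderiv_disc_ne_zero_iff h1 (mem_chart_source E x)).2 (by rwa [h2]))
  rwa [(levi_eq_hessC hf h1 (mem_chart_source E x)).2, h2] at h3

/-- Positive definiteness of the Levi form is stable under small perturbations, locally uniformly:
the unit sphere of the tangent space is compact. -/
theorem LeviPosAt.eventually_add {f ψ : M → ℝ} {V : Set M} (hV : IsOpen V) {x : M} (hx : x ∈ V)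
    (hf : ContMDiffOn 𝓘(ℝ, E) 𝓘(ℝ, ℝ) ∞ f V) (hψ : ContMDiffOn 𝓘(ℝ, E) 𝓘(ℝ, ℝ) ∞ ψ V)
    (h : LeviPosAt E f x) :
    ∃ ε > 0, ∀ᶠ y in 𝓝 x, ∀ s : ℝ, |s| < ε → LeviPosAt E (fun z => f z + s * ψ z) y := by
  have := FiniteDimensional.complete ℂ E
  have := FiniteDimensional.proper ℂ E
  set e := chartAt E x with he
  have hfx := hf.contMDiffAt (hV.mem_nhds hx)
  have hψx := hψ.contMDiffAt (hV.mem_nhds hx)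
  have hcont : ∀ {g : M → ℝ}, ContMDiffAt 𝓘(ℝ, E) 𝓘(ℝ, ℝ) ∞ g x →
      ContinuousAt (fderiv ℝ (fderiv ℝ (g ∘ e.symm))) (e x) := fun hg => by
    have h1 := (levi_eq_hessC hg (isHolDisc_affineDisc x 0).1 (mem_chart_source E x)).1
    have h2 := (h1.fderiv_right (m := 1)
      (WithTop.coe_le_coe.2 (le_top : ((1 : ℕ∞) + 1) ≤ ⊤))).fderiv_right (m := 0) (by norm_num)
    exact h2.continuousAt
  have hH : ∀ {g : M → ℝ}, ContMDiffAt 𝓘(ℝ, E) 𝓘(ℝ, ℝ) ∞ g x → ∀ v : E,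
      ContinuousAt (fun z : (E × ℝ) × E => hessC (g ∘ e.symm) z.1.1 z.2) ((e x, 0), v) :=
    fun {g} hg v => by
    have h1 : ContinuousAt (fun z : (E × ℝ) × E => fderiv ℝ (fderiv ℝ (g ∘ e.symm)) z.1.1)
        ((e x, 0), v) :=
      ContinuousAt.comp (g := fderiv ℝ (fderiv ℝ (g ∘ e.symm))) (f := fun z : (E × ℝ) × E => z.1.1)
        (hcont hg) (by fun_prop)
    have h2 : ContinuousAt (fun z : (E × ℝ) × E => z.2) ((e x, 0), v) := continuousAt_snd
    have h3 : ContinuousAt (fun z : (E × ℝ) × E => Complex.I • z.2) ((e x, 0), v) :=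
      h2.const_smul _
    exact ((h1.clm_apply h2).clm_apply h2).add ((h1.clm_apply h3).clm_apply h3)
  -- on the unit sphere, uniformly in the point and in the coefficient `s`
  have key : ∀ᶠ z : E × ℝ in 𝓝 (e x, 0), ∀ v ∈ Metric.sphere (0 : E) 1,
      0 < hessC (f ∘ e.symm) z.1 v + z.2 * hessC (ψ ∘ e.symm) z.1 v := by
    refine (isCompact_sphere 0 1).eventually_forall_of_forall_eventually fun v hv => ?_
    have hc : ContinuousAt (fun z : (E × ℝ) × E => hessC (f ∘ e.symm) z.1.1 z.2 +
        z.1.2 * hessC (ψ ∘ e.symm) z.1.1 z.2) ((e x, 0), v) :=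
      (hH hfx v).add (ContinuousAt.mul (by fun_prop) (hH hψx v))
    refine hc.eventually (lt_mem_nhds ?_)
    have : v ≠ 0 := fun h0 => by simp [h0] at hv
    simpa using h.hessC_pos hfx this
  rw [nhds_prod_eq, Filter.eventually_prod_iff] at key
  obtain ⟨p, hp, q, hq, hpq⟩ := key
  obtain ⟨ε, hε, hεq⟩ := Metric.eventually_nhds_iff.1 hq
  refine ⟨ε, hε, ?_⟩
  have hpe : ∀ᶠ y in 𝓝 x, p (e y) := (e.continuousAt (mem_chart_source E x)).eventually hp
  filter_upwards [hpe, hV.mem_nhds hx, e.open_source.mem_nhds (mem_chart_source E x)]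
    with y hy hyV hye s hs γ hγ hγ0
  have hfy := hf.contMDiffAt (hV.mem_nhds hyV)
  have hψy := hψ.contMDiffAt (hV.mem_nhds hyV)
  rw [levi_add_mul hfy hψy s hγ, (levi_eq_hessC hfy hγ hye).2,
    (levi_eq_hessC hψy hγ hye).2]
  have hv := (mfderiv_disc_ne_zero_iff hγ hye).1 hγ0
  set v := deriv (chartAt E x ∘ γ) 0
  have hn : 0 < ‖v‖ := norm_pos_iff.2 hv
  have h1 := hpq hy (hεq (by simpa using hs)) (((‖v‖⁻¹ : ℝ) : ℂ) • v) (by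
    simp [norm_smul, hn.ne'])
  simp only [hessC_smul] at h1
  have h2 : (‖v‖⁻¹) ^ 2 * hessC (f ∘ e.symm) (e y) v + s * ((‖v‖⁻¹) ^ 2 * hessC (ψ ∘ e.symm) (e y) v)
      = (‖v‖⁻¹) ^ 2 * (hessC (f ∘ e.symm) (e y) v + s * hessC (ψ ∘ e.symm) (e y) v) := by ring
  rw [h2] at h1
  exact pos_of_mul_pos_right h1 (by positivity)

/-- A function with positive definite Levi form at a point lies, near that point, above the
pluriharmonic part of its Taylor polynomial of degree two. -/
theorem LeviPosAt.supportedAt {f : M → ℝ} {x : M} (h : LeviPosAt E f x)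
    (hf : ContMDiffAt 𝓘(ℝ, E) 𝓘(ℝ, ℝ) ∞ f x) : SupportedAt E f x := by
  have := FiniteDimensional.complete ℂ E
  have := FiniteDimensional.proper ℂ E
  set e := chartAt E x with he
  set y₀ := e x with hy₀
  set g : E → ℝ := f ∘ e.symm with hg
  have hgd : ContDiffAt ℝ 2 g y₀ :=
    (levi_eq_hessC hf (isHolDisc_affineDisc x 0).1 (mem_chart_source E x)).1.of_le
      (WithTop.coe_le_coe.2 (le_top : (2 : ℕ∞) ≤ ⊤))
  set S := fderiv ℝ (fderiv ℝ g) y₀ with hS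
  set J : E →L[ℝ] E := ContinuousLinearMap.restrictScalars ℝ
    (Complex.I • ContinuousLinearMap.id ℂ E) with hJ
  have hJv : ∀ v, J v = Complex.I • v := fun v => rfl
  have hJJ : ∀ v, J (J v) = -v := fun v => by
    rw [hJv, hJv, smul_smul, Complex.I_mul_I, neg_one_smul]
  set T : E →L[ℝ] E →L[ℝ] ℝ := (1 / 2 : ℝ) • (S - S.bilinearComp J J) with hT
  have hTv : ∀ u v, T u v = 1 / 2 * (S u v - S (J u) (J v)) := fun u v => rfl
  -- the pluriharmonic part of the Taylor polynomial
  set P : E → ℝ := fun y => g y₀ + fderiv ℝ g y₀ (y - y₀) + 1 / 2 * T (y - y₀) (y - y₀) with hP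
  have hP1 : ∀ y, HasFDerivAt P (fderiv ℝ g y₀ +
      (1 / 2 : ℝ) • (T (y - y₀) + T.flip (y - y₀))) y := by
    intro y
    have h1 : HasFDerivAt (fun y : E => y - y₀) (ContinuousLinearMap.id ℝ E) y :=
      (hasFDerivAt_id y).sub_const y₀
    have h2 := (T.hasFDerivAt.comp y h1).clm_apply h1
    have h3 := (((fderiv ℝ g y₀).hasFDerivAt.comp y h1).const_add (g y₀)).add
      (h2.const_smul (1 / 2 : ℝ))
    refine h3.congr_fderiv ?_
    ext v
    simp
  have hPd : ContDiff ℝ 2 P := by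
    have h1 : ContDiff ℝ 2 (fun y : E => y - y₀) := contDiff_id.sub contDiff_const
    exact (contDiff_const.add ((fderiv ℝ g y₀).contDiff.comp h1)).add
      (contDiff_const.mul ((T.contDiff.comp h1).clm_apply h1))
  have hP2 : ∀ y v, hessC P y v = 0 := by
    intro y v
    have h1 : fderiv ℝ P = fun y => fderiv ℝ g y₀ +
      (1 / 2 : ℝ) • (T (y - y₀) + T.flip (y - y₀)) := funext fun y => (hP1 y).fderiv
    have h2 : HasFDerivAt (fderiv ℝ P) ((1 / 2 : ℝ) • (T + T.flip)) y := by
      rw [h1]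
      have h1 : HasFDerivAt (fun y : E => y - y₀) (ContinuousLinearMap.id ℝ E) y :=
        (hasFDerivAt_id y).sub_const y₀
      exact (((T.hasFDerivAt.comp y h1).add (T.flip.hasFDerivAt.comp y h1)).const_smul
        (1 / 2 : ℝ)).const_add _
    rw [hessC, h2.fderiv, ← hJv]
    simp only [_root_.smul_apply, _root_.add_apply, ContinuousLinearMap.flip_apply, hTv, hJJ,
      smul_eq_mul, map_neg, _root_.neg_apply]
    ring
  obtain ⟨κ, hκ, hκS⟩ : ∃ κ > 0, ∀ v, κ * ‖v‖ ^ 2 ≤ hessC g y₀ v := by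
    have hc : Continuous (hessC g y₀) := by
      have h3 : Continuous fun v : E => Complex.I • v := continuous_const_smul _
      exact ((S.continuous.clm_apply continuous_id)).add
        ((S.continuous.comp h3).clm_apply h3)
    rcases subsingleton_or_nontrivial E with hE | hE
    · exact ⟨1, one_pos, fun v => by rw [Subsingleton.elim v 0, hessC_zero]; simp⟩
    obtain ⟨v₀, hv₀, hmin⟩ := (isCompact_sphere (0 : E) 1).exists_isMinOn
      (NormedSpace.sphere_nonempty.2 zero_le_one) hc.continuousOn
    have hv0 : v₀ ≠ 0 := fun h0 => by simp [h0] at hv₀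
    refine ⟨hessC g y₀ v₀, h.hessC_pos hf hv0, fun v => ?_⟩
    by_cases hv : v = 0
    · simp [hv, hessC_zero]
    have hn : 0 < ‖v‖ := norm_pos_iff.2 hv
    have h1 : hessC g y₀ v₀ ≤ hessC g y₀ (((‖v‖⁻¹ : ℝ) : ℂ) • v) :=
      hmin (by simp [norm_smul, hn.ne'])
    rw [hessC_smul] at h1
    calc hessC g y₀ v₀ * ‖v‖ ^ 2 ≤ ((‖v‖⁻¹) ^ 2 * hessC g y₀ v) * ‖v‖ ^ 2 := by gcongr
      _ = hessC g y₀ v := by field_simp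
  -- the Taylor remainder has its minimum at the base point
  have hrem : ∀ᶠ y in 𝓝 y₀, P y ≤ g y := by
    have hdd : HasFDerivAt (fderiv ℝ g) S y₀ :=
      ((hgd.fderiv_right (m := 1) (by norm_num)).differentiableAt (by norm_num)).hasFDerivAt
    have hlo := hdd.isLittleO.def (show (0 : ℝ) < κ / 2 by positivity)
    have hdiff : ∀ᶠ y in 𝓝 y₀, DifferentiableAt ℝ g y :=
      (hgd.eventually (by norm_num)).mono fun w hw => hw.differentiableAt (by norm_num)
    obtain ⟨ρ, hρ, H⟩ := Metric.eventually_nhds_iff_ball.1 (hlo.and hdiff)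
    filter_upwards [Metric.ball_mem_nhds y₀ hρ] with y hy
    set w := y - y₀ with hw
    have hmem : ∀ t ∈ Icc (0 : ℝ) 1, y₀ + t • w ∈ Metric.ball y₀ ρ := by
      intro t ht
      rw [mem_ball_iff_norm, add_sub_cancel_left, norm_smul, Real.norm_eq_abs, abs_of_nonneg ht.1]
      rw [mem_ball_iff_norm] at hy
      exact (mul_le_of_le_one_left (norm_nonneg _) ht.2).trans_lt hy
    set φ : ℝ → ℝ := fun t => g (y₀ + t • w) - P (y₀ + t • w) with hφ
    have hφd : ∀ t ∈ Icc (0 : ℝ) 1, HasDerivAt φ (fderiv ℝ g (y₀ + t • w) w -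
        (fderiv ℝ g y₀ + (1 / 2 : ℝ) • (T (t • w) + T.flip (t • w))) w) t := by
      intro t ht
      have hl : HasDerivAt (fun t : ℝ => y₀ + t • w) w t := by
        simpa using ((hasDerivAt_id t).smul_const w).const_add y₀
      have h1 := (H _ (hmem t ht)).2.hasFDerivAt.comp_hasDerivAt t hl
      have h2 := (hP1 (y₀ + t • w)).comp_hasDerivAt t hl
      rw [add_sub_cancel_left] at h2
      exact h1.sub h2
    have hpos : ∀ t ∈ Icc (0 : ℝ) 1, 0 ≤ fderiv ℝ g (y₀ + t • w) w -
        (fderiv ℝ g y₀ + (1 / 2 : ℝ) • (T (t • w) + T.flip (t • w))) w := by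
      intro t ht
      have h1 := (H _ (hmem t ht)).1
      rw [add_sub_cancel_left] at h1
      have h2 := (ContinuousLinearMap.le_opNorm _ w).trans
        (mul_le_mul_of_nonneg_right h1 (norm_nonneg w))
      have h3 := (abs_le.1 (Real.norm_eq_abs _ ▸ h2)).1
      have h4 := hκS w
      rw [norm_smul, Real.norm_eq_abs, abs_of_nonneg ht.1] at h3
      simp only [_root_.sub_apply, map_smul, _root_.smul_apply, smul_eq_mul] at h3
      simp only [_root_.add_apply, map_smul, _root_.smul_apply, smul_eq_mul,
        ContinuousLinearMap.flip_apply, hTv]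
      rw [hessC, ← hJv] at h4
      change κ * ‖w‖ ^ 2 ≤ S w w + S (J w) (J w) at h4
      nlinarith [mul_le_mul_of_nonneg_left h4 ht.1]
    have hmono : MonotoneOn φ (Icc 0 1) := by
      refine monotoneOn_of_deriv_nonneg (convex_Icc 0 1)
        (fun t ht => (hφd t ht).continuousAt.continuousWithinAt)
        (fun t ht => (hφd t (interior_subset ht)).differentiableAt.differentiableWithinAt)
        fun t ht => ?_
      rw [(hφd t (interior_subset ht)).deriv]
      exact hpos t (interior_subset ht)
    have h01 := hmono (left_mem_Icc.2 zero_le_one) (right_mem_Icc.2 zero_le_one) zero_le_one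
    have hφ0 : φ 0 = 0 := by simp [hφ, hP]
    have hφ1 : φ 1 = g y - P y := by simp [hφ, hw]
    linarith
  refine ⟨hf.continuousAt, P ∘ e, ?_, ?_, ?_⟩
  · simp [hP, hg, ← hy₀, hy₀ ▸ e.left_inv (mem_chart_source E x)]
  · filter_upwards [(e.continuousAt (mem_chart_source E x)).eventually hrem,
      e.open_source.mem_nhds (mem_chart_source E x)] with y hy hye
    simpa [hg, e.left_inv hye] using hy
  · intro γ hγ
    have han := hγ.analyticAt_chart (mem_chart_source E x)
    refine ⟨hPd.contDiffAt.comp 0 (han.contDiffAt.restrict_scalars ℝ), ?_⟩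
    filter_upwards [han.eventually_analyticAt] with ζ hζ
    change Laplacian.laplacian (P ∘ (e ∘ γ)) ζ = 0
    rw [laplacian_comp_holomorphic hPd.contDiffAt hζ, hP2]

end LeviPos

/-! ### Smooth metrics of line bundles -/

section Metrics

variable {E : Type*} [NormedAddCommGroup E] [NormedSpace ℂ E] {M : Type*}
  [TopologicalSpace M] [ChartedSpace E M]
  {E' : Type*} [NormedAddCommGroup E'] [NormedSpace ℂ E'] {N : Type*}
  [TopologicalSpace N] [ChartedSpace E' N]

/-- A smooth metric of a line bundle, given by its local weights. -/
structure SmoothMetric (L : HolLineBundle E M) where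
  /-- The local weights. -/
  ψ : L.ι → M → ℝ
  smooth : ∀ i, ContMDiffOn 𝓘(ℝ, E) 𝓘(ℝ, ℝ) ∞ (ψ i) (L.U i)
  trans : ∀ i j, ∀ x ∈ L.U i ∩ L.U j, ψ i x = ψ j x + Real.log (‖L.g i j x‖ ^ 2)

theorem HolLineBundle.exists_mem (L : HolLineBundle E M) (x : M) : ∃ i, x ∈ L.U i :=
  mem_iUnion.1 (L.iUnion_U ▸ mem_univ x)

theorem HolLineBundle.pluriharmonicAt_log (L : HolLineBundle E M) {i j : L.ι} {x : M}
    (hx : x ∈ L.U i ∩ L.U j) : PluriharmonicAt E (fun y => Real.log (‖L.g i j y‖ ^ 2)) x :=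
  pluriharmonicAt_log_norm_sq
    ((L.hol_g i j).contMDiffAt (((L.isOpen_U i).inter (L.isOpen_U j)).mem_nhds hx))
    (L.g_ne_zero i j x hx)

theorem HolLineBundle.supportedAt_log (L : HolLineBundle E M) {i j : L.ι} {x : M}
    (hx : x ∈ L.U i ∩ L.U j) (c : ℝ) :
    SupportedAt E (fun y => c * Real.log (‖L.g i j y‖ ^ 2)) x :=
  supportedAt_log_norm_sq
    ((L.hol_g i j).contMDiffAt (((L.isOpen_U i).inter (L.isOpen_U j)).mem_nhds hx))
    (L.g_ne_zero i j x hx) c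

namespace SmoothMetric

variable {L : HolLineBundle E M}

theorem smoothAt (ψ : SmoothMetric L) {i : L.ι} {x : M} (hx : x ∈ L.U i) :
    ContMDiffAt 𝓘(ℝ, E) 𝓘(ℝ, ℝ) ∞ (ψ.ψ i) x :=
  (ψ.smooth i).contMDiffAt ((L.isOpen_U i).mem_nhds hx)

/-- The curvature of a smooth metric does not depend on the trivialization. -/
theorem levi_eq (ψ : SmoothMetric L) {i j : L.ι} {x : M} (hi : x ∈ L.U i) (hj : x ∈ L.U j)
    {γ : ℂ → M} (hγ : IsHolDisc E γ x) : levi (ψ.ψ i) γ = levi (ψ.ψ j) γ := by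
  have h := L.pluriharmonicAt_log ⟨hi, hj⟩
  have hev : ∀ᶠ y in 𝓝 x, y ∈ L.U i ∩ L.U j :=
    ((L.isOpen_U i).inter (L.isOpen_U j)).mem_nhds ⟨hi, hj⟩
  have h1 : (fun y => ψ.ψ i y + -1 * ψ.ψ j y) =ᶠ[𝓝 x]
      fun y => Real.log (‖L.g i j y‖ ^ 2) := by
    filter_upwards [hev] with y hy
    rw [ψ.trans i j y hy]; ring
  have h2 := levi_of_pluriharmonicAt (h.congr h1.symm) hγ
  rw [levi_add_mul (ψ.smoothAt hi) (ψ.smoothAt hj) _ hγ] at h2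
  linarith

/-- The metric has positive curvature. -/
def IsPositive (ψ : SmoothMetric L) : Prop := ∀ i, ∀ x ∈ L.U i, LeviPosAt E (ψ.ψ i) x

theorem leviPosAt_const_mul {f : M → ℝ} {x : M} (hf : ContMDiffAt 𝓘(ℝ, E) 𝓘(ℝ, ℝ) ∞ f x)
    (h : LeviPosAt E f x) {δ : ℝ} (hδ : 0 < δ) : LeviPosAt E (fun y => δ * f y) x :=
  fun γ hγ h0 => by
    rw [levi_const_mul hf δ hγ]
    exact mul_pos hδ (h γ hγ h0)

/-- A positive multiple of the curvature of a positive metric, as a Kähler form. -/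
def toKahler (ψ : SmoothMetric L) (hψ : ψ.IsPositive) (δ : ℝ) (hδ : 0 < δ) : KahlerForm E M where
  ι := L.ι
  V := L.U
  pot i x := δ * ψ.ψ i x
  isOpen_V := L.isOpen_U
  iUnion_V := L.iUnion_U
  smooth i := contMDiffOn_const.mul (ψ.smooth i)
  strict i x hx γ hγ h0 := leviPosAt_const_mul (ψ.smoothAt hx) (hψ i x hx) hδ γ hγ h0
  compat i j x hx γ hγ := by
    rw [levi_const_mul (ψ.smoothAt hx.1) δ hγ, levi_const_mul (ψ.smoothAt hx.2) δ hγ,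
      ψ.levi_eq hx.1 hx.2 hγ]

end SmoothMetric

theorem KahlerForm.smoothAt (θ : KahlerForm E M) {a : θ.ι} {x : M} (hx : x ∈ θ.V a) :
    ContMDiffAt 𝓘(ℝ, E) 𝓘(ℝ, ℝ) ∞ (θ.pot a) x :=
  (θ.smooth a).contMDiffAt ((θ.isOpen_V a).mem_nhds hx)

theorem KahlerForm.exists_mem (θ : KahlerForm E M) (x : M) : ∃ a, x ∈ θ.V a :=
  mem_iUnion.1 (θ.iUnion_V ▸ mem_univ x)

/-- The pullback of a Kähler form by a holomorphic immersion. -/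
def KahlerForm.pullback (θ : KahlerForm E' N) (f : M → N) (hf : ContMDiff 𝓘(ℂ, E) 𝓘(ℂ, E') ω f)
    (himm : ∀ x, Function.Injective (mfderiv 𝓘(ℂ, E) 𝓘(ℂ, E') f x)) : KahlerForm E M where
  ι := θ.ι
  V a := f ⁻¹' θ.V a
  pot a := θ.pot a ∘ f
  isOpen_V a := (θ.isOpen_V a).preimage hf.continuous
  iUnion_V := by rw [← preimage_iUnion, θ.iUnion_V, preimage_univ]
  smooth a := fun x hx => ((θ.smoothAt hx).comp x (contMDiffAt_real hf.contMDiffAt)).contMDiffWithinAt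
  strict a x hx γ hγ h0 := by
    refine θ.strict a (f x) hx (f ∘ γ) (hγ.comp hf.contMDiffAt) fun h1 => h0 ?_
    rw [mfderiv_comp 0 (hf.mdifferentiable (by simp) _) (hγ.1.mdifferentiableAt (by simp))] at h1
    refine ContinuousLinearMap.ext fun v => himm (γ 0) ?_
    exact (congrArg (fun A => A v) h1).trans (map_zero (mfderiv 𝓘(ℂ, E) 𝓘(ℂ, E') f (γ 0))).symm
  compat a b x hx γ hγ := θ.compat a b (f x) hx (f ∘ γ) (hγ.comp hf.contMDiffAt)

/-- On a compact manifold, a small multiple of the curvature of a smooth metric can be added to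
a Kähler form without loss of positivity. -/
theorem KahlerForm.exists_add_pos [IsManifold 𝓘(ℂ, E) ω M] [FiniteDimensional ℂ E]
    [CompactSpace M] (θ : KahlerForm E M) {L : HolLineBundle E M} (ψ : SmoothMetric L) :
    ∃ ε > 0, ∀ s : ℝ, |s| < ε → ∀ a i, ∀ x ∈ θ.V a ∩ L.U i,
      LeviPosAt E (fun y => θ.pot a y + s * ψ.ψ i y) x := by
  have hloc : ∀ x : M, ∃ ε > 0, ∀ᶠ y in 𝓝 x, ∀ s : ℝ, |s| < ε → ∀ a i, y ∈ θ.V a ∩ L.U i →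
      LeviPosAt E (fun y => θ.pot a y + s * ψ.ψ i y) y := by
    intro x
    obtain ⟨a, ha⟩ := θ.exists_mem x
    obtain ⟨i, hi⟩ := L.exists_mem x
    have hO := (θ.isOpen_V a).inter (L.isOpen_U i)
    obtain ⟨ε, hε, h⟩ := LeviPosAt.eventually_add (E := E) (f := θ.pot a) (ψ := ψ.ψ i) hO ⟨ha, hi⟩
      ((θ.smooth a).mono inter_subset_left) ((ψ.smooth i).mono inter_subset_right)
      (θ.strict a x ha)
    refine ⟨ε, hε, ?_⟩
    filter_upwards [h, hO.mem_nhds ⟨ha, hi⟩] with y hy hyO s hs b j hb γ hγ h0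
    have h1 := hy s hs γ hγ h0
    rw [levi_add_mul (θ.smoothAt hyO.1) (ψ.smoothAt hyO.2) s hγ] at h1
    rw [levi_add_mul (θ.smoothAt hb.1) (ψ.smoothAt hb.2) s hγ, ψ.levi_eq hb.2 hyO.2 hγ,
      θ.compat b a y ⟨hb.1, hyO.1⟩ γ hγ]
    exact h1
  choose ε hε h using hloc
  obtain ⟨t, ht⟩ := CompactSpace.elim_nhds_subcover _ (fun x => h x)
  rcases isEmpty_or_nonempty M with hM | ⟨⟨x₀⟩⟩
  · exact ⟨1, one_pos, fun s _ a i x => (hM.false x).elim⟩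
  have hcov : ∀ x : M, ∃ z ∈ t, ∀ s : ℝ, |s| < ε z → ∀ a i, x ∈ θ.V a ∩ L.U i →
      LeviPosAt E (fun y => θ.pot a y + s * ψ.ψ i y) x := fun x => by
    have h1 := (Set.ext_iff.1 ht x).2 (mem_univ x)
    obtain ⟨z, hz, hxz⟩ := mem_iUnion₂.1 h1
    exact ⟨z, hz, hxz⟩
  have hne : t.Nonempty := let ⟨z, hz, _⟩ := hcov x₀; ⟨z, hz⟩
  refine ⟨t.inf' hne ε, (Finset.lt_inf'_iff hne).2 fun x _ => hε x, fun s hs a i x hx => ?_⟩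
  obtain ⟨z, hz, hxz⟩ := hcov x
  exact hxz s (hs.trans_le (Finset.inf'_le _ hz)) a i hx

/-! ### Singular metrics of `ℝ`-line bundles -/

namespace RLineBundle

variable {F G : RLineBundle E M}

theorem isOpen_dom (F : RLineBundle E M) (i : F.Triv) : IsOpen (F.dom i) :=
  isOpen_iInter_of_finite fun k => (F.bundle k).isOpen_U (i k)

theorem exists_mem_dom (F : RLineBundle E M) (x : M) : ∃ i, x ∈ F.dom i := by
  choose i hi using fun k => (F.bundle k).exists_mem x
  exact ⟨i, mem_iInter.2 hi⟩

/-- The trivialization of the first summand of a difference. -/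
def subFst (i : (F - G).Triv) : F.Triv := fun k => i (.inl k)

/-- The trivialization of the second summand of a difference. -/
def subSnd (i : (F - G).Triv) : G.Triv := fun k => i (.inr k)

/-- The trivialization of the first summand of a sum. -/
def addFst (i : (F + G).Triv) : F.Triv := fun k => i (.inl k)

/-- The trivialization of the second summand of a sum. -/
def addSnd (i : (F + G).Triv) : G.Triv := fun k => i (.inr k)

/-- The trivialization of a bundle attached to a trivialization of a multiple. -/
def smulTriv {r : ℝ} (i : (r • F).Triv) : F.Triv := i

/-- The index of the trivialization of a line bundle. -/
def ofIdx {L : HolLineBundle E M} (i : (of L).Triv) : L.ι := i ()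

theorem mem_dom_add {x : M} {i : (F + G).Triv} : x ∈ (F + G).dom i ↔
    x ∈ F.dom (addFst i) ∧ x ∈ G.dom (addSnd i) := by
  simp only [dom, mem_iInter]
  exact ⟨fun h => ⟨fun k => h (.inl k), fun k => h (.inr k)⟩,
    fun h k => by cases k with
      | inl k => exact h.1 k
      | inr k => exact h.2 k⟩

theorem logTrans_add (i j : (F + G).Triv) (x : M) : (F + G).logTrans i j x =
    F.logTrans (addFst i) (addFst j) x + G.logTrans (addSnd i) (addSnd j) x :=
  Fintype.sum_sum_type _

theorem mem_dom_smul {r : ℝ} {i : (r • F).Triv} {x : M} :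
    x ∈ (r • F).dom i ↔ x ∈ F.dom (smulTriv i) := Iff.rfl

theorem logTrans_smul {r : ℝ} (i j : (r • F).Triv) (x : M) :
    (r • F).logTrans i j x = r * F.logTrans (smulTriv i) (smulTriv j) x := by
  unfold logTrans
  rw [Finset.mul_sum]
  exact Finset.sum_congr rfl fun k _ => mul_assoc _ _ _

theorem mem_dom_sub {x : M} {i : (F - G).Triv} : x ∈ (F - G).dom i ↔
    x ∈ F.dom (subFst i) ∧ x ∈ G.dom (subSnd i) :=
  mem_dom_add (G := (-1 : ℝ) • G)

theorem logTrans_sub (i j : (F - G).Triv) (x : M) : (F - G).logTrans i j x =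
    F.logTrans (subFst i) (subFst j) x - G.logTrans (subSnd i) (subSnd j) x := by
  refine (logTrans_add (G := (-1 : ℝ) • G) i j x).trans ?_
  refine (congrArg _ (logTrans_smul (r := -1) (subSnd i) (subSnd j) x)).trans ?_
  rw [neg_one_mul, ← sub_eq_add_neg]
  rfl

theorem mem_dom_of {L : HolLineBundle E M} {x : M} {i : (of L).Triv} :
    x ∈ (of L).dom i ↔ x ∈ L.U (ofIdx i) := by
  simp only [dom, mem_iInter]
  exact ⟨fun h => h (), fun h k => h⟩

theorem logTrans_of {L : HolLineBundle E M} (i j : (of L).Triv) (x : M) :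
    (of L).logTrans i j x = Real.log (‖L.g (ofIdx i) (ofIdx j) x‖ ^ 2) :=
  (Fintype.sum_unique (ι := Unit) _).trans (one_mul _)

theorem mem_dom_pullback {F : RLineBundle E' N} {f : M → N}
    {hf : ContMDiff 𝓘(ℂ, E) 𝓘(ℂ, E') ω f} {x : M} {i : (F.pullback f hf).Triv} :
    x ∈ (F.pullback f hf).dom i ↔ f x ∈ F.dom i := by
  simp only [dom, mem_iInter]
  rfl

namespace SingPosMetric

/-- The metric induced by pulling back along a holomorphic map, when the transition functions of
the two bundles correspond to each other. -/
def transfer {F' : RLineBundle E' N} (h : F'.SingPosMetric) (F : RLineBundle E M) (f : M → N)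
    (hf : ContMDiff 𝓘(ℂ, E) 𝓘(ℂ, E') ω f) (T : F.Triv → F'.Triv)
    (hdom : ∀ i, ∀ x ∈ F.dom i, f x ∈ F'.dom (T i))
    (hlog : ∀ i j, ∀ x ∈ F.dom i ∩ F.dom j, F.logTrans i j x = F'.logTrans (T i) (T j) (f x)) :
    F.SingPosMetric where
  φ i x := h.φ (T i) (f x)
  psh i := (h.psh (T i)).comp (F'.isOpen_dom _) (F.isOpen_dom i) hf.contMDiffOn (hdom i)
  trans i j x hx := by
    rw [hlog i j x hx]
    exact h.trans (T i) (T j) (f x) ⟨hdom i x hx.1, hdom j x hx.2⟩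

/-- Strict positivity is preserved because the pullback of a Kähler form by an immersion is Kähler. -/
theorem transfer_isStrictlyPositive {F' : RLineBundle E' N} {h : F'.SingPosMetric}
    (hs : h.IsStrictlyPositive) {F : RLineBundle E M} {f : M → N}
    (hf : ContMDiff 𝓘(ℂ, E) 𝓘(ℂ, E') ω f)
    (himm : ∀ x, Function.Injective (mfderiv 𝓘(ℂ, E) 𝓘(ℂ, E') f x)) {T : F.Triv → F'.Triv}
    {hdom : ∀ i, ∀ x ∈ F.dom i, f x ∈ F'.dom (T i)}
    {hlog : ∀ i j, ∀ x ∈ F.dom i ∩ F.dom j, F.logTrans i j x = F'.logTrans (T i) (T j) (f x)} :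
    (h.transfer F f hf T hdom hlog).IsStrictlyPositive := by
  obtain ⟨θ, hθ⟩ := hs
  refine ⟨θ.pullback f hf himm, fun i a => ?_⟩
  exact (hθ (T i) a).comp ((F'.isOpen_dom _).inter (θ.isOpen_V a))
    ((F.isOpen_dom i).inter ((θ.isOpen_V a).preimage hf.continuous)) hf.contMDiffOn
    fun x hx => ⟨hdom i x hx.1, hx.2⟩

theorem transfer_isSmoothNear {F' : RLineBundle E' N} {h : F'.SingPosMetric}
    {F : RLineBundle E M} {f : M → N} {x : M} (hs : h.IsSmoothNear (f x))
    (hf : ContMDiff 𝓘(ℂ, E) 𝓘(ℂ, E') ω f) {T : F.Triv → F'.Triv}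
    {hdom : ∀ i, ∀ x ∈ F.dom i, f x ∈ F'.dom (T i)}
    {hlog : ∀ i j, ∀ x ∈ F.dom i ∩ F.dom j, F.logTrans i j x = F'.logTrans (T i) (T j) (f x)} :
    (h.transfer F f hf T hdom hlog).IsSmoothNear x := by
  obtain ⟨W, hW, hx, H⟩ := hs
  refine ⟨f ⁻¹' W, hW.preimage hf.continuous, hx, fun i => ?_⟩
  obtain ⟨g, hg, hgφ⟩ := H (T i)
  have hO := hW.inter (F'.isOpen_dom (T i))
  refine ⟨g ∘ f, fun y hy => ?_, fun y hy => hgφ (f y) ⟨hy.1, hdom i y hy.2⟩⟩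
  exact ((hg.contMDiffAt (hO.mem_nhds ⟨hy.1, hdom i y hy.2⟩)).comp y
    (contMDiffAt_real hf.contMDiffAt)).contMDiffWithinAt

/-- The weights of a metric are finite where the metric is smooth; this shows that it is not
identically `-∞`. -/
theorem ne_bot_of_isSmoothNear {h : F.SingPosMetric} {x : M} (hs : h.IsSmoothNear x) {i : F.Triv}
    (hx : x ∈ F.dom i) : h.φ i x ≠ ⊥ := by
  obtain ⟨W, -, hxW, H⟩ := hs
  obtain ⟨f, -, hf⟩ := H i
  rw [hf x ⟨hxW, hx⟩]
  exact EReal.coe_ne_bot _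

/-- The product of a singular metric with the power `s = -ε` of a smooth metric. -/
noncomputable def twist (h : F.SingPosMetric) {A : HolLineBundle E M} (ψ : SmoothMetric A) (ε : ℝ)
    (hpsh : ∀ i j, PSHOn E (fun x => h.φ i x + ((-ε * ψ.ψ j x : ℝ) : EReal)) (F.dom i ∩ A.U j)) :
    (F - ε • of A).SingPosMetric where
  φ i x := h.φ (subFst i) x + ((-ε * ψ.ψ (ofIdx (smulTriv (subSnd i))) x : ℝ) : EReal)
  psh i := (hpsh _ _).mono fun x hx =>
    ⟨(mem_dom_sub.1 hx).1, mem_dom_of.1 (mem_dom_sub.1 hx).2⟩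
  trans i j x hx := by
    obtain ⟨h1, h2⟩ := mem_dom_sub.1 hx.1
    obtain ⟨h1', h2'⟩ := mem_dom_sub.1 hx.2
    replace h2 := mem_dom_of.1 (mem_dom_smul.1 h2)
    replace h2' := mem_dom_of.1 (mem_dom_smul.1 h2')
    have hl : (F - ε • of A).logTrans i j x = F.logTrans (subFst i)
        (subFst j) x - ε * Real.log (‖A.g (ofIdx (smulTriv (subSnd i))) (ofIdx (smulTriv (subSnd j))) x‖ ^ 2) := by
      rw [logTrans_sub, ← logTrans_of]
      congr 1
      exact logTrans_smul _ _ x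
    rw [hl, h.trans _ _ x ⟨h1, h1'⟩, ψ.trans _ _ x ⟨h2, h2'⟩, add_assoc, add_assoc,
      ← EReal.coe_add, ← EReal.coe_add]
    congr 2
    ring

end SingPosMetric

theorem ereal_sub_add (u : EReal) (a b : ℝ) :
    u - (a : EReal) + ((a + b : ℝ) : EReal) = u + (b : EReal) := by
  induction u with
  | bot => simp
  | top => simp
  | coe u => norm_cast; ring

/-- If a weight dominates a Kähler potential, then adding a function which is dominated by the
potential preserves plurisubharmonicity. -/
theorem pshOn_add_of_dominates [IsManifold 𝓘(ℂ, E) ω M] (θ : KahlerForm E M) {u : M → EReal}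
    {U : Set M} (hU : IsOpen U) {f : M → ℝ}
    (hu : ∀ a, PSHOn E (fun x => u x - (θ.pot a x : EReal)) (U ∩ θ.V a))
    (hf : ∀ a, ∀ x ∈ U ∩ θ.V a, SupportedAt E (fun y => θ.pot a y + f y) x) :
    PSHOn E (fun x => u x + (f x : EReal)) U := by
  refine PSHOn.of_cover hU θ.isOpen_V θ.iUnion_V fun a => ?_
  have hO := hU.inter (θ.isOpen_V a)
  refine (PSHOn.add_supported hO (hu a) (hf a)).congr hO fun x _ => ?_
  exact ereal_sub_add _ _ _

end RLineBundle

end Metrics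

/-! ### The Fubini–Study potential -/

section LogSum

variable {κ : Type*} [Fintype κ]

/-- The real inner product of `ℂ^κ` as a real bilinear map. -/
noncomputable def realInner (κ : Type*) [Fintype κ] : (κ → ℂ) →L[ℝ] (κ → ℂ) →L[ℝ] ℝ :=
  ∑ a, ((ContinuousLinearMap.mul ℝ ℝ).bilinearComp
      (Complex.reCLM.comp (ContinuousLinearMap.proj a)) (Complex.reCLM.comp (ContinuousLinearMap.proj a)) +
    (ContinuousLinearMap.mul ℝ ℝ).bilinearComp
      (Complex.imCLM.comp (ContinuousLinearMap.proj a)) (Complex.imCLM.comp (ContinuousLinearMap.proj a)))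

theorem realInner_apply (u v : κ → ℂ) :
    realInner κ u v = ∑ a, ((u a).re * (v a).re + (u a).im * (v a).im) := by
  simp [realInner]

/-- The square of the Hermitian norm of `ℂ^κ`. -/
noncomputable def sumSq (v : κ → ℂ) : ℝ := ∑ a, ‖v a‖ ^ 2

theorem realInner_self (v : κ → ℂ) : realInner κ v v = sumSq v := by
  rw [realInner_apply, sumSq]
  refine Finset.sum_congr rfl fun a _ => ?_
  rw [← Complex.normSq_eq_norm_sq, Complex.normSq_apply]

theorem realInner_comm (u v : κ → ℂ) : realInner κ u v = realInner κ v u := by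
  simp only [realInner_apply, mul_comm]

theorem realInner_I_left (u v : κ → ℂ) :
    realInner κ (Complex.I • u) v = -realInner κ u (Complex.I • v) := by
  simp only [realInner_apply, ← Finset.sum_neg_distrib, Pi.smul_apply, smul_eq_mul,
    Complex.mul_re, Complex.mul_im, Complex.I_re, Complex.I_im]
  exact Finset.sum_congr rfl fun a _ => by ring

theorem sumSq_pos {v : κ → ℂ} (hv : v ≠ 0) : 0 < sumSq v := by
  obtain ⟨a, ha⟩ := Function.ne_iff.1 hv
  refine Finset.sum_pos' (fun _ _ => by positivity) ⟨a, Finset.mem_univ a, ?_⟩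
  have : 0 < ‖v a‖ := norm_pos_iff.2 ha
  positivity

theorem contDiff_sumSq : ContDiff ℝ ω (sumSq : (κ → ℂ) → ℝ) := by
  have : (sumSq : (κ → ℂ) → ℝ) = fun v => realInner κ v v := by
    ext v
    rw [realInner_self]
  rw [this]
  exact (realInner κ).contDiff.clm_apply contDiff_id

theorem contDiffAt_log_sumSq {v : κ → ℂ} (hv : v ≠ 0) :
    ContDiffAt ℝ ω (fun w : κ → ℂ => Real.log (sumSq w)) v :=
  contDiff_sumSq.contDiffAt.log (sumSq_pos hv).ne'

/-- The potential `log ∑ |z_a|²` on `ℂ^κ` is plurisubharmonic, and its Levi form is degenerate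
only in the radial directions. -/
theorem hessC_log_sumSq_pos {v u : κ → ℂ} (hv : v ≠ 0) (hu : ∀ c : ℂ, u ≠ c • v) :
    0 < hessC (fun w : κ → ℂ => Real.log (sumSq w)) v u := by
  set B := realInner κ with hB
  have hN : ∀ w : κ → ℂ, HasFDerivAt (sumSq : (κ → ℂ) → ℝ) (B w + B.flip w) w := by
    intro w
    have h1 := B.hasFDerivAt (x := w) |>.clm_apply (hasFDerivAt_id w)
    have h2 : (fun w => B w (id w)) = (sumSq : (κ → ℂ) → ℝ) := funext fun w => realInner_self w
    rw [h2] at h1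
    refine h1.congr_fderiv ?_
    ext z
    simp
  have hpos : ∀ᶠ w in 𝓝 v, sumSq w ≠ 0 :=
    contDiff_sumSq.continuous.continuousAt.eventually_ne (sumSq_pos hv).ne'
  have h1 : fderiv ℝ (fun w : κ → ℂ => Real.log (sumSq w)) =ᶠ[𝓝 v]
      fun w => (sumSq w)⁻¹ • (B w + B.flip w) := by
    filter_upwards [hpos] with w hw
    exact ((hN w).log hw).fderiv
  have h2 : HasFDerivAt (fun w : κ → ℂ => (sumSq w)⁻¹ • (B w + B.flip w))
      ((sumSq v)⁻¹ • (B + B.flip) +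
        (-(sumSq v ^ 2)⁻¹ • (B v + B.flip v)).smulRight (B v + B.flip v)) v := by
    have h3 : HasFDerivAt (fun w : κ → ℂ => (sumSq w)⁻¹) (-(sumSq v ^ 2)⁻¹ • (B v + B.flip v)) v :=
      (hasDerivAt_inv (sumSq_pos hv).ne').comp_hasFDerivAt v (hN v)
    exact h3.smul (B.hasFDerivAt.add B.flip.hasFDerivAt)
  have hval : ∀ z : κ → ℂ, fderiv ℝ (fderiv ℝ (fun w : κ → ℂ => Real.log (sumSq w))) v z z =
      (sumSq v)⁻¹ * (2 * B z z) - (sumSq v ^ 2)⁻¹ * (2 * B v z) ^ 2 := by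
    intro z
    rw [h1.fderiv_eq, h2.fderiv]
    simp only [_root_.add_apply, _root_.smul_apply, ContinuousLinearMap.smulRight_apply,
      ContinuousLinearMap.flip_apply, smul_eq_mul, realInner_comm z v, hB]
    ring
  have hII : B (Complex.I • u) (Complex.I • u) = B u u := by
    rw [hB, realInner_I_left, smul_smul, Complex.I_mul_I, neg_one_smul, map_neg, neg_neg]
  rw [hessC, hval, hval, hII]
  set n := sumSq v with hn
  have hn0 : 0 < n := sumSq_pos hv
  set p := B v u with hp
  set q := B v (Complex.I • u) with hq
  -- the component of `u` orthogonal to `v`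
  set w : κ → ℂ := u - (p / n) • v - (-q / n) • (Complex.I • v) with hw
  have hw0 : w ≠ 0 := by
    intro h0
    refine hu ((p / n : ℝ) + (-q / n : ℝ) * Complex.I) ?_
    rw [add_smul, mul_smul, Complex.coe_smul, Complex.coe_smul]
    rw [hw, sub_sub, sub_eq_zero] at h0
    exact h0
  have hvI : B v (Complex.I • v) = 0 := by
    have h3 := realInner_I_left v v
    rw [realInner_comm] at h3
    change B v (Complex.I • v) = -B v (Complex.I • v) at h3
    linarith
  have hww : sumSq w = B u u - (p ^ 2 + q ^ 2) / n := by
    rw [← realInner_self]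
    change B w w = _
    have e1 : B v v = n := realInner_self v
    have e2 : B u v = p := realInner_comm u v
    have e3 : B (Complex.I • v) u = -q := realInner_I_left v u
    have e4 : B u (Complex.I • v) = -q := by rw [← e3]; exact realInner_comm _ _
    have e5 : B (Complex.I • v) v = 0 := by rw [← hvI]; exact realInner_comm _ _
    have e6 : B (Complex.I • v) (Complex.I • v) = n := by
      rw [← e1, hB, realInner_I_left, smul_smul, Complex.I_mul_I, neg_one_smul, map_neg, neg_neg]
    rw [hw]
    simp only [map_sub, map_smul, _root_.sub_apply, _root_.smul_apply, smul_eq_mul, e1, e2, e3,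
      e4, e5, e6, hvI, ← hp]
    field_simp
    ring
  have h4 := sumSq_pos hw0
  rw [hww] at h4
  have : n⁻¹ * (2 * B u u) - (n ^ 2)⁻¹ * (2 * p) ^ 2 +
      (n⁻¹ * (2 * B u u) - (n ^ 2)⁻¹ * (2 * q) ^ 2) =
      4 * n⁻¹ * (B u u - (p ^ 2 + q ^ 2) / n) := by
    field_simp
    ring
  rw [this]
  positivity

end LogSum

/-! ### Metrics defined by sections -/

section Sections

variable {E : Type*} [NormedAddCommGroup E] [NormedSpace ℂ E] {M : Type*}
  [TopologicalSpace M] [ChartedSpace E M]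

namespace HolLineBundle

variable {L : HolLineBundle E M} {m : ℕ} {κ : Type*} [Fintype κ]

/-- The sections `s` of `L ^ m` define an embedding in a projective space. The tangent vectors are
tested through the holomorphic discs that represent them. -/
structure EmbedsBy (L : HolLineBundle E M) (s : κ → L.PowSection m) : Prop where
  base_point_free : ∀ i, ∀ x ∈ L.U i, ∃ a, (s a).s i x ≠ 0
  injective : ∀ i j, ∀ x ∈ L.U i, ∀ y ∈ L.U j,
    (∃ c : ℂ, ∀ a, (s a).s j y = c * (s a).s i x) → x = y
  immersive : ∀ i, ∀ x ∈ L.U i, ∀ γ : ℂ → M, IsHolDisc E γ x →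
    (∃ c : ℂ, ∀ a, deriv ((s a).s i ∘ γ) 0 = c * (s a).s i x) →
    mfderiv 𝓘(ℂ, ℂ) 𝓘(ℂ, E) γ 0 = 0

theorem PowSection.holAt (s : L.PowSection m) {i : L.ι} {x : M} (hx : x ∈ L.U i) :
    ContMDiffAt 𝓘(ℂ, E) 𝓘(ℂ, ℂ) ω (s.s i) x :=
  (s.hol i).contMDiffAt ((L.isOpen_U i).mem_nhds hx)

theorem PowSection.analyticAt (s : L.PowSection m) {i : L.ι} {x : M} (hx : x ∈ L.U i) {γ : ℂ → M}
    (hγ : IsHolDisc E γ x) : AnalyticAt ℂ (s.s i ∘ γ) 0 := by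
  obtain ⟨hγ, rfl⟩ := hγ
  exact analyticAt_of_contMDiffAt ((s.holAt hx).comp 0 hγ)

theorem PowSection.deriv_comp (s : L.PowSection m) {i : L.ι} {γ : ℂ → M} (hx : γ 0 ∈ L.U i)
    (hγ : ContMDiffAt 𝓘(ℂ, ℂ) 𝓘(ℂ, E) ω γ 0) : deriv (s.s i ∘ γ) 0 =
      mfderiv 𝓘(ℂ, E) 𝓘(ℂ, ℂ) (s.s i) (γ 0) (mfderiv 𝓘(ℂ, ℂ) 𝓘(ℂ, E) γ 0 (1 : ℂ)) := by
  rw [← fderiv_apply_one_eq_deriv, ← mfderiv_eq_fderiv,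
    mfderiv_comp 0 ((s.holAt hx).mdifferentiableAt (by simp)) (hγ.mdifferentiableAt (by simp))]
  rfl

theorem IsEmbedding.embedsBy {k : ℕ} {s : Fin k → L.PowSection m} (hs : L.IsEmbedding s) :
    L.EmbedsBy s where
  base_point_free := hs.base_point_free
  injective := hs.injective
  immersive := by
    rintro i x hx γ ⟨hγ, rfl⟩ ⟨c, hc⟩
    refine ContinuousLinearMap.ext_ring ?_
    exact hs.immersive i (γ 0) hx (mfderiv 𝓘(ℂ, ℂ) 𝓘(ℂ, E) γ 0 (1 : ℂ)) ⟨c, fun a => by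
      rw [← hc a, (s a).deriv_comp hx hγ]⟩

theorem mfderiv_affineDisc [IsManifold 𝓘(ℂ, E) ω M] (x : M) (v : E) :
    mfderiv 𝓘(ℂ, ℂ) 𝓘(ℂ, E) (affineDisc E x v) 0 (1 : ℂ) = v := by
  obtain ⟨⟨hγ, hγx⟩, hd⟩ := isHolDisc_affineDisc (E := E) x v
  have h : mfderiv 𝓘(ℂ, ℂ) 𝓘(ℂ, E) (affineDisc E x v) 0 =
      fderivWithin ℂ (writtenInExtChartAt 𝓘(ℂ, ℂ) 𝓘(ℂ, E) 0 (affineDisc E x v)) (range 𝓘(ℂ, ℂ))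
        (extChartAt 𝓘(ℂ, ℂ) (0 : ℂ) 0) := (hγ.mdifferentiableAt (by simp)).mfderiv
  rw [h]
  simp only [writtenInExtChartAt, extChartAt, mfld_simps, fderivWithin_univ]
  rw [hγx]
  exact hd

omit [Fintype κ] in
/-- The immersion condition in terms of tangent vectors, each of which is the velocity of a disc. -/
theorem EmbedsBy.eq_zero_of_mfderiv [IsManifold 𝓘(ℂ, E) ω M] {s : κ → L.PowSection m}
    (hs : L.EmbedsBy s) {i : L.ι} {x : M} (hx : x ∈ L.U i) (v : E) {c : ℂ}
    (hc : ∀ a, mfderiv 𝓘(ℂ, E) 𝓘(ℂ, ℂ) ((s a).s i) x v = c * (s a).s i x) : v = 0 := by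
  obtain ⟨⟨hγ, hγx⟩, -⟩ := isHolDisc_affineDisc (E := E) x v
  have hv := mfderiv_affineDisc x v
  have h0 := hs.immersive i x hx (affineDisc E x v) ⟨hγ, hγx⟩ ⟨c, fun a => by
    rw [(s a).deriv_comp (by rwa [hγx]) hγ, hv, ← hc a]
    exact congrArg (fun y => mfderiv 𝓘(ℂ, E) 𝓘(ℂ, ℂ) ((s a).s i) y v) hγx⟩
  rw [h0] at hv
  exact hv.symm

theorem EmbedsBy.isAmple [IsManifold 𝓘(ℂ, E) ω M] {s : κ → L.PowSection m} (hs : L.EmbedsBy s)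
    (hm : 0 < m) : L.IsAmple := by
  refine ⟨m, hm, Fintype.card κ, fun k => s ((Fintype.equivFin κ).symm k), ⟨?_, ?_, ?_⟩⟩
  · intro i x hx
    obtain ⟨a, ha⟩ := hs.base_point_free i x hx
    exact ⟨Fintype.equivFin κ a, by simpa using ha⟩
  · rintro i j x hx y hy ⟨c, hc⟩
    exact hs.injective i j x hx y hy ⟨c, fun a => by simpa using hc (Fintype.equivFin κ a)⟩
  · rintro i x hx v ⟨c, hc⟩
    exact hs.eq_zero_of_mfderiv hx v ((Fintype.equivFin κ).symm.surjective.forall.2 hc)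

/-- The metric `(1 / m) log ∑ |s_a|²` of a line bundle defined by sections of its `m`-th power
without common zeros. -/
noncomputable def sectionMetric (s : κ → L.PowSection m) (hm : 0 < m)
    (hs : ∀ i, ∀ x ∈ L.U i, ∃ a, (s a).s i x ≠ 0) : SmoothMetric L where
  ψ i x := (m : ℝ)⁻¹ * Real.log (sumSq fun a => (s a).s i x)
  smooth i := by
    intro x hx
    have h1 : ContMDiffAt 𝓘(ℂ, E) 𝓘(ℂ, κ → ℂ) ω (fun y a => (s a).s i y) x :=
      contMDiffAt_pi_space.2 fun a => (s a).holAt hx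
    have h2 : (fun a => (s a).s i x) ≠ 0 :=
      let ⟨a, ha⟩ := hs i x hx
      Function.ne_iff.2 ⟨a, ha⟩
    have h3 := (((contDiffAt_log_sumSq h2).of_le (by simp) : ContDiffAt ℝ ∞ _ _)).contMDiffAt.comp x
      (contMDiffAt_real h1)
    exact (contMDiffAt_const.mul h3).contMDiffWithinAt
  trans i j x hx := by
    have hg : 0 < ‖L.g i j x‖ := norm_pos_iff.2 (L.g_ne_zero i j x hx)
    have h1 : (sumSq fun a => (s a).s i x) = (‖L.g i j x‖ ^ 2) ^ m *
        sumSq fun a => (s a).s j x := by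
      simp only [sumSq, Finset.mul_sum]
      refine Finset.sum_congr rfl fun a _ => ?_
      rw [(s a).trans i j x hx, norm_mul, norm_pow, mul_pow]
      ring
    have h2 : (fun a => (s a).s j x) ≠ 0 :=
      let ⟨a, ha⟩ := hs j x hx.2
      Function.ne_iff.2 ⟨a, ha⟩
    rw [h1, Real.log_mul (by positivity) (sumSq_pos h2).ne', Real.log_pow]
    field_simp
    ring

/-- The metric defined by sections which embed is positive: the Levi form of `log ∑ |z_a|²` degenerates
only in the radial directions, and immersivity excludes them. -/
theorem sectionMetric_isPositive [IsManifold 𝓘(ℂ, E) ω M] {s : κ → L.PowSection m}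
    (hs : L.EmbedsBy s) (hm : 0 < m) :
    (sectionMetric s hm hs.base_point_free).IsPositive := by
  intro i x hx γ hγ h0
  set c : ℂ → κ → ℂ := fun ζ a => (s a).s i (γ ζ) with hc
  have hcx : ∀ a, c 0 a = (s a).s i x := fun a => by rw [hc, ← hγ.2]
  have hv : c 0 ≠ 0 :=
    let ⟨a, ha⟩ := hs.base_point_free i _ hx
    Function.ne_iff.2 ⟨a, by rwa [hcx]⟩
  have han : AnalyticAt ℂ c 0 := AnalyticAt.pi fun a => (s a).analyticAt hx hγ
  have hder : ∀ a, deriv c 0 a = deriv ((s a).s i ∘ γ) 0 := fun a =>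
    ((hasDerivAt_pi.1 han.differentiableAt.hasDerivAt) a).deriv.symm
  have hpos := hessC_log_sumSq_pos (u := deriv c 0) hv fun t ht => h0
    (hs.immersive i x hx γ hγ ⟨t, fun a => by rw [← hder a, ht, ← hcx]; rfl⟩)
  have h2 : ContDiffAt ℝ 2 (fun w : κ → ℂ => Real.log (sumSq w)) (c 0) :=
    (contDiffAt_log_sumSq hv).of_le (by exact le_top)
  rw [← laplacian_comp_holomorphic h2 han] at hpos
  have h3 : levi ((sectionMetric s hm hs.base_point_free).ψ i) γ = (m : ℝ)⁻¹ *
      Laplacian.laplacian ((fun w : κ → ℂ => Real.log (sumSq w)) ∘ c) 0 :=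
    InnerProductSpace.laplacian_smul (m : ℝ)⁻¹ (h2.comp 0 (han.contDiffAt.restrict_scalars ℝ))
  rw [h3]
  positivity

theorem IsAmple.exists_metric [IsManifold 𝓘(ℂ, E) ω M] (hL : L.IsAmple) :
    ∃ ψ : SmoothMetric L, ψ.IsPositive := by
  obtain ⟨m, hm, k, s, hs⟩ := hL
  exact ⟨_, sectionMetric_isPositive hs.embedsBy hm⟩

end HolLineBundle

/-- A line bundle with a smooth positive metric has everything in its ample locus. -/
theorem SmoothMetric.IsPositive.mem_ampleLocus [IsManifold 𝓘(ℂ, E) ω M] [FiniteDimensional ℂ E]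
    {L : HolLineBundle E M} {ψ : SmoothMetric L} (hψ : ψ.IsPositive) (x : M) :
    x ∈ (RLineBundle.of L).ampleLocus := by
  have hpsh : ∀ {f : M → ℝ} {U : Set M}, IsOpen U → (∀ x ∈ U, SupportedAt E f x) →
      PSHOn E (fun x => (f x : EReal)) U := by
    intro f U hU hf
    have h0 : PSHOn E (fun _ : M => (0 : EReal)) U := by
      refine ⟨upperSemicontinuousOn_const, fun _ _ => EReal.zero_lt_top, fun x _ γ _ =>
        ⟨1, one_pos, fun r _ _ N => ?_⟩⟩
      have : (max (0 : EReal) (N : EReal)).toReal = max 0 N := by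
        rw [← EReal.coe_zero, ← EReal.coe_strictMono.monotone.map_max, EReal.toReal_coe]
      rw [this, Real.circleAverage_const]
      exact_mod_cast le_max_left 0 N
    exact (PSHOn.add_supported hU h0 hf).congr hU fun x _ => zero_add _
  refine ⟨⟨fun i x => ((ψ.ψ (RLineBundle.ofIdx i) x : ℝ) : EReal), fun i => ?_, fun i j x hx => ?_⟩,
    ⟨ψ.toKahler hψ 1 one_pos, fun i a => ?_⟩, ⟨univ, isOpen_univ, mem_univ x, fun i => ?_⟩⟩
  · refine hpsh ((RLineBundle.of L).isOpen_dom i) fun x hx => ?_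
    have hx := RLineBundle.mem_dom_of.1 hx
    exact (hψ _ x hx).supportedAt (ψ.smoothAt hx)
  · rw [RLineBundle.logTrans_of, ← EReal.coe_add, ψ.trans _ _ x
      ⟨RLineBundle.mem_dom_of.1 hx.1, RLineBundle.mem_dom_of.1 hx.2⟩]
  · have hO := ((RLineBundle.of L).isOpen_dom i).inter (L.isOpen_U a)
    refine (hpsh (f := fun y => 1 * Real.log (‖L.g (RLineBundle.ofIdx i) a y‖ ^ 2)) hO
      fun x hx => ?_).congr hO fun x hx => ?_
    · exact L.supportedAt_log ⟨RLineBundle.mem_dom_of.1 hx.1, hx.2⟩ 1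
    · change _ = ((ψ.ψ (RLineBundle.ofIdx i) x : ℝ) : EReal) - ((1 * ψ.ψ a x : ℝ) : EReal)
      rw [ψ.trans _ a x ⟨RLineBundle.mem_dom_of.1 hx.1, hx.2⟩, ← EReal.coe_sub]
      congr 1
      ring
  · exact ⟨_, (ψ.smooth (RLineBundle.ofIdx i)).mono
      fun y hy => RLineBundle.mem_dom_of.1 hy.2, fun y _ => rfl⟩

end Sections

/-! ### Products of line bundles and of sections -/

section Algebra

variable {E : Type*} [NormedAddCommGroup E] [NormedSpace ℂ E] {M : Type*}
  [TopologicalSpace M] [ChartedSpace E M]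
  {E' : Type*} [NormedAddCommGroup E'] [NormedSpace ℂ E'] {N : Type*}
  [TopologicalSpace N] [ChartedSpace E' N]

namespace HolLineBundle

/-- The tensor product of two line bundles. -/
def mul (L L' : HolLineBundle E M) : HolLineBundle E M where
  ι := L.ι × L'.ι
  U i := L.U i.1 ∩ L'.U i.2
  g i j x := L.g i.1 j.1 x * L'.g i.2 j.2 x
  isOpen_U i := (L.isOpen_U _).inter (L'.isOpen_U _)
  iUnion_U := eq_univ_of_forall fun x => by
    obtain ⟨i, hi⟩ := L.exists_mem x
    obtain ⟨j, hj⟩ := L'.exists_mem x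
    exact mem_iUnion.2 ⟨(i, j), hi, hj⟩
  hol_g i j := ((L.hol_g i.1 j.1).mono fun _ h => ⟨h.1.1, h.2.1⟩).mul
    ((L'.hol_g i.2 j.2).mono fun _ h => ⟨h.1.2, h.2.2⟩)
  g_ne_zero i j x h := mul_ne_zero (L.g_ne_zero _ _ x ⟨h.1.1, h.2.1⟩)
    (L'.g_ne_zero _ _ x ⟨h.1.2, h.2.2⟩)
  cocycle i j k x h := by
    rw [← L.cocycle i.1 j.1 k.1 x ⟨⟨h.1.1.1, h.1.2.1⟩, h.2.1⟩,
      ← L'.cocycle i.2 j.2 k.2 x ⟨⟨h.1.1.2, h.1.2.2⟩, h.2.2⟩]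
    ring

/-- The dual line bundle. -/
noncomputable def inv (L : HolLineBundle E M) : HolLineBundle E M where
  ι := L.ι
  U := L.U
  g i j x := (L.g i j x)⁻¹
  isOpen_U := L.isOpen_U
  iUnion_U := L.iUnion_U
  hol_g i j x hx := by
    have h := analyticAt_inv (𝕜 := ℂ) (L.g_ne_zero i j x hx)
    exact (h.contDiffAt (n := ω)).contMDiffAt.comp_contMDiffWithinAt x (L.hol_g i j x hx)
  g_ne_zero i j x h := inv_ne_zero (L.g_ne_zero i j x h)
  cocycle i j k x h := by rw [← L.cocycle i j k x h, mul_inv]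

/-- The power of a line bundle. -/
def pow (L : HolLineBundle E M) (m : ℕ) : HolLineBundle E M where
  ι := L.ι
  U := L.U
  g i j x := L.g i j x ^ m
  isOpen_U := L.isOpen_U
  iUnion_U := L.iUnion_U
  hol_g i j := (L.hol_g i j).pow m
  g_ne_zero i j x h := pow_ne_zero m (L.g_ne_zero i j x h)
  cocycle i j k x h := by rw [← L.cocycle i j k x h, mul_pow]

variable {L L' : HolLineBundle E M} {m : ℕ} {κ κ' : Type*}

namespace PowSection

/-- A section of `L ^ m` as a section of the line bundle `L.pow m`. -/
def toPow (s : L.PowSection m) : (L.pow m).PowSection 1 where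
  s := s.s
  hol := s.hol
  trans i j x hx := by
    change _ = (L.g i j x ^ m) ^ 1 * _
    rw [s.trans i j x hx, pow_one]

/-- The product of two sections. -/
def mul (s : L.PowSection m) (t : L'.PowSection m) : (L.mul L').PowSection m where
  s i x := s.s i.1 x * t.s i.2 x
  hol i := ((s.hol i.1).mono inter_subset_left).mul ((t.hol i.2).mono inter_subset_right)
  trans i j x hx := by
    change _ = (L.g i.1 j.1 x * L'.g i.2 j.2 x) ^ m * _
    rw [s.trans i.1 j.1 x ⟨hx.1.1, hx.2.1⟩, t.trans i.2 j.2 x ⟨hx.1.2, hx.2.2⟩]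
    ring

/-- The section `s - c t`. -/
def subSMul (s : L.PowSection m) (c : ℂ) (t : L.PowSection m) : L.PowSection m where
  s i x := s.s i x - c * t.s i x
  hol i := (s.hol i).sub (contMDiffOn_const.mul (t.hol i))
  trans i j x hx := by
    rw [s.trans i j x hx, t.trans i j x hx]
    ring

/-- The pullback of a section. -/
def pullback {L : HolLineBundle E' N} (s : L.PowSection m) (f : M → N)
    (hf : ContMDiff 𝓘(ℂ, E) 𝓘(ℂ, E') ω f) : (L.pullback f hf).PowSection m where
  s i x := s.s i (f x)
  hol i := (s.hol i).comp hf.contMDiffOn fun _ hx => hx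
  trans i j x hx := s.trans i j (f x) hx

end PowSection

/-- Sections of `L ^ m` are sections of the first power of a line bundle, so that `m = 1` may be
assumed. -/
theorem EmbedsBy.toPow {s : κ → L.PowSection m} (hs : L.EmbedsBy s) :
    (L.pow m).EmbedsBy fun a => (s a).toPow :=
  ⟨hs.base_point_free, hs.injective, hs.immersive⟩

end HolLineBundle

/-- If two vectors of products are proportional, then so are the factors. -/
theorem proportional_of_mul {κ κ' : Type*} {f f' : κ → ℂ} {g g' : κ' → ℂ} (hf' : ∃ a, f' a ≠ 0)
    (hg' : ∃ b, g' b ≠ 0) {c : ℂ} (h : ∀ a b, f' a * g' b = c * (f a * g b)) :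
    (∃ α, ∀ a, f' a = α * f a) ∧ ∃ β, ∀ b, g' b = β * g b := by
  obtain ⟨a₀, ha⟩ := hf'
  obtain ⟨b₀, hb⟩ := hg'
  refine ⟨⟨c * g b₀ / g' b₀, fun a => ?_⟩, ⟨c * f a₀ / f' a₀, fun b => ?_⟩⟩
  · rw [div_mul_eq_mul_div, eq_div_iff hb, h]; ring
  · rw [div_mul_eq_mul_div, eq_div_iff ha, mul_comm, h]; ring

/-- If the derivatives of the products of the coordinates of two vectors are proportional to the
products, then the derivatives of each vector are proportional to it. -/
theorem proportional_of_deriv_mul {κ κ' : Type*} {f f' : κ → ℂ} {g g' : κ' → ℂ}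
    (hf : ∃ a, f a ≠ 0) (hg : ∃ b, g b ≠ 0) {c : ℂ}
    (h : ∀ a b, f' a * g b + f a * g' b = c * (f a * g b)) :
    (∃ α, ∀ a, f' a = α * f a) ∧ ∃ β, ∀ b, g' b = β * g b := by
  obtain ⟨a₀, ha⟩ := hf
  obtain ⟨b₀, hb⟩ := hg
  refine ⟨⟨c - g' b₀ / g b₀, fun a => ?_⟩, ⟨c - f' a₀ / f a₀, fun b => ?_⟩⟩
  · field_simp
    linear_combination h a b₀
  · field_simp
    linear_combination h a₀ b

namespace HolLineBundle

variable {L L' : HolLineBundle E M} {m : ℕ} {κ κ' : Type*}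

/-- Products of sections embed as soon as the two systems of sections together separate the points
and the tangent vectors (the Segre map). -/
theorem embedsBy_mul {s : κ → L.PowSection m} {t : κ' → L'.PowSection m}
    (hs : ∀ i, ∀ x ∈ L.U i, ∃ a, (s a).s i x ≠ 0)
    (ht : ∀ i, ∀ x ∈ L'.U i, ∃ a, (t a).s i x ≠ 0)
    (hinj : ∀ i i' j j' x y, x ∈ L.U i → x ∈ L'.U i' → y ∈ L.U j → y ∈ L'.U j' →
      (∃ c : ℂ, ∀ a, (s a).s j y = c * (s a).s i x) →
      (∃ c : ℂ, ∀ a, (t a).s j' y = c * (t a).s i' x) → x = y)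
    (himm : ∀ i i' x, x ∈ L.U i → x ∈ L'.U i' → ∀ γ : ℂ → M, IsHolDisc E γ x →
      (∃ c : ℂ, ∀ a, deriv ((s a).s i ∘ γ) 0 = c * (s a).s i x) →
      (∃ c : ℂ, ∀ a, deriv ((t a).s i' ∘ γ) 0 = c * (t a).s i' x) →
      mfderiv 𝓘(ℂ, ℂ) 𝓘(ℂ, E) γ 0 = 0) :
    (L.mul L').EmbedsBy fun a : κ × κ' => (s a.1).mul (t a.2) where
  base_point_free := by
    rintro i x ⟨h1, h2⟩
    obtain ⟨a, ha⟩ := hs _ x h1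
    obtain ⟨b, hb⟩ := ht _ x h2
    exact ⟨(a, b), mul_ne_zero ha hb⟩
  injective := by
    rintro i j x ⟨hx1, hx2⟩ y ⟨hy1, hy2⟩ ⟨c, hc⟩
    have hc : ∀ a b, (s a).s j.1 y * (t b).s j.2 y = c * ((s a).s i.1 x * (t b).s i.2 x) :=
      fun a b => hc (a, b)
    obtain ⟨h1, h2⟩ := proportional_of_mul (hs _ y hy1) (ht _ y hy2) hc
    exact hinj _ _ _ _ x y hx1 hx2 hy1 hy2 h1 h2
  immersive := by
    rintro i x ⟨hx1, hx2⟩ γ hγ ⟨c, hc⟩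
    have hd : ∀ a b, deriv ((s a).s i.1 ∘ γ) 0 * (t b).s i.2 x +
        (s a).s i.1 x * deriv ((t b).s i.2 ∘ γ) 0 = c * ((s a).s i.1 x * (t b).s i.2 x) := by
      intro a b
      have h1 := ((s a).analyticAt hx1 hγ).differentiableAt.hasDerivAt
      have h2 := ((t b).analyticAt hx2 hγ).differentiableAt.hasDerivAt
      have h3 := (h1.mul h2).deriv
      simp only [Function.comp_apply, hγ.2] at h3
      rw [← h3]
      exact hc (a, b)
    obtain ⟨h1, h2⟩ := proportional_of_deriv_mul (hs _ x hx1) (ht _ x hx2) hd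
    exact himm _ _ x hx1 hx2 γ hγ h1 h2

end HolLineBundle

end Algebra

/-! ### The projective line -/

namespace ProjLine

/-- The affine charts as charts of the manifold structure. -/
noncomputable def chartHomeo (b : Bool) : OpenPartialHomeomorph ProjLine ℂ :=
  core.openPartialHomeomorph (chart b) ⟨b, rfl⟩

theorem chartHomeo_mem (b : Bool) : chartHomeo b ∈ IsManifold.maximalAtlas 𝓘(ℂ, ℂ) ω ProjLine :=
  IsManifold.subset_maximalAtlas (mem_iUnion₂.2 ⟨_, _, rfl⟩)

theorem contMDiffOn_chart (b : Bool) :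
    ContMDiffOn 𝓘(ℂ, ℂ) 𝓘(ℂ, ℂ) ω (fun l : ProjLine => hom l (!b) / hom l b) {l | hom l b ≠ 0} :=
  contMDiffOn_of_mem_maximalAtlas (chartHomeo_mem b)

end ProjLine

/-- Points of the projective line with proportional homogeneous coordinates are equal. -/
theorem ProjLine.eq_of_hom {x y : ProjLine} {c : ℂ}
    (h : ∀ β, ProjLine.hom y β = c * ProjLine.hom x β) : x = y := by
  have h2 : Projectivization.mk ℂ _ (Projectivization.rep_nonzero (K := ℂ) (V := ℂ × ℂ) x) =
      Projectivization.mk ℂ _ (Projectivization.rep_nonzero (K := ℂ) (V := ℂ × ℂ) y) :=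
    ((Projectivization.mk_eq_mk_iff' ℂ _ _ _ _).2
      ⟨c, Prod.ext (h true).symm (h false).symm⟩).symm
  exact (Projectivization.mk_rep (K := ℂ) (V := ℂ × ℂ) x).symm.trans
    (h2.trans (Projectivization.mk_rep (K := ℂ) (V := ℂ × ℂ) y))

theorem chartAt_zero : chartAt ℂ ProjLine.zero = ProjLine.chartHomeo false := by
  have h : ProjLine.hom ProjLine.zero false ≠ 0 := by
    obtain ⟨a, ha, h1, -⟩ := ProjLine.hom_ofCoord false 0
    rw [ProjLine.zero, h1]
    exact ha
  change ProjLine.core.openPartialHomeomorph _ _ = ProjLine.core.openPartialHomeomorph _ _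
  congr 1
  change ProjLine.chart (if ProjLine.hom ProjLine.zero false ≠ 0 then false else true) = _
  rw [if_pos h]

theorem hom_zero_true : ProjLine.hom ProjLine.zero true = 0 := by
  obtain ⟨a, ha, -, h2⟩ := ProjLine.hom_ofCoord false 0
  exact h2.trans (mul_zero a)

theorem hom_zero_false : ProjLine.hom ProjLine.zero false ≠ 0 := by
  obtain ⟨a, ha, h1, -⟩ := ProjLine.hom_ofCoord false 0
  rw [ProjLine.zero, h1]
  exact ha

theorem eq_zero_of_hom {l : ProjLine} (h : ProjLine.hom l true = 0) : l = ProjLine.zero := by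
  refine ProjLine.eq_of_hom (c := ProjLine.hom ProjLine.zero false / ProjLine.hom l false) fun β => ?_
  have hl : ProjLine.hom l false ≠ 0 := fun h0 => ProjLine.fst_ne l h0 h
  cases β
  · field_simp
  · rw [hom_zero_true, h, mul_zero]

/-- A disc whose coordinate in a chart has zero derivative has zero derivative. -/
theorem mfderiv_disc_eq_zero {E : Type*} [NormedAddCommGroup E] [NormedSpace ℂ E] {M : Type*}
    [TopologicalSpace M] [ChartedSpace E M] [IsManifold 𝓘(ℂ, E) ω M]
    {e : OpenPartialHomeomorph M E}
    (he : e ∈ IsManifold.maximalAtlas 𝓘(ℂ, E) ω M) {γ : ℂ → M} {x : M} (hγ : IsHolDisc E γ x)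
    (hx : x ∈ e.source) (h : deriv (e ∘ γ) 0 = 0) : mfderiv 𝓘(ℂ, ℂ) 𝓘(ℂ, E) γ 0 = 0 := by
  obtain ⟨hγ, rfl⟩ := hγ
  have h1 : ContMDiffAt 𝓘(ℂ, ℂ) 𝓘(ℂ, E) ω (e ∘ γ) 0 :=
    (contMDiffAt_of_mem_maximalAtlas he hx).comp 0 hγ
  have h2 : ContMDiffAt 𝓘(ℂ, E) 𝓘(ℂ, E) ω e.symm ((e ∘ γ) 0) :=
    contMDiffAt_symm_of_mem_maximalAtlas he (e.map_source hx)
  have h3 : γ =ᶠ[𝓝 0] e.symm ∘ (e ∘ γ) := by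
    filter_upwards [hγ.continuousAt (e.open_source.mem_nhds hx)] with ζ hζ
    exact (e.left_inv hζ).symm
  by_contra h0
  refine (mfderiv_disc_ne_zero_iff ⟨hγ, rfl⟩ (mem_chart_source E (γ 0))).1 h0 ?_
  have h4 : ContMDiffAt 𝓘(ℂ, E) 𝓘(ℂ, E) ω (chartAt E (γ 0) ∘ e.symm) ((e ∘ γ) 0) := by
    refine ContMDiffAt.comp _ ?_ h2
    rw [Function.comp_apply, e.left_inv hx]
    exact contMDiffAt_of_mem_maximalAtlas (IsManifold.chart_mem_maximalAtlas _)
      (mem_chart_source E (γ 0))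
  have h5 : DifferentiableAt ℂ (chartAt E (γ 0) ∘ e.symm) ((e ∘ γ) 0) :=
    h4.contDiffAt.differentiableAt (by simp)
  have h6 : HasDerivAt (e ∘ γ) 0 0 :=
    h ▸ (h1.contDiffAt.differentiableAt (by simp)).hasDerivAt
  have h7 : chartAt E (γ 0) ∘ γ =ᶠ[𝓝 0] (chartAt E (γ 0) ∘ e.symm) ∘ (e ∘ γ) :=
    h3.fun_comp _
  rw [h7.deriv_eq, (h5.hasFDerivAt.comp_hasDerivAt 0 h6).deriv, map_zero]

/-- The homogeneous coordinates as sections of `𝒪(1)`. -/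
noncomputable def homSection (β : Bool) : hyperplaneBundle.PowSection 1 where
  s b l := ProjLine.hom l β / ProjLine.hom l b
  hol b := by
    by_cases h : β = b
    · refine (contMDiffOn_const (c := (1 : ℂ))).congr fun l hl => ?_
      rw [h]
      exact div_self hl
    · obtain rfl : β = !b := by cases β <;> cases b <;> simp_all
      exact ProjLine.contMDiffOn_chart b
  trans i j l h := by
    have h1 : ProjLine.hom l i ≠ 0 := h.1
    have h2 : ProjLine.hom l j ≠ 0 := h.2
    change _ = (ProjLine.hom l j / ProjLine.hom l i) ^ 1 * _
    field_simp

/-- The homogeneous coordinates of the projective line separate its points and tangent vectors. -/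
theorem hyperplaneBundle_embedsBy : hyperplaneBundle.EmbedsBy homSection where
  base_point_free i x hx := ⟨i, div_ne_zero hx hx⟩
  injective := by
    rintro i j x hx y hy ⟨c, hc⟩
    have hx : ProjLine.hom x i ≠ 0 := hx
    have hy : ProjLine.hom y j ≠ 0 := hy
    have h1 : ∀ β, ProjLine.hom y β = (c * ProjLine.hom y j / ProjLine.hom x i) *
        ProjLine.hom x β := by
      intro β
      have : ProjLine.hom y β / ProjLine.hom y j = c * (ProjLine.hom x β / ProjLine.hom x i) := hc β
      field_simp at this ⊢
      linear_combination this
    exact ProjLine.eq_of_hom h1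
  immersive := by
    rintro i x hx γ hγ ⟨c, hc⟩
    have hx : ProjLine.hom x i ≠ 0 := hx
    have h0 := hc i
    have h1 := hc (!i)
    have h2 : (homSection i).s i ∘ γ =ᶠ[𝓝 0] fun _ => 1 := by
      have h3 : {l | ProjLine.hom l i ≠ 0} ∈ 𝓝 (γ 0) :=
        (ProjLine.isOpen_hom i).mem_nhds (by rw [hγ.2]; exact hx)
      filter_upwards [hγ.continuousAt h3] with ζ hζ
      exact div_self hζ
    rw [h2.deriv_eq, deriv_const] at h0
    have h3 : c = 0 := (mul_eq_zero.1 h0.symm).resolve_right (div_ne_zero hx hx)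
    rw [h3, zero_mul] at h1
    exact mfderiv_disc_eq_zero (ProjLine.chartHomeo_mem i) hγ hx h1

/-! ### Line bundles on `X × ℙ¹` -/

section Product

variable {E : Type} [NormedAddCommGroup E] [NormedSpace ℂ E] {X : Type*} [TopologicalSpace X]
  [ChartedSpace E X] [IsManifold 𝓘(ℂ, E) ω X]

/-- The velocity of a disc in `X × ℙ¹` is determined by the velocities of its projections. -/
theorem mfderiv_disc_prod_eq_zero {γ : ℂ → X × ProjLine} {z : X × ProjLine}
    (hγ : IsHolDisc (E × ℂ) γ z) (h1 : mfderiv 𝓘(ℂ, ℂ) 𝓘(ℂ, E) (Prod.fst ∘ γ) 0 = 0)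
    (h2 : mfderiv 𝓘(ℂ, ℂ) 𝓘(ℂ, ℂ) (Prod.snd ∘ γ) 0 = 0) :
    mfderiv 𝓘(ℂ, ℂ) 𝓘(ℂ, E × ℂ) γ 0 = 0 := by
  have hγ1 : IsHolDisc E (Prod.fst ∘ γ) z.1 := hγ.comp contMDiff_prFst.contMDiffAt
  have hγ2 : IsHolDisc ℂ (Prod.snd ∘ γ) z.2 := hγ.comp contMDiff_prSnd.contMDiffAt
  have d1 : deriv (chartAt E z.1 ∘ Prod.fst ∘ γ) 0 = 0 := by
    by_contra h
    exact (mfderiv_disc_ne_zero_iff hγ1 (mem_chart_source E z.1)).2 h h1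
  have d2 : deriv (chartAt ℂ z.2 ∘ Prod.snd ∘ γ) 0 = 0 := by
    by_contra h
    exact (mfderiv_disc_ne_zero_iff hγ2 (mem_chart_source ℂ z.2)).2 h h2
  have a1 := (hγ1.analyticAt_chart (mem_chart_source E z.1)).differentiableAt.hasDerivAt
  have a2 := (hγ2.analyticAt_chart (mem_chart_source ℂ z.2)).differentiableAt.hasDerivAt
  refine mfderiv_disc_eq_zero (IsManifold.chart_mem_maximalAtlas z) hγ (mem_chart_source _ z) ?_
  rw [d1] at a1
  rw [d2] at a2
  exact (a1.prodMk a2).deriv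

/-- The line bundle `B ⊠ 𝒪(1)` on `X × ℙ¹`. -/
noncomputable def prodBundle (B : HolLineBundle E X) : HolLineBundle (E × ℂ) (X × ProjLine) :=
  (B.pullback Prod.fst contMDiff_prFst).mul (hyperplaneBundle.pullback Prod.snd contMDiff_prSnd)

/-- The products of sections of `B` and of homogeneous coordinates. -/
noncomputable def prodSection {B : HolLineBundle E X} {κ : Type*} (s : κ → B.PowSection 1)
    (a : κ × Bool) : (prodBundle B).PowSection 1 :=
  ((s a.1).pullback Prod.fst contMDiff_prFst).mul
    ((homSection a.2).pullback Prod.snd contMDiff_prSnd)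

/-- The sections of `B ⊠ 𝒪(1)` embed by the Segre map. -/
theorem prodBundle_embedsBy {B : HolLineBundle E X} {κ : Type*} {s : κ → B.PowSection 1}
    (hs : B.EmbedsBy s) : (prodBundle B).EmbedsBy (prodSection s) := by
  refine HolLineBundle.embedsBy_mul (s := fun a => (s a).pullback Prod.fst contMDiff_prFst)
    (t := fun b => (homSection b).pullback Prod.snd contMDiff_prSnd)
    (fun i x hx => hs.base_point_free i (Prod.fst x) hx)
    (fun i x hx => hyperplaneBundle_embedsBy.base_point_free i (Prod.snd x) hx) ?_ ?_
  · intro i i' j j' (x : X × ProjLine) (y : X × ProjLine) hx hx' hy hy' h1 h2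
    exact Prod.ext (hs.injective i j _ hx _ hy h1)
      (hyperplaneBundle_embedsBy.injective i' j' _ hx' _ hy' h2)
  · intro i i' (x : X × ProjLine) hx hx' γ hγ h1 h2
    exact mfderiv_disc_prod_eq_zero hγ
      (hs.immersive i (Prod.fst x) hx _ (hγ.comp contMDiff_prFst.contMDiffAt) h1)
      (hyperplaneBundle_embedsBy.immersive i' x.2 hx' _ (hγ.comp contMDiff_prSnd.contMDiffAt) h2)

end Product

/-! ### The complex structure of the blowup -/

/-- Hadamard's lemma: an analytic function is, near `x`, its value at `x` plus a linear form
depending analytically on the point and applied to the increment. -/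
theorem exists_analyticAt_division {E : Type*} [NormedAddCommGroup E] [NormedSpace ℂ E]
    {f : E → ℂ} {x : E} (hf : AnalyticAt ℂ f x) : ∃ H : E → E →L[ℂ] ℂ, AnalyticAt ℂ H x ∧
      H x = fderiv ℂ f x ∧ ∀ᶠ y in 𝓝 x, f y = f x + H y (y - x) := by
  obtain ⟨p, r, hp⟩ := hf
  have hr : 0 < p.shift.radius := by
    rw [FormalMultilinearSeries.radius_shift]
    exact hp.r_pos.trans_le hp.r_le
  have h1 := p.shift.hasFPowerSeriesOnBall hr
  have h2 := (h1.comp_sub x)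
  rw [zero_add] at h2
  have h3 : ∀ᶠ y in 𝓝 x, f y = f x + p.shift.sum (y - x) (y - x) := by
    filter_upwards [hp.eventually_hasSum_sub, h2.eventually_hasSum_sub] with y hy hy'
    have h4 := (ContinuousLinearMap.apply ℂ ℂ (y - x)).hasSum hy'
    have h5 : ∀ n, (ContinuousLinearMap.apply ℂ ℂ (y - x)) (p.shift n fun _ => y - x) =
        p (n + 1) fun _ => y - x := by
      intro n
      change p (n + 1) (Fin.snoc (fun _ => y - x) (y - x)) = _
      congr 1
      ext i
      refine Fin.lastCases ?_ (fun j => ?_) i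
      · simp
      · simp
    simp only [h5] at h4
    have h6 := (hasSum_nat_add_iff' 1).2 hy
    have h7 : p 0 (fun _ => y - x) = f x := hp.coeff_zero _
    rw [Finset.sum_range_one, h7] at h6
    exact sub_eq_iff_eq_add'.1 (h6.unique h4)
  refine ⟨fun y => p.shift.sum (y - x), h2.analyticAt, ?_, h3⟩
  have h4 : HasFDerivAt (fun y => f x + p.shift.sum (y - x) (y - x)) (p.shift.sum (x - x)) x := by
    have h5 := (h2.analyticAt.differentiableAt.hasFDerivAt.clm_apply
      ((hasFDerivAt_id x).sub_const x)).const_add (f x)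
    refine h5.congr_fderiv ?_
    ext v
    simp
  rw [Filter.EventuallyEq.fderiv_eq h3, h4.fderiv]

namespace Blowup

variable {E : Type} [NormedAddCommGroup E] [NormedSpace ℂ E] {M : Type*} [TopologicalSpace M]
  [ChartedSpace E M] {q : M}

variable [IsManifold 𝓘(ℂ, E) ω M]

/-- The charts of the blowup as charts of its manifold structure. -/
noncomputable def chartHomeo (q : M) (k : AffDir E ⊕ {z : M // z ≠ q}) :
    OpenPartialHomeomorph (Blowup E q) E :=
  (core E q).openPartialHomeomorph (chart E q k) ⟨k, rfl⟩

theorem chartHomeo_mem (k : AffDir E ⊕ {z : M // z ≠ q}) :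
    chartHomeo q k ∈ IsManifold.maximalAtlas 𝓘(ℂ, E) ω (Blowup E q) :=
  IsManifold.subset_maximalAtlas (mem_iUnion₂.2 ⟨_, _, rfl⟩)

theorem isOpen_excDom (o : Option (AffDir E)) : IsOpen (excDom E q o) := (excBundle E q).isOpen_U o

theorem contMDiffOn_excChart (a : AffDir E) :
    ContMDiffOn 𝓘(ℂ, E) 𝓘(ℂ, E) ω (excChart q a) (excDom E q (some a)) :=
  contMDiffOn_of_mem_maximalAtlas (chartHomeo_mem (.inl a))

theorem contMDiffOn_point (a : AffDir E) :
    ContMDiffOn 𝓘(ℂ, E) 𝓘(ℂ, E) ω (point q a) (dom q a) :=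
  contMDiffOn_symm_of_mem_maximalAtlas (chartHomeo_mem (.inl a))

/-- The vector spanning the line attached to a point, normalized by `a.f = 1`. -/
noncomputable def dirN (a : AffDir E) (b : Blowup E q) : E := (a.f (dir b))⁻¹ • dir b

omit [IsManifold 𝓘(ℂ, E) ω M] in
/-- The vector attached to the coordinate of a point is the normalized vector on its line. -/
theorem lift_excChart (a : AffDir E) {b : Blowup E q} (hb : a.f (dir b) ≠ 0) :
    a.lift (excChart q a b) = dirN a b := by
  have h1 : a.f (excChart q a b) = a.f (coord E q (down b)) := by
    change a.f ((a.f (dir b))⁻¹ • dir b + (a.f (coord E q (down b)) - 1) • a.w) = _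
    simp [a.f_w, hb]
  rw [AffDir.lift, h1]
  change (a.f (dir b))⁻¹ • dir b + (a.f (coord E q (down b)) - 1) • a.w + _ = _
  rw [add_assoc, ← add_smul]
  simp [dirN]

theorem contMDiffOn_dirN (a : AffDir E) :
    ContMDiffOn 𝓘(ℂ, E) 𝓘(ℂ, E) ω (dirN a) (excDom E q (some a)) :=
  (a.contDiff_lift.contMDiff.comp_contMDiffOn (contMDiffOn_excChart a)).congr
    fun _ hb => (lift_excChart a hb.2).symm

theorem contMDiffOn_coord_down :
    ContMDiffOn 𝓘(ℂ, E) 𝓘(ℂ, E) ω (fun b : Blowup E q => coord E q (down b))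
      (down ⁻¹' (chartAt E q).source) :=
  contMDiffOn_coord.comp contMDiff_down.contMDiffOn fun _ h => h

/-- A disc at a point not on the exceptional divisor has zero derivative if its image has. -/
theorem mfderiv_eq_zero_of_down {γ : ℂ → Blowup E q} {b : Blowup E q} (hγ : IsHolDisc E γ b)
    (hb : down b ≠ q) (h : mfderiv 𝓘(ℂ, ℂ) 𝓘(ℂ, E) (down ∘ γ) 0 = 0) :
    mfderiv 𝓘(ℂ, ℂ) 𝓘(ℂ, E) γ 0 = 0 := by
  have hγ1 : IsHolDisc E (down ∘ γ) (down b) := hγ.comp contMDiff_down.contMDiffAt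
  refine mfderiv_disc_eq_zero (chartHomeo_mem (.inr ⟨down b, hb⟩)) hγ
    ⟨mem_chart_source E (down b), hb⟩ ?_
  by_contra h1
  exact (mfderiv_disc_ne_zero_iff hγ1 (mem_chart_source E (down b))).2 h1 h

/-- A disc has zero derivative if its image in `M` and the lines attached to its points
have. -/
theorem mfderiv_eq_zero_of_dirN {γ : ℂ → Blowup E q} {b : Blowup E q} (hγ : IsHolDisc E γ b)
    {a : AffDir E} (hb : b ∈ excDom E q (some a))
    (h : mfderiv 𝓘(ℂ, ℂ) 𝓘(ℂ, E) (down ∘ γ) 0 = 0) (hd : deriv (dirN a ∘ γ) 0 = 0) :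
    mfderiv 𝓘(ℂ, ℂ) 𝓘(ℂ, E) γ 0 = 0 := by
  have hγ1 : IsHolDisc E (down ∘ γ) (down b) := hγ.comp contMDiff_down.contMDiffAt
  refine mfderiv_disc_eq_zero (chartHomeo_mem (.inl a)) hγ hb ?_
  have h1 : deriv (chartAt E q ∘ down ∘ γ) 0 = 0 := by
    by_contra h1
    exact (mfderiv_disc_ne_zero_iff hγ1 hb.1).2 h1 h
  have h2 := (hγ1.analyticAt_chart hb.1).differentiableAt.hasDerivAt
  rw [h1] at h2
  have h3 : HasDerivAt (dirN a ∘ γ) 0 0 := by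
    have h4 : ContMDiffAt 𝓘(ℂ, ℂ) 𝓘(ℂ, E) ω (dirN a ∘ γ) 0 := by
      refine ContMDiffAt.comp 0 ?_ hγ.1
      rw [hγ.2]
      exact (contMDiffOn_dirN a).contMDiffAt ((isOpen_excDom _).mem_nhds hb)
    rw [← hd]
    exact (h4.contDiffAt.differentiableAt (by simp)).hasDerivAt
  have h5 : HasDerivAt (fun ζ => dirN a (γ ζ) +
      (a.f (chartAt E q (down (γ ζ)) - chartAt E q q) - 1) • a.w) 0 0 := by
    have h6 := (a.f.hasFDerivAt.comp_hasDerivAt (0 : ℂ) (h2.sub_const (chartAt E q q))).sub_const 1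
    have h7 := h3.add (h6.smul_const a.w)
    simpa [Pi.add_def, Function.comp_def] using h7
  exact h5.deriv

end Blowup

/-! ### Sections of `π^*B - E` on the blowup -/

/-- The target `ℂ` being a vector space, only the source is read in a chart. -/
theorem mfderiv_eq_fderiv_chart {E : Type*} [NormedAddCommGroup E] [NormedSpace ℂ E] {M : Type*}
    [TopologicalSpace M] [ChartedSpace E M] {f : M → ℂ} {q : M}
    (hf : MDifferentiableAt 𝓘(ℂ, E) 𝓘(ℂ, ℂ) f q) (v : E) :
    mfderiv 𝓘(ℂ, E) 𝓘(ℂ, ℂ) f q v = fderiv ℂ (f ∘ (chartAt E q).symm) (chartAt E q q) v := by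
  have h : mfderiv 𝓘(ℂ, E) 𝓘(ℂ, ℂ) f q =
      fderivWithin ℂ (writtenInExtChartAt 𝓘(ℂ, E) 𝓘(ℂ, ℂ) q f) (range 𝓘(ℂ, E))
        (extChartAt 𝓘(ℂ, E) q q) := hf.mfderiv
  rw [h]
  simp only [writtenInExtChartAt, extChartAt, mfld_simps, fderivWithin_univ]
  rfl

theorem analyticAt_comp_chart_symm {E : Type*} [NormedAddCommGroup E] [NormedSpace ℂ E] {M : Type*}
    [TopologicalSpace M] [ChartedSpace E M] [IsManifold 𝓘(ℂ, E) ω M] {f : M → ℂ} {q : M}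
    (hf : ContMDiffAt 𝓘(ℂ, E) 𝓘(ℂ, ℂ) ω f q) :
    AnalyticAt ℂ (f ∘ (chartAt E q).symm) (chartAt E q q) := by
  refine (ContMDiffAt.contDiffAt (ContMDiffAt.comp _ ?_ (contMDiffAt_symm_of_mem_maximalAtlas
    (IsManifold.chart_mem_maximalAtlas q) ((chartAt E q).map_source
      (mem_chart_source E q))))).analyticAt
  rwa [(chartAt E q).left_inv (mem_chart_source E q)]

namespace Blowup

variable {E : Type} [NormedAddCommGroup E] [NormedSpace ℂ E] {M : Type*} [TopologicalSpace M]
  [ChartedSpace E M] {q : M} [IsManifold 𝓘(ℂ, E) ω M]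

/-- The leading term at the points of the blowup of a function vanishing at `q`: its value away
from the exceptional divisor, and its derivative on the lines in the tangent space. -/
noncomputable def leading (f : M → ℂ) : Blowup E q → ℂ
  | off x _ => f x
  | exc l => fderiv ℂ (f ∘ (chartAt E q).symm) (chartAt E q q) l.rep

/-- Near the exceptional divisor, the quotient of a function vanishing at `q` by the equation of
the divisor is given by Hadamard's lemma. -/
theorem exists_leading_eq {f : M → ℂ} (hf : ContMDiffAt 𝓘(ℂ, E) 𝓘(ℂ, ℂ) ω f q) (h0 : f q = 0) :
    ∃ H : E → E →L[ℂ] ℂ, AnalyticAt ℂ H (chartAt E q q) ∧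
      H (chartAt E q q) = fderiv ℂ (f ∘ (chartAt E q).symm) (chartAt E q q) ∧
      ∀ (a : AffDir E) (b : Blowup E q), b ∈ excDom E q (some a) → down b = q →
        ∀ᶠ b' in 𝓝 b, leading f b' / a.f (dir b') = H (chartAt E q (down b')) (dirN a b') := by
  obtain ⟨H, hH, hH0, hHf⟩ := exists_analyticAt_division (analyticAt_comp_chart_symm hf)
  refine ⟨H, hH, hH0, fun a b hb hbq => ?_⟩
  have hc : ContinuousAt (fun b' : Blowup E q => chartAt E q (down b')) b := by
    refine ContinuousAt.comp ?_ contMDiff_down.continuous.continuousAt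
    rw [hbq]
    exact (chartAt E q).continuousAt (mem_chart_source E q)
  have hHf' := hc.eventually (show ∀ᶠ y in 𝓝 (chartAt E q (down b)), _ by rw [hbq]; exact hHf)
  filter_upwards [hHf', (isOpen_excDom (some a)).mem_nhds hb] with b' h1 h2
  have hdir : H (chartAt E q (down b')) (dir b') = leading f b' := by
    cases b' with
    | off x hx =>
      have h3 : (f ∘ (chartAt E q).symm) (chartAt E q x) =
        (f ∘ (chartAt E q).symm) (chartAt E q q) + H (chartAt E q x) (coord E q x) := h1
      simp only [Function.comp_apply] at h3
      rw [(chartAt E q).left_inv (show x ∈ _ from h2.1), (chartAt E q).left_inv (mem_chart_source E q), h0,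
        zero_add] at h3
      exact h3.symm
    | exc l =>
      change H (chartAt E q q) _ = _
      rw [hH0]
      rfl
  rw [dirN, map_smul, hdir, smul_eq_mul, div_eq_inv_mul]

/-- A function vanishing at `q`, divided by the local equation of the exceptional divisor, is
holomorphic on the blowup. -/
theorem contMDiffAt_leading_div {f : M → ℂ} {b : Blowup E q}
    (hf : ContMDiffAt 𝓘(ℂ, E) 𝓘(ℂ, ℂ) ω f (down b)) (h0 : down b = q → f q = 0)
    {o : Option (AffDir E)} (hb : b ∈ excDom E q o) :
    ContMDiffAt 𝓘(ℂ, E) 𝓘(ℂ, ℂ) ω (fun b : Blowup E q => leading f b / excFactor b o) b := by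
  by_cases hbq : down b = q
  · cases o with
    | none => exact absurd hbq hb
    | some a =>
      rw [hbq] at hf
      obtain ⟨H, hH, -, hHb⟩ := exists_leading_eq hf (h0 hbq)
      refine ContMDiffAt.congr_of_eventuallyEq ?_ (hHb a b hb hbq)
      have h1 : ContMDiffAt 𝓘(ℂ, E) 𝓘(ℂ, E) ω (dirN a) b :=
        (contMDiffOn_dirN a).contMDiffAt ((isOpen_excDom _).mem_nhds hb)
      have h2 : ContMDiffAt 𝓘(ℂ, E) 𝓘(ℂ, E →L[ℂ] ℂ) ω
          (fun b' : Blowup E q => H (chartAt E q (down b'))) b := by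
        have h3 : ContMDiffAt 𝓘(ℂ, E) 𝓘(ℂ, E →L[ℂ] ℂ) ω H (chartAt E q (down b)) := by
          rw [hbq]
          exact hH.contDiffAt.contMDiffAt
        refine h3.comp b (ContMDiffAt.comp b ?_ contMDiff_down.contMDiffAt)
        exact contMDiffAt_of_mem_maximalAtlas (IsManifold.chart_mem_maximalAtlas q)
          (by rw [hbq]; exact mem_chart_source E q)
      exact h2.clm_apply h1
  · have hne : ∀ᶠ b' in 𝓝 b, down b' ≠ q :=
      contMDiff_down.continuous.continuousAt ((isOpen_ne E q).mem_nhds hbq)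
    have h1 : ContMDiffAt 𝓘(ℂ, E) 𝓘(ℂ, ℂ) ω (fun b' : Blowup E q => f (down b')) b :=
      hf.comp b contMDiff_down.contMDiffAt
    have hl : ∀ {b' : Blowup E q}, down b' ≠ q → leading f b' = f (down b') := by
      intro b' hb'
      cases b' with
      | off x hx => rfl
      | exc l => exact absurd rfl hb'
    cases o with
    | none =>
      refine h1.congr_of_eventuallyEq ?_
      filter_upwards [hne] with b' hb'
      change leading f b' / 1 = _
      rw [div_one, hl hb']
    | some a =>
      have h2 : ContMDiffAt 𝓘(ℂ, E) 𝓘(ℂ, ℂ) ω (fun b' : Blowup E q => a.f (coord E q (down b'))) b :=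
        (a.f.contMDiff.comp_contMDiffOn contMDiffOn_coord_down).contMDiffAt
          (((chartAt E q).open_source.preimage contMDiff_down.continuous).mem_nhds hb.1)
      have h3 : a.f (coord E q (down b)) ≠ 0 := by
        rw [← dir_of_ne hbq]
        exact hb.2
      have h4 : ContMDiffAt 𝓘(ℂ, E) 𝓘(ℂ, ℂ) ω
          (fun b' : Blowup E q => (a.f (coord E q (down b')))⁻¹) b :=
        ((analyticAt_inv (𝕜 := ℂ) h3).contDiffAt (n := ω)).contMDiffAt.comp b h2
      refine (h1.mul h4).congr_of_eventuallyEq ?_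
      filter_upwards [hne] with b' hb'
      change leading f b' / a.f (dir b') = _
      rw [hl hb', dir_of_ne hb', div_eq_mul_inv]
      rfl

variable (q) in
/-- The line bundle `π^*B - E` on the blowup. -/
noncomputable def quotBundle (B : HolLineBundle E M) : HolLineBundle E (Blowup E q) :=
  (B.pullback down contMDiff_down).mul (excBundle E q).inv

variable {B : HolLineBundle E M}

/-- A section of `B` vanishing at `q` as a section of `π^*B - E`. -/
noncomputable def quotSection (l : B.PowSection 1) (hl : ∀ i, q ∈ B.U i → l.s i q = 0) :
    (quotBundle q B).PowSection 1 where
  s i b := leading (l.s i.1) b / excFactor b i.2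
  hol := by
    rintro ⟨i, o⟩ b ⟨hb1, hb2⟩
    refine (contMDiffAt_leading_div (l.holAt hb1) (fun h => hl i ?_) hb2).contMDiffWithinAt
    rw [← h]
    exact hb1
  trans := by
    rintro ⟨i, o⟩ ⟨j, o'⟩ b ⟨⟨hi, ho⟩, ⟨hj, ho'⟩⟩
    have hi : down b ∈ B.U i := hi
    have hj : down b ∈ B.U j := hj
    have ho := excFactor_ne (i := o) (b := b) ho
    have ho' := excFactor_ne (i := o') (b := b) ho'
    change _ = (B.g i j (down b) * (excFactor b o / excFactor b o')⁻¹) ^ 1 *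
      (leading (l.s j) b / excFactor b o')
    have key : leading (l.s i) b = B.g i j (down b) * leading (l.s j) b := by
      cases b with
      | off x hx =>
        change l.s i x = B.g i j x * l.s j x
        rw [l.trans i j x ⟨hi, hj⟩, pow_one]
      | exc ℓ =>
        have hi : q ∈ B.U i := hi
        have hj : q ∈ B.U j := hj
        have h1 : AnalyticAt ℂ (B.g i j ∘ (chartAt E q).symm) (chartAt E q q) :=
          analyticAt_comp_chart_symm ((B.hol_g i j).contMDiffAt
            (((B.isOpen_U i).inter (B.isOpen_U j)).mem_nhds ⟨hi, hj⟩))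
        have h2 : AnalyticAt ℂ (l.s j ∘ (chartAt E q).symm) (chartAt E q q) :=
          analyticAt_comp_chart_symm (l.holAt hj)
        have h3 : l.s i ∘ (chartAt E q).symm =ᶠ[𝓝 (chartAt E q q)]
            (B.g i j ∘ (chartAt E q).symm) * (l.s j ∘ (chartAt E q).symm) := by
          have h4 : ContinuousAt (chartAt E q).symm (chartAt E q q) :=
            (chartAt E q).continuousAt_symm ((chartAt E q).map_source (mem_chart_source E q))
          have h5 : B.U i ∩ B.U j ∈ 𝓝 ((chartAt E q).symm (chartAt E q q)) := by
            rw [(chartAt E q).left_inv (mem_chart_source E q)]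
            exact ((B.isOpen_U i).inter (B.isOpen_U j)).mem_nhds ⟨hi, hj⟩
          filter_upwards [h4 h5] with y hy
          simpa using l.trans i j _ hy
        change fderiv ℂ (l.s i ∘ (chartAt E q).symm) (chartAt E q q) ℓ.rep =
          B.g i j q * fderiv ℂ (l.s j ∘ (chartAt E q).symm) (chartAt E q q) ℓ.rep
        rw [h3.fderiv_eq, fderiv_mul h1.differentiableAt h2.differentiableAt]
        simp [(chartAt E q).left_inv (mem_chart_source E q), hl j hj]
    rw [key]
    field_simp

variable {κ : Type*}

omit [IsManifold 𝓘(ℂ, E) ω M] in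
/-- Sections without common zeros can be normalized at a point by one of them. -/
theorem exists_normalization {s : κ → B.PowSection 1} (hs : B.EmbedsBy s) (q : M) :
    ∃ (a₀ : κ) (c : κ → ℂ), ∀ i, q ∈ B.U i → (s a₀).s i q ≠ 0 ∧
      ∀ a, (s a).s i q = c a * (s a₀).s i q := by
  obtain ⟨i₀, hi₀⟩ := B.exists_mem q
  obtain ⟨a₀, ha₀⟩ := hs.base_point_free i₀ q hi₀
  refine ⟨a₀, fun a => (s a).s i₀ q / (s a₀).s i₀ q, fun i hi => ?_⟩
  have hg := B.g_ne_zero i i₀ q ⟨hi, hi₀⟩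
  refine ⟨?_, fun a => ?_⟩
  · rw [(s a₀).trans i i₀ q ⟨hi, hi₀⟩, pow_one]
    exact mul_ne_zero hg ha₀
  · rw [(s a).trans i i₀ q ⟨hi, hi₀⟩, (s a₀).trans i i₀ q ⟨hi, hi₀⟩]
    field_simp

section Normalized

variable {s : κ → B.PowSection 1} {a₀ : κ} {c : κ → ℂ}

omit [IsManifold 𝓘(ℂ, E) ω M] in
theorem subSMul_vanishes (h : ∀ i, q ∈ B.U i → (s a₀).s i q ≠ 0 ∧
    ∀ a, (s a).s i q = c a * (s a₀).s i q) (a : κ) (i : B.ι) (hi : q ∈ B.U i) :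
    ((s a).subSMul (c a) (s a₀)).s i q = 0 :=
  sub_eq_zero.2 ((h i hi).2 a)

/-- The sections of `π^*B - E` obtained from the combinations of the sections `s` vanishing
at `q`. -/
noncomputable def blowSection (h : ∀ i, q ∈ B.U i → (s a₀).s i q ≠ 0 ∧
    ∀ a, (s a).s i q = c a * (s a₀).s i q) (a : κ) : (quotBundle q B).PowSection 1 :=
  quotSection ((s a).subSMul (c a) (s a₀)) (subSMul_vanishes h a)

/-- The differentials at `q` of the combinations vanishing at `q` separate the tangent
vectors. -/
theorem eq_zero_of_fderiv (hs : B.EmbedsBy s) (h : ∀ i, q ∈ B.U i → (s a₀).s i q ≠ 0 ∧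
    ∀ a, (s a).s i q = c a * (s a₀).s i q) {i : B.ι} (hi : q ∈ B.U i) {v : E}
    (hv : ∀ a, fderiv ℂ (((s a).subSMul (c a) (s a₀)).s i ∘ (chartAt E q).symm) (chartAt E q q) v
      = 0) : v = 0 := by
  have hd : ∀ a, DifferentiableAt ℂ ((s a).s i ∘ (chartAt E q).symm) (chartAt E q q) := fun a =>
    (analyticAt_comp_chart_symm ((s a).holAt hi)).differentiableAt
  refine hs.eq_zero_of_mfderiv hi v (c := fderiv ℂ ((s a₀).s i ∘ (chartAt E q).symm) (chartAt E q q) v /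
    (s a₀).s i q) fun a => ?_
  have h1 := hv a
  have h2 : ((s a).subSMul (c a) (s a₀)).s i ∘ (chartAt E q).symm =
      (s a).s i ∘ (chartAt E q).symm - c a • ((s a₀).s i ∘ (chartAt E q).symm) := rfl
  rw [h2, fderiv_sub (hd a) ((hd a₀).const_smul _), fderiv_const_smul (hd a₀)] at h1
  refine (mfderiv_eq_fderiv_chart (((s a).holAt hi).mdifferentiableAt (by simp)) v).trans ?_
  rw [(h i hi).2 a]
  have h3 := (h i hi).1
  simp only [_root_.sub_apply, _root_.smul_apply, smul_eq_mul] at h1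
  field_simp
  linear_combination h1

/-- The sections of `π^*B - E` have no common zeros: off the exceptional divisor because the sections
of `B` separate points, on it because they separate tangent vectors. -/
theorem blowSection_base_point_free (hs : B.EmbedsBy s) (h : ∀ i, q ∈ B.U i →
    (s a₀).s i q ≠ 0 ∧ ∀ a, (s a).s i q = c a * (s a₀).s i q) :
    ∀ i, ∀ b ∈ (quotBundle q B).U i, ∃ a, (blowSection h a).s i b ≠ 0 := by
  rintro ⟨i, o⟩ b ⟨hi, ho⟩
  have hi : down b ∈ B.U i := hi
  by_contra! hall
  have h1 : ∀ a, leading (((s a).subSMul (c a) (s a₀)).s i) b = 0 := fun a =>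
    (div_eq_zero_iff.1 (hall a)).resolve_right (excFactor_ne (i := o) ho)
  cases b with
  | off x hx =>
    have hi : x ∈ B.U i := hi
    obtain ⟨j, hj⟩ := B.exists_mem q
    have h2 : ∀ a, (s a).s i x = c a * (s a₀).s i x := fun a => sub_eq_zero.1 (h1 a)
    refine hx (hs.injective j i q hj x hi ⟨(s a₀).s i x / (s a₀).s j q, fun a => ?_⟩).symm
    have h3 := (h j hj).1
    rw [h2, (h j hj).2 a]
    field_simp
  | exc l => exact l.rep_nonzero (eq_zero_of_fderiv hs h hi h1)

variable (q B) in
/-- The line bundle `2π^*B - E` on the blowup. -/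
noncomputable def blowBundle : HolLineBundle E (Blowup E q) :=
  (B.pullback down contMDiff_down).mul (quotBundle q B)

/-- The products of the sections of `B` and of `π^*B - E`. -/
noncomputable def embSection (h : ∀ i, q ∈ B.U i → (s a₀).s i q ≠ 0 ∧
    ∀ a, (s a).s i q = c a * (s a₀).s i q) (a : κ × κ) : (blowBundle q B).PowSection 1 :=
  ((s a.1).pullback down contMDiff_down).mul (blowSection h a.2)

/-- The sections of `2π^*B - E` which embed the blowup. -/
theorem blowBundle_embedsBy (hs : B.EmbedsBy s) (h : ∀ i, q ∈ B.U i →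
    (s a₀).s i q ≠ 0 ∧ ∀ a, (s a).s i q = c a * (s a₀).s i q) :
    (blowBundle q B).EmbedsBy (embSection h) := by
  refine HolLineBundle.embedsBy_mul (s := fun a => (s a).pullback down contMDiff_down)
    (t := blowSection h) (fun i x hx => hs.base_point_free i (down x) hx)
    (blowSection_base_point_free hs h) ?_ ?_
  -- The sections of `B` separate the images in `M`. Over `q`, the differentials of the sections
  -- vanishing there take proportional values on the two lines, which therefore agree.
  · rintro i ⟨i', o⟩ j ⟨j', o'⟩ b b' hb ⟨hi', ho⟩ hb' ⟨hj', ho'⟩ h1 ⟨t, ht⟩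
    have h2 : down b = down b' := hs.injective i j _ hb _ hb' h1
    by_cases hq : down b = q
    · cases b with
      | off x hx => exact absurd hq hx
      | exc l =>
        cases b' with
        | off x hx => exact absurd (h2.symm.trans hq) hx
        | exc l' =>
          have hi' : q ∈ B.U i' := hi'
          have e1 := excFactor_ne (i := o) ho
          have e2 := excFactor_ne (i := o') ho'
          have hg : (quotBundle q B).g (j', o') (i', o') (exc l') ≠ 0 :=
            (quotBundle q B).g_ne_zero (j', o') (i', o') (exc l') ⟨⟨hj', ho'⟩, hi', ho'⟩
          set v : κ → E →L[ℂ] ℂ := fun a => fderiv ℂ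
            (fun y => ((s a).subSMul (c a) (s a₀)).s i' ((chartAt E q).symm y))
            (chartAt E q q) with hv
          have h3 : ∀ a, (quotBundle q B).g (j', o') (i', o') (exc l') *
              (v a l'.rep / excFactor (exc l' : Blowup E q) o') = t * (v a l.rep / excFactor (exc l : Blowup E q) o) := by
            intro a
            have h4 := (blowSection h a).trans (j', o') (i', o') (exc l')
              ⟨⟨hj', ho'⟩, hi', ho'⟩
            rw [pow_one] at h4
            exact h4.symm.trans (ht a)
          set g := (quotBundle q B).g (j', o') (i', o') (exc l')
          set e := excFactor (exc l : Blowup E q) o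
          set e' := excFactor (exc l' : Blowup E q) o'
          have h5 : l'.rep - (t * e' / (g * e)) • l.rep = 0 := by
            refine eq_zero_of_fderiv hs h hi' fun a => ?_
            change v a _ = 0
            rw [map_sub, map_smul, smul_eq_mul]
            have := h3 a
            field_simp at this ⊢
            linear_combination this
          have h6 : Projectivization.mk ℂ _ l'.rep_nonzero = Projectivization.mk ℂ _ l.rep_nonzero :=
            (Projectivization.mk_eq_mk_iff' ℂ _ _ _ _).2 ⟨_, (sub_eq_zero.1 h5).symm⟩
          rw [Projectivization.mk_rep, Projectivization.mk_rep] at h6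
          rw [h6]
    · exact ext_of_down h2 hq
  -- The image of a disc in `M` has zero derivative. Over `q`, the derivative of the normalized
  -- direction is proportional to the direction itself, where `a.f = 1`; but `a.f` is constant on
  -- normalized directions, so this derivative is zero.
  · rintro i ⟨i', o⟩ b hb ⟨hi', ho⟩ γ hγ h1 ⟨t, ht⟩
    have hi' : down b ∈ B.U i' := hi'
    have h2 : mfderiv 𝓘(ℂ, ℂ) 𝓘(ℂ, E) (down ∘ γ) 0 = 0 :=
      hs.immersive i (down b) hb _ (hγ.comp contMDiff_down.contMDiffAt) h1
    by_cases hq : down b = q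
    · cases o with
      | none => exact absurd hq ho
      | some a =>
        refine mfderiv_eq_zero_of_dirN hγ ho h2 ?_
        have hi' : q ∈ B.U i' := hq ▸ hi'
        have hγc : ContinuousAt γ 0 := hγ.continuousAt
        have hu : HasDerivAt (dirN a ∘ γ) (deriv (dirN a ∘ γ) 0) 0 := by
          have h4 : ContMDiffAt 𝓘(ℂ, ℂ) 𝓘(ℂ, E) ω (dirN a ∘ γ) 0 := by
            refine ContMDiffAt.comp 0 ?_ hγ.1
            rw [hγ.2]
            exact (contMDiffOn_dirN a).contMDiffAt ((isOpen_excDom _).mem_nhds ho)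
          exact (h4.contDiffAt.differentiableAt (by simp)).hasDerivAt
        have hx : HasDerivAt (chartAt E q ∘ down ∘ γ) 0 0 := by
          have hγ1 : IsHolDisc E (down ∘ γ) (down b) := hγ.comp contMDiff_down.contMDiffAt
          have h3 := (hγ1.analyticAt_chart ho.1).differentiableAt.hasDerivAt
          rwa [show deriv (chartAt E q ∘ down ∘ γ) 0 = 0 by
            by_contra h1
            exact (mfderiv_disc_ne_zero_iff hγ1 ho.1).2 h1 h2] at h3
        set u' := deriv (dirN a ∘ γ) 0 with hu'
        have h0 : u' - t • dirN a b = 0 := by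
          refine eq_zero_of_fderiv hs h hi' fun k => ?_
          obtain ⟨H, hH, hH0, hHb⟩ := exists_leading_eq (((s k).subSMul (c k) (s a₀)).holAt hi')
            (subSMul_vanishes h k i' hi')
          have h3 := hHb a b ho hq
          have h4 : (blowSection h k).s (i', some a) b = H (chartAt E q (down b)) (dirN a b) :=
            h3.self_of_nhds
          have h5 : (blowSection h k).s (i', some a) ∘ γ =ᶠ[𝓝 0]
              fun ζ => H ((chartAt E q ∘ down ∘ γ) ζ) ((dirN a ∘ γ) ζ) :=
            Tendsto.eventually (hγ.2 ▸ hγc : Tendsto γ (𝓝 0) (𝓝 b)) h3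
          have hx0 : (chartAt E q ∘ down ∘ γ) 0 = chartAt E q q := by
            simp only [Function.comp_apply, hγ.2, hq]
          have h6 : HasDerivAt (fun ζ => H ((chartAt E q ∘ down ∘ γ) ζ)) 0 0 := by
            have h7 : DifferentiableAt ℂ H ((chartAt E q ∘ down ∘ γ) 0) := by
              rw [hx0]
              exact hH.differentiableAt
            have h8 := h7.hasFDerivAt.comp_hasDerivAt 0 hx
            rwa [map_zero] at h8
          have h7 := (h6.clm_apply hu).deriv
          have h8 := ht k
          rw [h5.deriv_eq, h7, h4, hx0, hq, hH0] at h8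
          rw [map_sub, map_smul, smul_eq_mul]
          simpa [sub_eq_zero] using h8
        have h9 : a.f u' = 0 := by
          have h10 := (a.f.hasFDerivAt.comp_hasDerivAt (0 : ℂ) hu).deriv
          have h11 : a.f ∘ dirN a ∘ γ =ᶠ[𝓝 0] fun _ => 1 := by
            filter_upwards [hγc (show excDom E q (some a) ∈ 𝓝 (γ 0) by
              rw [hγ.2]; exact (isOpen_excDom _).mem_nhds ho)] with ζ hζ
            have : a.f (dir (γ ζ)) ≠ 0 := hζ.2
            simp [dirN, this]
          rw [← h10, h11.deriv_eq, deriv_const]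
        have h12 : a.f (dirN a b) = 1 := by
          have : a.f (dir b) ≠ 0 := ho.2
          simp [dirN, this]
        have h13 := congrArg a.f h0
        rw [map_sub, map_smul, h9, h12, map_zero, zero_sub, neg_eq_zero, smul_eq_mul, mul_one] at h13
        rwa [h13, zero_smul, sub_zero] at h0
    · exact mfderiv_eq_zero_of_down hγ hq h2

end Normalized

end Blowup

/-! ### Positive metrics on the blowup -/

/-- The Fubini–Study potential of a Segre embedding is the sum of those of the factors. -/
theorem log_sumSq_mul {κ κ' : Type*} [Fintype κ] [Fintype κ'] {u : κ → ℂ} {v : κ' → ℂ}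
    (hu : u ≠ 0) (hv : v ≠ 0) : Real.log (sumSq fun a : κ × κ' => u a.1 * v a.2) =
      Real.log (sumSq u) + Real.log (sumSq v) := by
  rw [← Real.log_mul (sumSq_pos hu).ne' (sumSq_pos hv).ne']
  congr 1
  simp only [sumSq, Fintype.sum_prod_type, Finset.sum_mul_sum, norm_mul, mul_pow]

section

variable {E : Type*} [NormedAddCommGroup E] [NormedSpace ℂ E] {M : Type*}
  [TopologicalSpace M] [ChartedSpace E M] {κ : Type*} [Fintype κ]

/-- The metric `log ∑ |s_a|²` defined by sections of a line bundle. -/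
noncomputable abbrev fsMetric {L : HolLineBundle E M} (s : κ → L.PowSection 1)
    (hs : ∀ i, ∀ x ∈ L.U i, ∃ a, (s a).s i x ≠ 0) : SmoothMetric L :=
  HolLineBundle.sectionMetric s one_pos hs

theorem fsMetric_ψ {L : HolLineBundle E M} (s : κ → L.PowSection 1)
    (hs : ∀ i, ∀ x ∈ L.U i, ∃ a, (s a).s i x ≠ 0) (i : L.ι) (x : M) :
    (fsMetric s hs).ψ i x = Real.log (sumSq fun a => (s a).s i x) := by
  simp [fsMetric, HolLineBundle.sectionMetric]

end

namespace Blowup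

variable {E : Type} [NormedAddCommGroup E] [NormedSpace ℂ E] {M : Type*} [TopologicalSpace M]
  [ChartedSpace E M] {q : M} [IsManifold 𝓘(ℂ, E) ω M] {B : HolLineBundle E M} {κ : Type*}
  [Fintype κ]

/-- On the blowup there are an ample line bundle `2π^*B - E` with a positive metric `σ` and a metric
`η` of the exceptional divisor such that `σ = 2π^*α - η`. -/
theorem exists_metrics {s : κ → B.PowSection 1} (hs : B.EmbedsBy s) (q : M) :
    (blowBundle q B).IsAmple ∧ ∃ (σ : SmoothMetric (blowBundle q B))
      (η : SmoothMetric (excBundle E q)), σ.IsPositive ∧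
      ∀ j j' o (b : Blowup E q), down b ∈ B.U j → down b ∈ B.U j' → b ∈ excDom E q o →
        σ.ψ (j, (j', o)) b = (fsMetric s hs.base_point_free).ψ j (down b) +
          (fsMetric s hs.base_point_free).ψ j' (down b) - η.ψ o b := by
  obtain ⟨a₀, c, h⟩ := exists_normalization hs q
  have hemb := blowBundle_embedsBy hs h
  set α := fsMetric s hs.base_point_free with hα
  set τ := fsMetric (blowSection h) (blowSection_base_point_free hs h) with hτ
  refine ⟨hemb.isAmple one_pos, HolLineBundle.sectionMetric _ one_pos hemb.base_point_free, ?_⟩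
  -- `τ` is a metric of `π^*B - E`, so `η = π^*α - τ` is a metric of `E`; its weights are expressed
  -- through any trivialization of `B`, by `hind`
  choose i₀ hi₀ using fun b : Blowup E q => B.exists_mem (down b)
  have hind : ∀ (o : Option (AffDir E)) (j : B.ι) (b : Blowup E q), b ∈ excDom E q o →
      down b ∈ B.U j → α.ψ (i₀ b) (down b) - τ.ψ (i₀ b, o) b = α.ψ j (down b) - τ.ψ (j, o) b := by
    intro o j b ho hj
    have h1 := α.trans (i₀ b) j (down b) ⟨hi₀ b, hj⟩
    have h2 := τ.trans (i₀ b, o) (j, o) b ⟨⟨hi₀ b, ho⟩, hj, ho⟩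
    have h3 : (quotBundle q B).g (i₀ b, o) (j, o) b = B.g (i₀ b) j (down b) := by
      change B.g (i₀ b) j (down b) * (excFactor b o / excFactor b o)⁻¹ = _
      rw [div_self (excFactor_ne ho), inv_one, mul_one]
    rw [h3] at h2
    linarith
  refine ⟨⟨fun o b => α.ψ (i₀ b) (down b) - τ.ψ (i₀ b, o) b, fun o b hb => ?_,
    fun o o' b hb => ?_⟩, HolLineBundle.sectionMetric_isPositive hemb one_pos,
    fun j j' o b hj hj' ho => ?_⟩
  · refine ContMDiffAt.contMDiffWithinAt ?_
    have h1 : ContMDiffAt 𝓘(ℝ, E) 𝓘(ℝ, ℝ) ∞ (fun b' : Blowup E q => α.ψ (i₀ b) (down b')) b :=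
      (α.smoothAt (hi₀ b)).comp b (contMDiffAt_real contMDiff_down.contMDiffAt)
    have h2 : ContMDiffAt 𝓘(ℝ, E) 𝓘(ℝ, ℝ) ∞ (τ.ψ (i₀ b, o)) b := τ.smoothAt ⟨hi₀ b, hb⟩
    refine (h1.sub h2).congr_of_eventuallyEq ?_
    have h3 : ∀ᶠ b' in 𝓝 b, down b' ∈ B.U (i₀ b) :=
      contMDiff_down.continuous.continuousAt ((B.isOpen_U _).mem_nhds (hi₀ b))
    filter_upwards [h3, (isOpen_excDom o).mem_nhds hb] with b' hb1 hb2
    exact hind o _ b' hb2 hb1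
  · have h1 := τ.trans (i₀ b, o) (i₀ b, o') b ⟨⟨hi₀ b, hb.1⟩, hi₀ b, hb.2⟩
    have h3 : (quotBundle q B).g (i₀ b, o) (i₀ b, o') b = ((excBundle E q).g o o' b)⁻¹ := by
      have h4 := B.cocycle (i₀ b) (i₀ b) (i₀ b) (down b) ⟨⟨hi₀ b, hi₀ b⟩, hi₀ b⟩
      have h5 : B.g (i₀ b) (i₀ b) (down b) = 1 :=
        mul_left_cancel₀ (B.g_ne_zero _ _ _ ⟨hi₀ b, hi₀ b⟩) (by rw [h4, mul_one])
      change B.g (i₀ b) (i₀ b) (down b) * _ = _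
      rw [h5, one_mul]
      rfl
    rw [h3, norm_inv, inv_pow, Real.log_inv] at h1
    linarith
  · have h1 : (fsMetric (embSection h) hemb.base_point_free).ψ (j, (j', o)) b =
        α.ψ j (down b) + τ.ψ (j', o) b := by
      refine (fsMetric_ψ (embSection h) hemb.base_point_free (j, (j', o)) b).trans ?_
      refine Eq.trans ?_ (congrArg₂ (· + ·) (fsMetric_ψ s hs.base_point_free j (down b))
        (fsMetric_ψ (blowSection h) (blowSection_base_point_free hs h) (j', o) b)).symm
      exact log_sumSq_mul (u := fun a => (s a).s j (down b))
        (v := fun a => (blowSection h a).s (j', o) b)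
        (Function.ne_iff.2 (hs.base_point_free j (down b) hj))
        (Function.ne_iff.2 (blowSection_base_point_free hs h (j', o) b ⟨hj', ho⟩))
    have h3 := hind o j' b ho hj'
    change (fsMetric (embSection h) hemb.base_point_free).ψ (j, (j', o)) b = _ - (_ - _)
    rw [h1, h3]
    ring

end Blowup

/-! ### Compactness of the blowup -/

namespace Blowup

variable {E : Type} [NormedAddCommGroup E] [NormedSpace ℂ E] {M : Type*} [TopologicalSpace M]
  [ChartedSpace E M] {q : M} [IsManifold 𝓘(ℂ, E) ω M]

open Classical in
/-- The inverse of the blowdown map away from `q`, with an arbitrary value at `q`. -/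
noncomputable def offMap (b₀ : Blowup E q) (x : M) : Blowup E q :=
  if h : x = q then b₀ else off x h

omit [TopologicalSpace M] [ChartedSpace E M] [IsManifold 𝓘(ℂ, E) ω M] in
theorem offMap_of_ne (b₀ : Blowup E q) {x : M} (h : x ≠ q) : offMap b₀ x = off x h := dif_neg h

omit [TopologicalSpace M] [ChartedSpace E M] [IsManifold 𝓘(ℂ, E) ω M] in
theorem offMap_down (b₀ : Blowup E q) {b : Blowup E q} (h : down b ≠ q) :
    offMap b₀ (down b) = b := by
  rw [offMap_of_ne b₀ h]
  exact ext_of_down rfl h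

theorem contMDiffAt_offMap (b₀ : Blowup E q) {x : M} (hx : x ≠ q) :
    ContMDiffAt 𝓘(ℂ, E) 𝓘(ℂ, E) ω (offMap b₀) x := by
  have hs : off x hx ∈ (chartHomeo q (.inr ⟨x, hx⟩)).source := ⟨mem_chart_source E x, hx⟩
  have h1 : ContMDiffAt 𝓘(ℂ, E) 𝓘(ℂ, E) ω (chartAt E x) x :=
    contMDiffAt_of_mem_maximalAtlas (IsManifold.chart_mem_maximalAtlas x) (mem_chart_source E x)
  have h2 : ContMDiffAt 𝓘(ℂ, E) 𝓘(ℂ, E) ω (chartHomeo q (.inr ⟨x, hx⟩)).symm (chartAt E x x) :=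
    contMDiffAt_symm_of_mem_maximalAtlas (chartHomeo_mem _) ((chartHomeo q _).map_source hs)
  refine (h2.comp x h1).congr_of_eventuallyEq ?_
  filter_upwards [(chartAt E x).open_source.mem_nhds (mem_chart_source E x),
    (isOpen_ne E q).mem_nhds hx] with y hy hyq
  rw [offMap_of_ne b₀ hyq]
  exact ((chartHomeo q (.inr ⟨x, hx⟩)).left_inv (x := off y hyq) ⟨hy, hyq⟩).symm

theorem contMDiffOn_offMap (b₀ : Blowup E q) :
    ContMDiffOn 𝓘(ℂ, E) 𝓘(ℂ, E) ω (offMap b₀) {x | x ≠ q} := fun _ hx =>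
  (contMDiffAt_offMap b₀ hx).contMDiffWithinAt

theorem isOpen_dom' (a : AffDir E) : IsOpen (dom q a) := (contMDiffOn_down_symm (q := q) (.inl a)).1

omit [IsManifold 𝓘(ℂ, E) ω M] in
theorem dir_ne_zero {b : Blowup E q} (hb : down b ∈ (chartAt E q).source) : dir b ≠ 0 := by
  cases b with
  | off x hx =>
    intro h
    exact hx ((chartAt E q).injOn hb (mem_chart_source E q) (sub_eq_zero.1 h))
  | exc l => exact l.rep_nonzero

omit [IsManifold 𝓘(ℂ, E) ω M] in
theorem exists_mem_excDom {b : Blowup E q} (hb : down b = q) :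
    ∃ a : AffDir E, b ∈ excDom E q (some a) := by
  have hs : down b ∈ (chartAt E q).source := by
    rw [hb]
    exact mem_chart_source E q
  obtain ⟨a, ha⟩ := AffDir.exists_of_ne (dir_ne_zero hs)
  exact ⟨a, hs, ha⟩

omit [IsManifold 𝓘(ℂ, E) ω M] in
theorem point_excChart {a : AffDir E} {b : Blowup E q} (hb : b ∈ excDom E q (some a)) :
    point q a (excChart q a b) = b := (excChart q a).left_inv hb

omit [IsManifold 𝓘(ℂ, E) ω M] in
theorem excChart_eq (a : AffDir E) (b : Blowup E q) :
    excChart q a b = dirN a b + (a.f (coord E q (down b)) - 1) • a.w := rfl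

/-- The blowup of a compact manifold is compact: an ultrafilter over `q` converges to the limit of
the directions. -/
theorem compactSpace [FiniteDimensional ℂ E] [CompactSpace M] : CompactSpace (Blowup E q) := by
  have : ProperSpace E := FiniteDimensional.proper ℂ E
  refine ⟨isCompact_iff_ultrafilter_le_nhds.2 fun F _ => ?_⟩
  obtain ⟨x, -, hx⟩ := isCompact_iff_ultrafilter_le_nhds.1 (isCompact_univ (X := M))
    (F.map down) (by simp)
  have hx : Tendsto down (F : Filter (Blowup E q)) (𝓝 x) := hx
  by_cases hxq : x = q
  · rw [hxq] at hx
    have hsrc : ∀ᶠ b in (F : Filter (Blowup E q)), down b ∈ (chartAt E q).source :=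
      hx ((chartAt E q).open_source.mem_nhds (mem_chart_source E q))
    -- the normalized directions have a limit `u` on the unit sphere
    obtain ⟨u, hu, hFu⟩ := isCompact_iff_ultrafilter_le_nhds.1 (isCompact_sphere (0 : E) 1)
      (F.map fun b => ((‖dir b‖⁻¹ : ℝ) : ℂ) • dir b) (by
        rw [Ultrafilter.coe_map, le_principal_iff, mem_map]
        filter_upwards [hsrc] with b hb
        have := norm_ne_zero_iff.2 (dir_ne_zero hb)
        simp [norm_smul, this])
    have hFu : Tendsto (fun b => ((‖dir b‖⁻¹ : ℝ) : ℂ) • dir b) (F : Filter (Blowup E q)) (𝓝 u) := hFu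
    have hu0 : u ≠ 0 := fun h => by simp [h] at hu
    obtain ⟨a, ha⟩ := AffDir.exists_of_ne hu0
    have hfa : Tendsto (fun b => a.f (((‖dir b‖⁻¹ : ℝ) : ℂ) • dir b)) (F : Filter (Blowup E q))
      (𝓝 (a.f u)) := (a.f.continuous.tendsto u).comp hFu
    have hne : ∀ᶠ b in (F : Filter (Blowup E q)), a.f (dir b) ≠ 0 := by
      filter_upwards [hfa.eventually_ne ha] with b hb h0
      exact hb (by rw [map_smul, h0, smul_zero])
    have hdirN : Tendsto (dirN a) (F : Filter (Blowup E q)) (𝓝 ((a.f u)⁻¹ • u)) := by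
      refine ((hfa.inv₀ ha).smul hFu).congr' ?_
      filter_upwards [hsrc] with b hb
      have : ((‖dir b‖⁻¹ : ℝ) : ℂ) ≠ 0 := by
        exact_mod_cast inv_ne_zero (norm_ne_zero_iff.2 (dir_ne_zero hb))
      rw [map_smul, smul_eq_mul, mul_inv, smul_smul, mul_right_comm, inv_mul_cancel₀ this, one_mul]
      rfl
    have hcoord : Tendsto (fun b => coord E q (down b)) (F : Filter (Blowup E q)) (𝓝 0) := by
      have h1 : ContinuousAt (coord E q) q :=
        contMDiffOn_coord.continuousOn.continuousAt
          ((chartAt E q).open_source.mem_nhds (mem_chart_source E q))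
      have h2 := h1.tendsto.comp hx
      rwa [coord_self] at h2
    -- the coordinate of the point of the exceptional divisor given by the line through `u`
    set y := (a.f u)⁻¹ • u + (a.f 0 - 1) • a.w with hy
    have hch : Tendsto (excChart q a) (F : Filter (Blowup E q)) (𝓝 y) := by
      refine hdirN.add (Tendsto.smul_const ?_ _)
      exact ((a.f.continuous.tendsto 0).comp hcoord).sub_const 1
    have hyd : y ∈ dom q a := by
      have : a.f y = 0 := by simp [hy, a.f_w, ha]
      change a.f y • a.lift y + chartAt E q q ∈ (chartAt E q).target
      rw [this, zero_smul, zero_add]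
      exact (chartAt E q).map_source (mem_chart_source E q)
    refine ⟨point q a y, mem_univ _, ?_⟩
    have hp : ContinuousAt (point q a) y :=
      (contMDiffOn_point a).continuousOn.continuousAt ((isOpen_dom' a).mem_nhds hyd)
    have h3 : Tendsto id (F : Filter (Blowup E q)) (𝓝 (point q a y)) := by
      refine (hp.tendsto.comp hch).congr' ?_
      filter_upwards [hsrc, hne] with b hb hb'
      exact point_excChart ⟨hb, hb'⟩
    exact h3
  · refine ⟨off x hxq, mem_univ _, ?_⟩
    have h1 : Tendsto (offMap (off x hxq)) (𝓝 x) (𝓝 (off x hxq : Blowup E q)) := by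
      have := (contMDiffAt_offMap (E := E) (off x hxq) hxq).continuousAt.tendsto
      rwa [offMap_of_ne (off x hxq) hxq] at this
    have h2 : Tendsto id (F : Filter (Blowup E q)) (𝓝 (off x hxq)) := by
      refine (h1.comp hx).congr' ?_
      filter_upwards [hx ((isOpen_ne E q).mem_nhds hxq)] with b hb
      exact offMap_down _ hb
    exact h2

/-- The complement of the exceptional divisor is dense. -/
theorem dense_off (q : M) : Dense {b : Blowup E q | down b ≠ q} := by
  intro b
  by_cases hb : down b = q
  · obtain ⟨a, ha⟩ := exists_mem_excDom hb
    set y := excChart q a b with hy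
    have hyd : y ∈ dom q a := (excChart q a).map_source ha
    have hfy : a.f y = 0 := by
      rw [← base_eq_iff hyd, ← down_point, hy, point_excChart ha, hb]
    -- in the chart the divisor is `a.f = 0`, to which `a.w` is transversal
    have h1 : Tendsto (fun t : ℂ => y + t • a.w) (𝓝[≠] 0) (𝓝 y) := by
      have : Continuous fun t : ℂ => y + t • a.w := by fun_prop
      have := this.tendsto 0
      rw [zero_smul, add_zero] at this
      exact this.mono_left nhdsWithin_le_nhds
    have hp : Tendsto (point q a) (𝓝 y) (𝓝 b) := by
      have := ((contMDiffOn_point a).continuousOn.continuousAt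
        ((isOpen_dom' a).mem_nhds hyd)).tendsto
      rwa [hy, point_excChart ha] at this
    refine mem_closure_of_tendsto (hp.comp h1) ?_
    filter_upwards [h1 ((isOpen_dom' a).mem_nhds hyd), self_mem_nhdsWithin] with t ht ht0
    change down (point q a (y + t • a.w)) ≠ q
    rw [down_point, Ne, base_eq_iff ht, map_add, hfy, map_smul, a.f_w]
    simpa using ht0
  · exact subset_closure hb

end Blowup

/-! ### The fibers and the strict transform in the blowup of `X × ℙ¹` -/

/-- Injectivity of the differential is tested on holomorphic discs. -/
theorem injective_mfderiv_of_disc {E E' : Type*} [NormedAddCommGroup E] [NormedSpace ℂ E]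
    [NormedAddCommGroup E'] [NormedSpace ℂ E'] {M N : Type*} [TopologicalSpace M] [ChartedSpace E M]
    [IsManifold 𝓘(ℂ, E) ω M] [TopologicalSpace N] [ChartedSpace E' N] {f : M → N} {x : M}
    (hf : ContMDiffAt 𝓘(ℂ, E) 𝓘(ℂ, E') ω f x)
    (h : ∀ γ : ℂ → M, IsHolDisc E γ x → mfderiv 𝓘(ℂ, ℂ) 𝓘(ℂ, E') (f ∘ γ) 0 = 0 →
      mfderiv 𝓘(ℂ, ℂ) 𝓘(ℂ, E) γ 0 = 0) :
    Function.Injective (mfderiv 𝓘(ℂ, E) 𝓘(ℂ, E') f x) := by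
  have key : ∀ v : E, mfderiv 𝓘(ℂ, E) 𝓘(ℂ, E') f x v = 0 → v = 0 := by
    intro v hv
    obtain ⟨⟨hγ, hγx⟩, -⟩ := isHolDisc_affineDisc (E := E) x v
    have hv' := HolLineBundle.mfderiv_affineDisc (E := E) x v
    have h1 := h _ ⟨hγ, hγx⟩ (by
      have hf' : MDifferentiableAt 𝓘(ℂ, E) 𝓘(ℂ, E') f (affineDisc E x v 0) := by
        rw [hγx]
        exact hf.mdifferentiableAt (by simp)
      rw [mfderiv_comp 0 hf' (hγ.mdifferentiableAt (by simp))]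
      refine ContinuousLinearMap.ext_ring ?_
      refine (congrArg (mfderiv 𝓘(ℂ, E) 𝓘(ℂ, E') f (affineDisc E x v 0)) hv').trans ?_
      exact (congrArg (fun y => (mfderiv 𝓘(ℂ, E) 𝓘(ℂ, E') f y v : E')) hγx).trans hv)
    rw [h1] at hv'
    exact hv'.symm
  exact (injective_iff_map_eq_zero _).2 key

theorem mfderiv_comp_disc_eq_zero {E E' : Type*} [NormedAddCommGroup E] [NormedSpace ℂ E]
    [NormedAddCommGroup E'] [NormedSpace ℂ E'] {M N : Type*} [TopologicalSpace M] [ChartedSpace E M]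
    [TopologicalSpace N] [ChartedSpace E' N] {g : M → N} {γ : ℂ → M} {x : M} (hγ : IsHolDisc E γ x)
    (hg : ContMDiffAt 𝓘(ℂ, E) 𝓘(ℂ, E') ω g x) (h : mfderiv 𝓘(ℂ, ℂ) 𝓘(ℂ, E) γ 0 = 0) :
    mfderiv 𝓘(ℂ, ℂ) 𝓘(ℂ, E') (g ∘ γ) 0 = 0 := by
  obtain ⟨hγ, rfl⟩ := hγ
  rw [mfderiv_comp 0 (hg.mdifferentiableAt (by simp)) (hγ.mdifferentiableAt (by simp)), h]
  exact ContinuousLinearMap.comp_zero _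

/-- A holomorphic map with a holomorphic left inverse is an immersion. -/
theorem injective_mfderiv_of_leftInverse {E E' : Type*} [NormedAddCommGroup E] [NormedSpace ℂ E]
    [NormedAddCommGroup E'] [NormedSpace ℂ E'] {M N : Type*} [TopologicalSpace M] [ChartedSpace E M]
    [TopologicalSpace N] [ChartedSpace E' N] {f : M → N} {g : N → M}
    (hf : ContMDiff 𝓘(ℂ, E) 𝓘(ℂ, E') ω f) (hg : ContMDiff 𝓘(ℂ, E') 𝓘(ℂ, E) ω g)
    (h : Function.LeftInverse g f) (x : M) :
    Function.Injective (mfderiv 𝓘(ℂ, E) 𝓘(ℂ, E') f x) := by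
  have h1 := mfderiv_comp x (hg.mdifferentiableAt (x := f x) (by simp))
    (hf.mdifferentiableAt (x := x) (by simp))
  rw [h.comp_eq_id, mfderiv_id] at h1
  refine Function.LeftInverse.injective (g := mfderiv 𝓘(ℂ, E') 𝓘(ℂ, E) g (f x)) fun v => ?_
  exact (DFunLike.congr_fun h1 v).symm

section Total

variable {E : Type} [NormedAddCommGroup E] [NormedSpace ℂ E] {X : Type*} [TopologicalSpace X]
  [ChartedSpace E X] [IsManifold 𝓘(ℂ, E) ω X] {p : X}

omit [IsManifold 𝓘(ℂ, E) ω X] in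
theorem contMDiff_prodMk (τ : ProjLine) :
    ContMDiff 𝓘(ℂ, E) 𝓘(ℂ, E × ℂ) ω (fun x : X => (x, τ)) := by
  rw [modelWithCornersSelf_prod]
  exact contMDiff_id.prodMk contMDiff_const

omit [TopologicalSpace X] [ChartedSpace E X] [IsManifold 𝓘(ℂ, E) ω X] in
theorem mk_ne_center {τ : ProjLine} (hτ : τ ≠ ProjLine.zero) (x : X) :
    ((x, τ) : X × ProjLine) ≠ (p, ProjLine.zero) := fun h => hτ (Prod.mk.inj h).2

variable (E p) in
/-- The inclusion of the fiber `X × {τ}` in the blowup, for `τ ≠ 0`. -/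
def fiberMap {τ : ProjLine} (hτ : τ ≠ ProjLine.zero) (x : X) : TotalSpace E p :=
  Blowup.off (x, τ) (mk_ne_center hτ x)

theorem contMDiff_fiberMap {τ : ProjLine} (hτ : τ ≠ ProjLine.zero) :
    ContMDiff 𝓘(ℂ, E) 𝓘(ℂ, E × ℂ) ω (fiberMap E p hτ) := by
  intro x
  have h1 := (Blowup.contMDiffAt_offMap (E := E × ℂ) (fiberMap E p hτ x)
    (mk_ne_center (p := p) hτ x)).comp x (contMDiff_prodMk τ x)
  refine h1.congr_of_eventuallyEq (Eventually.of_forall fun y => ?_)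
  exact (Blowup.offMap_of_ne _ (mk_ne_center hτ y)).symm

theorem injective_mfderiv_fiberMap {τ : ProjLine} (hτ : τ ≠ ProjLine.zero) (x : X) :
    Function.Injective (mfderiv 𝓘(ℂ, E) 𝓘(ℂ, E × ℂ) (fiberMap E p hτ) x) :=
  injective_mfderiv_of_leftInverse (contMDiff_fiberMap hτ)
    (contMDiff_prFst.comp Blowup.contMDiff_down) (fun _ => rfl) x

omit [NormedSpace ℂ E] in
omit [TopologicalSpace X] [ChartedSpace E X] [IsManifold 𝓘(ℂ, E) ω X] in
theorem inl_ne_zero {v : E} (hv : v ≠ 0) : ((v, 0) : E × ℂ) ≠ 0 := fun h => hv (Prod.mk.inj h).1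

variable (E p) in
/-- The embedding of the blowup of `X` at `p` as the strict transform of `X × {0}`. -/
noncomputable def stMap : Blowup E p → TotalSpace E p
  | .off x hx => .off (x, ProjLine.zero) fun h => hx (Prod.mk.inj h).1
  | .exc l => .exc (Projectivization.mk ℂ (l.rep, 0) (inl_ne_zero l.rep_nonzero))

/-- The linear form and the vector of `E × ℂ` attached to those of `E`. -/
noncomputable def AffDir.prodZero (a : AffDir E) : AffDir (E × ℂ) :=
  ⟨(a.f.comp (ContinuousLinearMap.fst ℂ E ℂ), (a.w, 0)), a.f_w⟩

theorem AffDir.prodZero_f (a : AffDir E) (v : E × ℂ) : a.prodZero.f v = a.f v.1 := rfl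

omit [TopologicalSpace X] [ChartedSpace E X] [IsManifold 𝓘(ℂ, E) ω X] in
theorem down_stMap (b : Blowup E p) : Blowup.down (stMap E p b) = (Blowup.down b, ProjLine.zero) := by
  cases b <;> rfl

omit [NormedSpace ℂ E] [IsManifold 𝓘(ℂ, E) ω X] in
/-- In the coordinates centered at `(p, 0)`, the last coordinate is the affine coordinate of `ℙ¹`. -/
theorem coord_prod (z : X × ProjLine) : Blowup.coord (E × ℂ) ((p, ProjLine.zero) : X × ProjLine) z =
    (Blowup.coord E p z.1, ProjLine.hom z.2 true / ProjLine.hom z.2 false) := by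
  have h1 : chartAt (E × ℂ) ((p, ProjLine.zero) : X × ProjLine) =
    (chartAt E p).prod (chartAt ℂ ProjLine.zero) := rfl
  have h2 : ∀ l, ProjLine.chartHomeo false l = ProjLine.hom l true / ProjLine.hom l false :=
    fun _ => rfl
  rw [Blowup.coord, h1, chartAt_zero]
  ext
  · rfl
  · change ProjLine.chartHomeo false z.2 - ProjLine.chartHomeo false ProjLine.zero = _
    rw [h2, h2, hom_zero_true, zero_div, sub_zero]

omit [IsManifold 𝓘(ℂ, E) ω X] in
/-- The vectors chosen on the lines in `T_pX` and on their images in `T_pX ⊕ ℂ` may differ by a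
factor; away from the exceptional divisors both are coordinate vectors. -/
theorem dir_stMap (b : Blowup E p) : ∃ k : ℂ, k ≠ 0 ∧ (Blowup.down b ≠ p → k = 1) ∧
    Blowup.dir (stMap E p b) = k • (Blowup.dir b, (0 : ℂ)) := by
  cases b with
  | off x hx =>
    refine ⟨1, one_ne_zero, fun _ => rfl, ?_⟩
    change Blowup.coord (E × ℂ) _ _ = _
    rw [coord_prod, one_smul, hom_zero_true, zero_div]
    rfl
  | exc l =>
    obtain ⟨k, hk⟩ := Projectivization.exists_smul_eq_mk_rep ℂ ((l.rep, 0) : E × ℂ)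
      (inl_ne_zero l.rep_nonzero)
    exact ⟨k, k.ne_zero, fun h => absurd rfl h, hk.symm⟩

omit [IsManifold 𝓘(ℂ, E) ω X] in
theorem mem_excDom_stMap {b : Blowup E p} {a : AffDir E} (hb : b ∈ Blowup.excDom E p (some a)) :
    stMap E p b ∈ Blowup.excDom (E × ℂ) (p, ProjLine.zero) (some a.prodZero) := by
  obtain ⟨k, hk, -, hd⟩ := dir_stMap b
  refine ⟨?_, ?_⟩
  · rw [down_stMap]
    exact ⟨hb.1, mem_chart_source ℂ _⟩
  · rw [hd, map_smul, AffDir.prodZero_f]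
    exact smul_ne_zero hk hb.2

omit [IsManifold 𝓘(ℂ, E) ω X] in
theorem dirN_stMap (b : Blowup E p) (a : AffDir E) :
    Blowup.dirN a.prodZero (stMap E p b) = (Blowup.dirN a b, 0) := by
  obtain ⟨k, hk, -, hd⟩ := dir_stMap b
  rw [Blowup.dirN, hd, map_smul, AffDir.prodZero_f, smul_eq_mul, mul_inv, smul_smul,
    mul_right_comm, inv_mul_cancel₀ hk, one_mul, Prod.smul_mk, smul_zero]
  rfl

omit [IsManifold 𝓘(ℂ, E) ω X] in
/-- In corresponding charts the embedding is `y ↦ (y, 0)`. -/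
theorem excChart_stMap (b : Blowup E p) (a : AffDir E) :
    Blowup.excChart (p, ProjLine.zero) a.prodZero (stMap E p b) = (Blowup.excChart p a b, 0) := by
  rw [Blowup.excChart_eq, Blowup.excChart_eq, dirN_stMap, down_stMap, coord_prod, AffDir.prodZero_f]
  change _ + _ • ((a.w, 0) : E × ℂ) = _
  rw [Prod.smul_mk, Prod.mk_add_mk, smul_zero, add_zero]

theorem contMDiff_stMap : ContMDiff 𝓘(ℂ, E) 𝓘(ℂ, E × ℂ) ω (stMap E p) := by
  intro b
  by_cases hb : Blowup.down b = p
  · obtain ⟨a, ha⟩ := Blowup.exists_mem_excDom hb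
    have h1 : ContMDiffAt 𝓘(ℂ, E) 𝓘(ℂ, E) ω (Blowup.excChart p a) b :=
      (Blowup.contMDiffOn_excChart a).contMDiffAt ((Blowup.isOpen_excDom _).mem_nhds ha)
    have h2 : ContMDiffAt 𝓘(ℂ, E) 𝓘(ℂ, E × ℂ) ω (fun b' => (Blowup.excChart p a b', (0 : ℂ))) b :=
      (ContinuousLinearMap.inl ℂ E ℂ).contMDiff.contMDiffAt.comp b h1
    have h3 : ContMDiffAt 𝓘(ℂ, E × ℂ) 𝓘(ℂ, E × ℂ) ω
        (Blowup.point ((p, ProjLine.zero) : X × ProjLine) a.prodZero) (Blowup.excChart p a b, 0) := by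
      refine (Blowup.contMDiffOn_point a.prodZero).contMDiffAt ((Blowup.isOpen_dom' _).mem_nhds ?_)
      rw [← excChart_stMap]
      exact (Blowup.excChart (p, ProjLine.zero) a.prodZero).map_source (mem_excDom_stMap ha)
    refine (h3.comp b h2).congr_of_eventuallyEq ?_
    filter_upwards [(Blowup.isOpen_excDom _).mem_nhds ha] with b' hb'
    rw [Function.comp_apply, ← excChart_stMap, Blowup.point_excChart (mem_excDom_stMap hb')]
  · have hne : ((Blowup.down b, ProjLine.zero) : X × ProjLine) ≠ (p, ProjLine.zero) :=
      fun h => hb (Prod.mk.inj h).1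
    have h1 := (Blowup.contMDiffAt_offMap (E := E × ℂ) (stMap E p b) hne).comp b
      ((contMDiff_prodMk ProjLine.zero).comp Blowup.contMDiff_down b)
    refine h1.congr_of_eventuallyEq ?_
    filter_upwards [Blowup.contMDiff_down.continuous.continuousAt
      ((Blowup.isOpen_ne E p).mem_nhds hb)] with b' hb'
    change stMap E p b' = Blowup.offMap (stMap E p b) (Blowup.down b', ProjLine.zero)
    rw [← down_stMap, Blowup.offMap_down]
    rw [down_stMap]
    exact fun h => hb' (Prod.mk.inj h).1

theorem injective_mfderiv_stMap (b : Blowup E p) :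
    Function.Injective (mfderiv 𝓘(ℂ, E) 𝓘(ℂ, E × ℂ) (stMap E p) b) := by
  refine injective_mfderiv_of_disc (contMDiff_stMap b) fun γ hγ h => ?_
  have hγ' : IsHolDisc (E × ℂ) (stMap E p ∘ γ) (stMap E p b) := hγ.comp (contMDiff_stMap b)
  have hdown : mfderiv 𝓘(ℂ, ℂ) 𝓘(ℂ, E) (Blowup.down ∘ γ) 0 = 0 := by
    have h1 := mfderiv_comp_disc_eq_zero (g := fun b => (Blowup.down b).1) hγ'
      (contMDiff_prFst.comp Blowup.contMDiff_down).contMDiffAt h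
    have h2 : (fun b => (Blowup.down b).1) ∘ stMap E p ∘ γ = Blowup.down ∘ γ :=
      funext fun ζ => congrArg Prod.fst (down_stMap (γ ζ))
    rwa [h2] at h1
  by_cases hb : Blowup.down b = p
  · obtain ⟨a, ha⟩ := Blowup.exists_mem_excDom hb
    refine Blowup.mfderiv_eq_zero_of_dirN hγ ha hdown ?_
    have h1 : ContMDiffAt 𝓘(ℂ, E × ℂ) 𝓘(ℂ, E) ω
        (fun b' => (Blowup.dirN a.prodZero b').1) (stMap E p b) :=
      (ContinuousLinearMap.fst ℂ E ℂ).contMDiff.contMDiffAt.comp _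
        ((Blowup.contMDiffOn_dirN a.prodZero).contMDiffAt
          ((Blowup.isOpen_excDom _).mem_nhds (mem_excDom_stMap ha)))
    have h2 := mfderiv_comp_disc_eq_zero hγ' h1 h
    have h3 : (fun b' => (Blowup.dirN a.prodZero b').1) ∘ stMap E p ∘ γ = Blowup.dirN a ∘ γ :=
      funext fun ζ => congrArg Prod.fst (dirN_stMap (γ ζ) a)
    rw [h3, mfderiv_eq_fderiv] at h2
    rw [← fderiv_apply_one_eq_deriv, h2]
    rfl
  · exact Blowup.mfderiv_eq_zero_of_down hγ hb hdown

end Total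

/-! ### The equation of the strict transform -/

section Total

variable {E : Type} [NormedAddCommGroup E] [NormedSpace ℂ E] {X : Type*} [TopologicalSpace X]
  [ChartedSpace E X] [IsManifold 𝓘(ℂ, E) ω X] {p : X}

variable (E X) in
/-- The pullback of `𝒪(1)` to `X × ℙ¹`. -/
noncomputable abbrev hyperplanePullback : HolLineBundle (E × ℂ) (X × ProjLine) :=
  hyperplaneBundle.pullback Prod.snd (contMDiff_prSnd (E := E))

variable (E p) in
/-- The section of `𝒪(1) - 𝓔` defined by the coordinate vanishing on `X × {0}`; its divisor is the
strict transform of `X × {0}`. -/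
noncomputable def stSection : (Blowup.quotBundle ((p, ProjLine.zero) : X × ProjLine)
    (hyperplanePullback E X)).PowSection 1 :=
  Blowup.quotSection (E := E × ℂ) (B := hyperplanePullback E X)
    ((homSection true).pullback Prod.snd contMDiff_prSnd) fun b _ => by
    change ProjLine.hom ProjLine.zero true / ProjLine.hom ProjLine.zero b = 0
    rw [hom_zero_true, zero_div]

omit [IsManifold 𝓘(ℂ, E) ω X] in
/-- The differential of the affine coordinate of `ℙ¹` at `(p, 0)` is the projection to `ℂ`. -/
theorem fderiv_coord (l : E × ℂ) : fderiv ℂ ((fun z : X × ProjLine =>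
      ProjLine.hom z.2 true / ProjLine.hom z.2 false) ∘
      (chartAt (E × ℂ) ((p, ProjLine.zero) : X × ProjLine)).symm)
    (chartAt (E × ℂ) ((p, ProjLine.zero) : X × ProjLine) (p, ProjLine.zero)) l = l.2 := by
  have h : ((fun z : X × ProjLine => ProjLine.hom z.2 true / ProjLine.hom z.2 false) ∘
      (chartAt (E × ℂ) ((p, ProjLine.zero) : X × ProjLine)).symm) =
      ContinuousLinearMap.snd ℂ E ℂ := by
    funext y
    have h1 : chartAt (E × ℂ) ((p, ProjLine.zero) : X × ProjLine) =
      (chartAt E p).prod (chartAt ℂ ProjLine.zero) := rfl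
    rw [h1, chartAt_zero]
    exact (ProjLine.chart false).right_inv (mem_univ y.2)
  rw [h, ContinuousLinearMap.fderiv]
  rfl

omit [IsManifold 𝓘(ℂ, E) ω X] in
/-- The leading term of the section vanishes exactly on the strict transform. -/
theorem leading_eq_zero_iff {β : Bool} {b : TotalSpace E p}
    (hβ : ProjLine.hom (Blowup.down b).2 β ≠ 0) :
    Blowup.leading (fun z : X × ProjLine => ProjLine.hom z.2 true / ProjLine.hom z.2 β) b = 0 ↔
      b ∈ range (stMap E p) := by
  cases b with
  | off z hz =>
    have hβ : ProjLine.hom z.2 β ≠ 0 := hβ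
    change ProjLine.hom z.2 true / ProjLine.hom z.2 β = 0 ↔ _
    rw [div_eq_zero_iff, or_iff_left hβ]
    constructor
    · intro h
      obtain ⟨x, τ⟩ := z
      obtain rfl : τ = ProjLine.zero := eq_zero_of_hom h
      exact ⟨.off x fun h => hz (Prod.ext h rfl), rfl⟩
    · rintro ⟨b', hb'⟩
      have h := congrArg (fun b => (Blowup.down b).2) hb'
      simp only [down_stMap] at h
      have h : ProjLine.zero = z.2 := h
      rw [← h, hom_zero_true]
  | exc l =>
    have hβ : ProjLine.hom ProjLine.zero β ≠ 0 := hβ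
    obtain rfl : β = false := by
      cases β
      · rfl
      · exact absurd hom_zero_true hβ
    have h1 : Blowup.leading (q := ((p, ProjLine.zero) : X × ProjLine))
        (fun z : X × ProjLine => ProjLine.hom z.2 true / ProjLine.hom z.2 false) (.exc l) =
        l.rep.2 := fderiv_coord l.rep
    rw [h1]
    constructor
    · intro h
      have hne : l.rep.1 ≠ 0 := fun h1 => l.rep_nonzero (Prod.ext h1 h)
      refine ⟨.exc (Projectivization.mk ℂ l.rep.1 hne), ?_⟩
      change Blowup.exc _ = _
      congr 1
      conv_rhs => rw [← Projectivization.mk_rep l]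
      obtain ⟨k, hk⟩ := Projectivization.exists_smul_eq_mk_rep ℂ l.rep.1 hne
      refine (Projectivization.mk_eq_mk_iff' ℂ _ _ _ _).2 ⟨k, Prod.ext hk ?_⟩
      change (k : ℂ) * l.rep.2 = 0
      rw [h, mul_zero]
    · rintro ⟨b', hb'⟩
      cases b' with
      | off x hx => exact nomatch hb'
      | exc l' =>
        obtain ⟨k, hk⟩ := Projectivization.exists_smul_eq_mk_rep ℂ ((l'.rep, 0) : E × ℂ)
          (inl_ne_zero l'.rep_nonzero)
        have h2 : Projectivization.mk ℂ ((l'.rep, 0) : E × ℂ) (inl_ne_zero l'.rep_nonzero) = l :=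
          Blowup.exc.inj hb'
        rw [h2] at hk
        rw [← hk]
        exact mul_zero (k : ℂ)

theorem stSection_eq_zero_iff {β : Bool} {o : Option (AffDir (E × ℂ))} {b : TotalSpace E p}
    (hβ : ProjLine.hom (Blowup.down b).2 β ≠ 0) (ho : b ∈ Blowup.excDom (E × ℂ) _ o) :
    (stSection E p).s (β, o) b = 0 ↔ b ∈ range (stMap E p) := by
  rw [← leading_eq_zero_iff hβ]
  change _ / _ = _ ↔ _
  rw [div_eq_zero_iff, or_iff_left (Blowup.excFactor_ne ho)]
  rfl

/-- The strict transform of `X × {0}` is the image of the blowup of `X` at `p`. -/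
theorem fiberTransform_eq : fiberTransform E p = range (stMap E p) := by
  apply subset_antisymm
  · refine closure_minimal ?_ (isClosed_of_closure_subset fun b hb => ?_)
    · rintro b ⟨h1, h2⟩
      obtain ⟨β, hβ⟩ := hyperplaneBundle.exists_mem (Blowup.down b).2
      rw [← leading_eq_zero_iff hβ]
      cases b with
      | off z hz =>
        have h1 : z.2 = ProjLine.zero := h1
        change ProjLine.hom z.2 true / _ = 0
        rw [h1, hom_zero_true, zero_div]
      | exc l => exact absurd rfl h2
    · obtain ⟨⟨β, o⟩, hβ, ho⟩ := (Blowup.quotBundle ((p, ProjLine.zero) : X × ProjLine)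
        (hyperplanePullback E X)).exists_mem b
      by_contra hn
      have h1 := ((stSection E p).holAt (i := (β, o)) ⟨hβ, ho⟩).continuousAt.eventually_ne
        (mt (stSection_eq_zero_iff hβ ho).1 hn)
      have h2 := ((Blowup.quotBundle ((p, ProjLine.zero) : X × ProjLine)
        (hyperplanePullback E X)).isOpen_U (β, o)).mem_nhds ⟨hβ, ho⟩
      obtain ⟨b', ⟨h3, h4⟩, h5⟩ := mem_closure_iff_nhds.1 hb _ (inter_mem h1 h2)
      exact h3 ((stSection_eq_zero_iff h4.1 h4.2).2 h5)
  · rintro _ ⟨b, rfl⟩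
    refine closure_mono ?_ (image_closure_subset_closure_image contMDiff_stMap.continuous
      ⟨b, Blowup.dense_off p b, rfl⟩)
    rintro _ ⟨b', hb', rfl⟩
    have hb' : Blowup.down b' ≠ p := hb'
    refine ⟨congrArg Prod.snd (down_stMap b'), ?_⟩
    rw [down_stMap]
    exact fun h => hb' (Prod.mk.inj h).1

end Total

/-! ### The maximum principle -/

/-- The maximum principle: a subharmonic function on a neighbourhood of a compact set is bounded by
its values on the frontier. The perturbation by `ε |z|²` makes the submean value property strict. -/
theorem PSHOn.le_of_frontier {u : ℂ → EReal} {V K : Set ℂ} (hV : IsOpen V) (hu : PSHOn ℂ u V)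
    (hK : IsCompact K) (hKV : K ⊆ V) {B : ℝ} (h : ∀ z ∈ K, z ∉ interior K → u z ≤ B) :
    ∀ z ∈ K, u z ≤ B := by
  intro z₀ hz₀
  by_contra! hlt
  obtain ⟨R, hR⟩ := hK.isBounded.exists_norm_le
  obtain ⟨B', hB1, hB2⟩ := EReal.lt_iff_exists_real_btwn.1 hlt
  have hBB' : B < B' := EReal.coe_lt_coe_iff.1 hB1
  -- small enough for the perturbed function to take its maximum over `K` where `u > B`
  set ε : ℝ := (B' - B) / (R ^ 2 + 1) with hε
  have hε0 : 0 < ε := div_pos (sub_pos.2 hBB') (by positivity)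
  have hεR : ε * R ^ 2 < B' - B := by
    rw [hε, div_mul_eq_mul_div, div_lt_iff₀ (by positivity)]
    nlinarith
  have hat : ∀ z ∈ K, PSHAt ℂ u z := fun z hz => (pshOn_iff hV).1 hu z (hKV hz)
  have husc : UpperSemicontinuousOn (fun z => u z + ((ε * ‖z‖ ^ 2 : ℝ) : EReal)) K := by
    intro z hz
    refine UpperSemicontinuousAt.upperSemicontinuousWithinAt K ?_
    refine (hat z hz).1.add' (ContinuousAt.upperSemicontinuousAt ?_) ?_
    · refine (continuous_coe_real_ereal.continuousAt).comp ?_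
      fun_prop
    · exact EReal.continuousAt_add (Or.inr (EReal.coe_ne_bot _)) (Or.inr (EReal.coe_ne_top _))
  obtain ⟨z₁, hz₁, hmax⟩ := husc.exists_isMaxOn ⟨z₀, hz₀⟩ hK
  have hmax : ∀ z ∈ K, u z + ((ε * ‖z‖ ^ 2 : ℝ) : EReal) ≤ u z₁ + ((ε * ‖z₁‖ ^ 2 : ℝ) : EReal) :=
    fun z hz => hmax hz
  have htop := (hat z₁ hz₁).2.1
  have h0 : (B' : EReal) ≤ u z₁ + ((ε * ‖z₁‖ ^ 2 : ℝ) : EReal) := by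
    refine hB2.le.trans (le_trans ?_ (hmax z₀ hz₀))
    exact le_add_of_nonneg_right (by exact_mod_cast by positivity)
  obtain ⟨t, ht⟩ : ∃ t : ℝ, u z₁ = t := by
    induction hw : u z₁ with
    | top => exact absurd hw htop.ne
    | bot =>
      rw [hw, EReal.bot_add] at h0
      exact absurd (le_bot_iff.1 h0) (EReal.coe_ne_bot _)
    | coe t => exact ⟨t, rfl⟩
  have hR1 : ‖z₁‖ ^ 2 ≤ R ^ 2 := pow_le_pow_left₀ (norm_nonneg _) (hR z₁ hz₁) 2
  have htB : B < t := by
    rw [ht, ← EReal.coe_add, EReal.coe_le_coe_iff] at h0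
    nlinarith
  have hint : z₁ ∈ interior K := by
    by_contra hn
    have := h z₁ hz₁ hn
    rw [ht, EReal.coe_le_coe_iff] at this
    linarith
  have hγ : IsHolDisc ℂ (fun ζ : ℂ => z₁ + ζ) z₁ :=
    ⟨(contDiff_const.add contDiff_id).contMDiff.contMDiffAt, add_zero z₁⟩
  obtain ⟨ρ, hρ, H⟩ := (hat z₁ hz₁).2.2 _ hγ
  obtain ⟨ρ', hρ', hsub⟩ := Metric.isOpen_iff.1 isOpen_interior z₁ hint
  set r := min ρ ρ' / 2 with hr
  have hr0 : 0 < r := half_pos (lt_min hρ hρ')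
  have hrρ : r < ρ := (half_lt_self (lt_min hρ hρ')).trans_le (min_le_left _ _)
  have hrρ' : r < ρ' := (half_lt_self (lt_min hρ hρ')).trans_le (min_le_right _ _)
  have hmem : ∀ ζ : ℂ, ‖ζ‖ = r → z₁ + ζ ∈ K := fun ζ hζ =>
    interior_subset (hsub (by simpa [hζ] using hrρ'))
  -- the function which bounds `u` on the circle around the maximum point, and its mean value
  set q : ℂ → ℝ := fun ζ => (((t - ε * r ^ 2 : ℝ) : ℂ) - 2 * ε * (starRingEnd ℂ z₁) * ζ).re with hq
  have hqmean : Real.circleAverage q 0 r = t - ε * r ^ 2 := by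
    rw [InnerProductSpace.HarmonicOnNhd.circleAverage_eq]
    · change (((t - ε * r ^ 2 : ℝ) : ℂ) - 2 * ε * (starRingEnd ℂ) z₁ * 0).re = _
      rw [mul_zero, sub_zero, Complex.ofReal_re]
    · intro z _
      refine AnalyticAt.harmonicAt_re ?_
      fun_prop
  have hqe : ∀ ζ : ℂ, ‖ζ‖ = r → q ζ = t + ε * ‖z₁‖ ^ 2 - ε * ‖z₁ + ζ‖ ^ 2 := by
    intro ζ hζ
    have h1 : ‖z₁ + ζ‖ ^ 2 = ‖z₁‖ ^ 2 + r ^ 2 + 2 * ((starRingEnd ℂ z₁) * ζ).re := by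
      rw [← hζ, ← Complex.normSq_eq_norm_sq, ← Complex.normSq_eq_norm_sq,
        ← Complex.normSq_eq_norm_sq]
      simp only [Complex.normSq_apply, Complex.add_re, Complex.add_im, Complex.mul_re,
        Complex.conj_re, Complex.conj_im]
      ring
    have h2 : q ζ = (t - ε * r ^ 2) - 2 * ε * ((starRingEnd ℂ z₁) * ζ).re := by
      have h3 : (2 : ℂ) * ε * (starRingEnd ℂ) z₁ * ζ = ((2 * ε : ℝ) : ℂ) * ((starRingEnd ℂ) z₁ * ζ) := by
        push_cast
        ring
      change (((t - ε * r ^ 2 : ℝ) : ℂ) - 2 * ε * (starRingEnd ℂ) z₁ * ζ).re = _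
      rw [h3, Complex.sub_re, Complex.ofReal_re, Complex.re_ofReal_mul]
    rw [h1, h2]
    ring
  have hle := H r hr0 hrρ (t - ε * R ^ 2)
  rw [ht, EReal.coe_le_coe_iff] at hle
  have hI : CircleIntegrable (fun ζ => (max (u (z₁ + ζ)) ((t - ε * R ^ 2 : ℝ) : EReal)).toReal) 0 r :=
    circleIntegrable_trunc (w := fun ζ => u (z₁ + ζ)) hr0.le
      (fun z hz y hy => (continuous_const.add continuous_id).continuousAt.eventually
        ((hat _ (hmem z hz)).1 y hy)) (fun z hz => (hat _ (hmem z hz)).2.1) _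
  have hI2 : CircleIntegrable q 0 r := by
    refine ContinuousOn.circleIntegrable hr0.le (Continuous.continuousOn ?_)
    exact Complex.continuous_re.comp (by fun_prop)
  have hle2 := Real.circleAverage_mono hI hI2 fun ζ hζ => by
    rw [mem_sphere_zero_iff_norm, abs_of_pos hr0] at hζ
    have h1 : u (z₁ + ζ) ≤ (q ζ : EReal) := by
      have h2 := hmax _ (hmem ζ hζ)
      rw [ht, ← EReal.coe_add] at h2
      rw [hqe ζ hζ, EReal.coe_sub]
      exact EReal.le_sub_iff_add_le (Or.inl (EReal.coe_ne_bot _)) (Or.inl (EReal.coe_ne_top _))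
        |>.2 h2
    have h3 : ((t - ε * R ^ 2 : ℝ) : EReal) ≤ (q ζ : EReal) := by
      rw [EReal.coe_le_coe_iff, hqe ζ hζ]
      have : ‖z₁ + ζ‖ ^ 2 ≤ R ^ 2 := pow_le_pow_left₀ (norm_nonneg _) (hR _ (hmem ζ hζ)) 2
      nlinarith [sq_nonneg ‖z₁‖]
    have h4 := EReal.toReal_le_toReal (max_le h1 h3)
      (ne_bot_of_le_ne_bot (EReal.coe_ne_bot _) (le_max_right _ _)) (EReal.coe_ne_top _)
    rwa [EReal.toReal_coe] at h4
  rw [hqmean] at hle2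
  have : 0 < ε * r ^ 2 := by positivity
  linarith

/-- The maximum principle on a disc. -/
theorem PSHOn.le_of_sphere {u : ℂ → EReal} {V : Set ℂ} (hV : IsOpen V) (hu : PSHOn ℂ u V) {r : ℝ}
    (hr : 0 < r) (hrV : Metric.closedBall 0 r ⊆ V) {B : ℝ} (h : ∀ z, ‖z‖ = r → u z ≤ B) :
    ∀ z, ‖z‖ ≤ r → u z ≤ B := by
  intro z hz
  refine hu.le_of_frontier hV (isCompact_closedBall 0 r) hrV (fun z hz hzi => h z ?_) z (by simpa)
  rw [interior_closedBall _ hr.ne'] at hzi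
  have h1 : ‖z‖ ≤ r := by simpa using hz
  have h2 : r ≤ ‖z‖ := by simpa using hzi
  exact le_antisymm h1 h2

/-- Hadamard's three circles theorem, for the circles of radii `s ≤ ‖z‖ ≤ ρ / 2` and `ρ`. -/
theorem PSHOn.three_circles {u : ℂ → EReal} {V : Set ℂ} (hV : IsOpen V) (hu : PSHOn ℂ u V)
    {s ρ : ℝ} (hs : 0 < s) (hsρ : s < ρ) (hρV : Metric.closedBall 0 ρ ⊆ V) {a b : ℝ} (hab : a ≤ b)
    (ha : ∀ z, ‖z‖ = s → u z ≤ a) (hb : ∀ z, ‖z‖ = ρ → u z ≤ b) {z : ℂ} (hz : s ≤ ‖z‖)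
    (hz' : ‖z‖ ≤ ρ / 2) :
    u z ≤ ((b - (b - a) * (Real.log 2 / Real.log (ρ / s)) : ℝ) : EReal) := by
  have hlog : 0 < Real.log (ρ / s) := Real.log_pos ((one_lt_div hs).2 hsρ)
  -- subtracting `κ log |z|` makes the bounds on the two circles equal
  set κ : ℝ := (b - a) / Real.log (ρ / s) with hκ
  have hκ0 : 0 ≤ κ := div_nonneg (sub_nonneg.2 hab) hlog.le
  have hV' : IsOpen (V ∩ {0}ᶜ) := hV.inter isOpen_compl_singleton
  have hw : PSHOn ℂ (fun z => u z + ((-(κ / 2) * Real.log (‖z‖ ^ 2) : ℝ) : EReal)) (V ∩ {0}ᶜ) :=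
    (hu.mono inter_subset_left).add_supported hV' fun z hz =>
      supportedAt_log_norm_sq (g := id) contMDiffAt_id hz.2 _
  set K : Set ℂ := Metric.closedBall 0 ρ \ Metric.ball 0 s with hK
  have hKc : IsCompact K := (isCompact_closedBall 0 ρ).diff Metric.isOpen_ball
  have hKV : K ⊆ V ∩ {0}ᶜ := fun z hz => ⟨hρV hz.1, fun h0 => hz.2 (by
    rw [mem_singleton_iff.1 h0]
    exact Metric.mem_ball_self hs)⟩
  have hval : ∀ (z : ℂ) (d : ℝ), u z ≤ d →
      u z + ((-(κ / 2) * Real.log (‖z‖ ^ 2) : ℝ) : EReal) ≤ ((d - κ * Real.log ‖z‖ : ℝ) : EReal) := by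
    intro z d hd
    refine (add_le_add_left hd _).trans_eq ?_
    rw [← EReal.coe_add, Real.log_pow]
    congr 1
    push_cast
    ring
  have hρ : 0 < ρ := hs.trans hsρ
  have hlr : Real.log (ρ / s) = Real.log ρ - Real.log s := Real.log_div hρ.ne' hs.ne'
  have heq : a - κ * Real.log s = b - κ * Real.log ρ := by
    have : κ * Real.log (ρ / s) = b - a := div_mul_cancel₀ _ hlog.ne'
    rw [hlr] at this
    linarith
  have hmain := hw.le_of_frontier (B := b - κ * Real.log ρ) hV' hKc hKV (fun z hz hzi => by
    have h1 : ‖z‖ ≤ ρ := by simpa using hz.1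
    have h2 : s ≤ ‖z‖ := by simpa using hz.2
    rcases h1.lt_or_eq with h1 | h1
    · rcases h2.lt_or_eq with h2 | h2
      · refine absurd (mem_interior.2 ⟨Metric.ball 0 ρ ∩ (Metric.closedBall 0 s)ᶜ, ?_,
          Metric.isOpen_ball.inter Metric.isClosed_closedBall.isOpen_compl, ?_⟩) hzi
        · exact fun y hy => ⟨Metric.ball_subset_closedBall hy.1,
            fun h => hy.2 (Metric.ball_subset_closedBall h)⟩
        · simpa using ⟨h1, h2⟩
      · rw [← heq, h2]
        exact hval z a (ha z h2.symm)
    · rw [← h1]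
      exact hval z b (hb z h1)) z ⟨by simpa using hz'.trans (half_le_self hρ.le), by simpa using hz⟩
  have hz0 : 0 < ‖z‖ := hs.trans_le hz
  have h1 : κ * Real.log 2 ≤ κ * (Real.log ρ - Real.log ‖z‖) := by
    refine mul_le_mul_of_nonneg_left ?_ hκ0
    rw [← Real.log_div hρ.ne' hz0.ne']
    refine Real.log_le_log two_pos ?_
    rw [le_div_iff₀ hz0]
    linarith
  have h2 : (b - a) * (Real.log 2 / Real.log (ρ / s)) = κ * Real.log 2 := by
    rw [hκ]
    ring
  rw [h2]
  have hfin : u z ≤ ((b - κ * Real.log ρ + κ * Real.log ‖z‖ : ℝ) : EReal) := by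
    have h3 : ((-(κ / 2) * Real.log (‖z‖ ^ 2) : ℝ) : EReal) = ((-(κ * Real.log ‖z‖) : ℝ) : EReal) := by
      rw [Real.log_pow]
      congr 1
      push_cast
      ring
    rw [h3] at hmain
    induction hw : u z with
    | top =>
      rw [hw, EReal.top_add_coe] at hmain
      exact absurd hmain (not_le.2 (EReal.coe_lt_top _))
    | bot => exact bot_le
    | coe t =>
      rw [hw, ← EReal.coe_add, EReal.coe_le_coe_iff] at hmain
      rw [EReal.coe_le_coe_iff]
      linarith
  refine hfin.trans (EReal.coe_le_coe_iff.2 ?_)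
  linarith

section Propagation

variable {E : Type*} [NormedAddCommGroup E] [NormedSpace ℂ E]

/-- A bound on a small ball improves the bound on a larger ball, by a factor which depends only on
the radii. -/
theorem PSHOn.propagate {c z₀ : E} {R s : ℝ} (hR : 0 < R) (hs : 0 < s)
    (hz₀ : z₀ ∈ Metric.ball c (R / 8)) : ∃ κ > 0, ∀ (u : E → EReal) (a b : ℝ),
      PSHOn E u (Metric.ball c R) → a ≤ b → (∀ x ∈ Metric.ball c R, u x ≤ b) →
      (∀ x ∈ Metric.ball z₀ s, u x ≤ a) → ∀ x ∈ Metric.ball c (R / 8),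
      u x ≤ ((b - (b - a) * κ : ℝ) : EReal) := by
  -- on the line through `z₀` and `x`, the circles around `z₀` of radii `s'` and `R / 2` are contained in
  -- the small and the large ball, and `x` lies in between
  set s' := min (s / 2) (R / 8) with hs'
  have hs0 : 0 < s' := lt_min (half_pos hs) (by positivity)
  have hs's : s' < s := (min_le_left _ _).trans_lt (half_lt_self hs)
  have hs'R : s' ≤ R / 8 := min_le_right _ _
  have hlog : Real.log 2 ≤ Real.log (R / 2 / s') :=
    Real.log_le_log two_pos (by rw [le_div_iff₀ hs0]; linarith)
  have hl2 : 0 < Real.log 2 := Real.log_pos one_lt_two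
  refine ⟨Real.log 2 / Real.log (R / 2 / s'), div_pos hl2 (hl2.trans_le hlog), ?_⟩
  intro u a b hu hab hb ha x hx
  have hκ1 : Real.log 2 / Real.log (R / 2 / s') ≤ 1 := (div_le_one (hl2.trans_le hlog)).2 hlog
  have hd0 : ‖z₀ - c‖ < R / 8 := by simpa [dist_eq_norm] using hz₀
  have hdx : ‖x - c‖ < R / 8 := by simpa [dist_eq_norm] using hx
  have hxz : ‖x - z₀‖ < R / 4 := by
    have : ‖x - z₀‖ ≤ ‖x - c‖ + ‖z₀ - c‖ := by
      rw [← norm_neg (z₀ - c), neg_sub]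
      simpa using norm_add_le (x - c) (c - z₀)
    linarith
  by_cases hxs : ‖x - z₀‖ < s'
  · refine (ha x (by simpa [dist_eq_norm] using hxs.trans hs's)).trans (EReal.coe_le_coe_iff.2 ?_)
    nlinarith
  push Not at hxs
  have hn0 : 0 < ‖x - z₀‖ := hs0.trans_le hxs
  set e : E := ((‖x - z₀‖⁻¹ : ℝ) : ℂ) • (x - z₀) with he
  have hen : ‖e‖ = 1 := by
    rw [he, norm_smul, Complex.norm_real, norm_inv, norm_norm, inv_mul_cancel₀ hn0.ne']
  have hxe : z₀ + ((‖x - z₀‖ : ℝ) : ℂ) • e = x := by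
    rw [he, smul_smul, ← Complex.ofReal_mul, mul_inv_cancel₀ hn0.ne']
    simp
  have hmem : ∀ ζ : ℂ, ‖ζ‖ < 3 * R / 4 → z₀ + ζ • e ∈ Metric.ball c R := by
    intro ζ hζ
    rw [mem_ball_iff_norm]
    calc ‖z₀ + ζ • e - c‖ = ‖(z₀ - c) + ζ • e‖ := by congr 1; abel
      _ ≤ ‖z₀ - c‖ + ‖ζ • e‖ := norm_add_le _ _
      _ < R := by rw [norm_smul, hen, mul_one]; linarith
  have hF : ContMDiffOn 𝓘(ℂ, ℂ) 𝓘(ℂ, E) ω (fun ζ : ℂ => z₀ + ζ • e) (Metric.ball 0 (3 * R / 4)) :=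
    (contDiff_const.add (contDiff_id.smul contDiff_const)).contMDiff.contMDiffOn
  have hG : PSHOn ℂ (fun ζ : ℂ => u (z₀ + ζ • e)) (Metric.ball 0 (3 * R / 4)) :=
    hu.comp Metric.isOpen_ball Metric.isOpen_ball hF fun ζ hζ => hmem ζ (by simpa using hζ)
  have h1 := hG.three_circles Metric.isOpen_ball (s := s') (ρ := R / 2) (a := a) (b := b)
    (z := ((‖x - z₀‖ : ℝ) : ℂ)) hs0 (by linarith) (Metric.closedBall_subset_ball (by linarith)) hab
    (fun ζ hζ => ha _ (by simpa [norm_smul, hen, hζ] using hs's))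
    (fun ζ hζ => hb _ (hmem ζ (by linarith))) (by simpa using hxs)
    (by simp only [Complex.norm_real, norm_norm]; linarith)
  simp only [hxe] at h1
  exact h1

end Propagation

/-! ### Metrics of `π^*L - c E` -/

namespace RLineBundle

section PairWeight

variable {E : Type*} [NormedAddCommGroup E] [NormedSpace ℂ E] {M : Type*}
  [TopologicalSpace M] [ChartedSpace E M] {F G : RLineBundle E M} {L D : HolLineBundle E M} {c : ℝ}

/-- The trivialization of a line bundle as an `ℝ`-line bundle. -/
def ofTriv (j : L.ι) : (of L).Triv := fun _ => j

/-- The trivialization of a difference. -/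
def subTriv (i : F.Triv) (j : G.Triv) : (F - G).Triv := fun k =>
  match k with
  | .inl k => i k
  | .inr k => j k

/-- The trivialization of `L - c D` attached to trivializations of `L` and `D`. -/
def pairTriv (c : ℝ) (j : L.ι) (o : D.ι) : (of L - c • of D).Triv :=
  subTriv (ofTriv j) (G := c • of D) (ofTriv o)

theorem mem_dom_pairTriv {j : L.ι} {o : D.ι} {x : M} :
    x ∈ (of L - c • of D).dom (pairTriv c j o) ↔ x ∈ L.U j ∧ x ∈ D.U o := by
  rw [mem_dom_sub, mem_dom_smul, mem_dom_of, mem_dom_of]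
  rfl

theorem logTrans_pairTriv {j j' : L.ι} {o o' : D.ι} {x : M} :
    (of L - c • of D).logTrans (pairTriv c j o) (pairTriv c j' o') x =
      Real.log (‖L.g j j' x‖ ^ 2) - c * Real.log (‖D.g o o' x‖ ^ 2) := by
  rw [logTrans_sub, logTrans_smul, logTrans_of, logTrans_of]
  rfl

theorem exists_pairTriv (i : (of L - c • of D).Triv) : ∃ j o, i = pairTriv c j o :=
  ⟨ofIdx (subFst i), ofIdx (smulTriv (subSnd i)), funext fun k => by
    cases k with
    | inl k => rfl
    | inr k => rfl⟩

variable (h : (of L - c • of D).SingPosMetric)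

theorem psh_pair (j : L.ι) (o : D.ι) : PSHOn E (h.φ (pairTriv c j o)) (L.U j ∩ D.U o) := by
  have h1 := h.psh (pairTriv c j o)
  rwa [show (of L - c • of D).dom (pairTriv c j o) = L.U j ∩ D.U o from
    Set.ext fun x => mem_dom_pairTriv] at h1

theorem trans_pair {j j' : L.ι} {o o' : D.ι} {x : M} (hx : x ∈ L.U j ∩ D.U o)
    (hx' : x ∈ L.U j' ∩ D.U o') : h.φ (pairTriv c j o) x = h.φ (pairTriv c j' o') x +
      ((Real.log (‖L.g j j' x‖ ^ 2) - c * Real.log (‖D.g o o' x‖ ^ 2) : ℝ) : EReal) := by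
  rw [← logTrans_pairTriv]
  exact h.trans _ _ x ⟨mem_dom_pairTriv.2 hx, mem_dom_pairTriv.2 hx'⟩

end PairWeight

end RLineBundle

theorem HolLineBundle.g_self {E : Type*} [NormedAddCommGroup E] [NormedSpace ℂ E] {M : Type*}
    [TopologicalSpace M] [ChartedSpace E M] (L : HolLineBundle E M) {i : L.ι} {x : M}
    (hx : x ∈ L.U i) : L.g i i x = 1 :=
  mul_left_cancel₀ (L.g_ne_zero _ _ _ ⟨hx, hx⟩) (by
    rw [L.cocycle i i i x ⟨⟨hx, hx⟩, hx⟩, mul_one])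

open RLineBundle

section Bound

variable {E : Type} [NormedAddCommGroup E] [NormedSpace ℂ E] {X : Type*} [TopologicalSpace X]
  [ChartedSpace E X] [IsManifold 𝓘(ℂ, E) ω X] {L : HolLineBundle E X} {p : X} {c : ℝ}

variable (L p c) in
/-- The `ℝ`-line bundle `π^*L - c E` on the blowup. -/
noncomputable abbrev blowMinus : RLineBundle E (Blowup E p) :=
  of (L.pullback (Blowup.down : Blowup E p → X) Blowup.contMDiff_down) -
    c • of (Blowup.excBundle E p)

/-- The weights of a metric of `π^*L - c E` away from `p`. -/
noncomputable def offWeight (b₀ : Blowup E p) (h : (blowMinus L p c).SingPosMetric) (j : L.ι)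
    (x : X) : EReal :=
  h.φ (pairTriv (L := L.pullback (Blowup.down : Blowup E p → X) Blowup.contMDiff_down)
    (D := Blowup.excBundle E p) c j none) (Blowup.offMap b₀ x)

theorem offWeight_psh (b₀ : Blowup E p) (h : (blowMinus L p c).SingPosMetric) (j : L.ι) :
    PSHOn E (offWeight b₀ h j) (L.U j ∩ {x | x ≠ p}) := by
  have hO := (L.isOpen_U j).inter (Blowup.isOpen_ne E p)
  have hV : IsOpen ((L.pullback (Blowup.down : Blowup E p → X) Blowup.contMDiff_down).U j ∩
      (Blowup.excBundle E p).U none) := ((L.pullback (Blowup.down : Blowup E p → X) Blowup.contMDiff_down).isOpen_U j).inter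
      ((Blowup.excBundle E p).isOpen_U _)
  refine (psh_pair h j none).comp hV hO
    ((Blowup.contMDiffOn_offMap b₀).mono inter_subset_right) ?_
  rintro x ⟨hx, hxp⟩
  rw [Blowup.offMap_of_ne b₀ hxp]
  exact ⟨hx, hxp⟩

/-- The weights away from `p` transform like those of a metric of `L`. -/
theorem offWeight_trans (b₀ : Blowup E p) (h : (blowMinus L p c).SingPosMetric) {j j' : L.ι}
    {x : X} (hx : x ∈ L.U j) (hx' : x ∈ L.U j') (hxp : x ≠ p) :
    offWeight b₀ h j x = offWeight b₀ h j' x + (Real.log (‖L.g j j' x‖ ^ 2) : EReal) := by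
  unfold offWeight
  rw [Blowup.offMap_of_ne b₀ hxp]
  have h1 := trans_pair h (x := Blowup.off x hxp) (j := j) (j' := j') (o := none) (o' := none)
    ⟨hx, hxp⟩ ⟨hx', hxp⟩
  have h2 : (Blowup.excBundle E p).g none none (Blowup.off x hxp) = 1 :=
    (Blowup.excBundle E p).g_self (i := (none : Option (AffDir E))) hxp
  rw [h2, norm_one, one_pow, Real.log_one, mul_zero, sub_zero] at h1
  exact h1

/-- Along a complex line through `p`, the bound of the weight of a metric of `π^*L - c E` on a circle
propagates to the disc, with a gain of `c log |ζ|²`. -/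
theorem offWeight_le_of_sphere (b₀ : Blowup E p) (h : (blowMinus L p c).SingPosMetric) {j : L.ι}
    {R : ℝ} (hR : Metric.ball (chartAt E p p) R ⊆ (chartAt E p).target)
    (hRU : ∀ y ∈ Metric.ball (chartAt E p p) R, (chartAt E p).symm y ∈ L.U j) {r : ℝ} (hr : 0 < r)
    (hrR : r < R) (e : E) (he : ‖e‖ = 1) :
    ∃ a : AffDir E, (∀ (l : ℙ ℂ E) (k : ℂ), l.rep = k • e →
      (Blowup.exc l : Blowup E p) ∈ Blowup.excDom E p (some a)) ∧ ∀ B : ℝ, (∀ ζ : ℂ, ‖ζ‖ = r →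
      offWeight b₀ h j ((chartAt E p).symm (ζ • e + chartAt E p p)) ≤ B) →
    (∀ ζ : ℂ, ζ ≠ 0 → ‖ζ‖ ≤ r → offWeight b₀ h j ((chartAt E p).symm (ζ • e + chartAt E p p)) ≤
      ((B + c * Real.log (‖ζ‖ ^ 2 / r ^ 2) : ℝ) : EReal)) ∧
    ∀ (l : ℙ ℂ E) (k : ℂ), l.rep = k • e →
      h.φ (pairTriv (L := L.pullback (Blowup.down : Blowup E p → X) Blowup.contMDiff_down)
        (D := Blowup.excBundle E p) c j (some a)) (Blowup.exc l) ≤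
          ((B - c * Real.log (r ^ 2) : ℝ) : EReal) := by
  have he0 : e ≠ 0 := fun h0 => by simp [h0] at he
  obtain ⟨f, hf⟩ := SeparatingDual.exists_eq_one (R := ℂ) he0
  set a : AffDir E := ⟨(f, e), hf⟩ with ha
  have haf : ∀ ζ : ℂ, a.f (ζ • e) = ζ := fun ζ => by
    change f (ζ • e) = ζ
    rw [map_smul, hf, smul_eq_mul, mul_one]
  have hlift : ∀ ζ : ℂ, a.lift (ζ • e) = e := fun ζ => by
    rw [AffDir.lift, haf]
    change ζ • e + (1 - ζ) • e = e
    rw [← add_smul]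
    simp
  have hbase : ∀ ζ : ℂ, Blowup.base p a (ζ • e) = (chartAt E p).symm (ζ • e + chartAt E p p) :=
    fun ζ => by rw [Blowup.base, haf, hlift]
  have hball : ∀ ζ : ℂ, ‖ζ‖ < R → ζ • e + chartAt E p p ∈ Metric.ball (chartAt E p p) R := by
    intro ζ hζ
    simpa [norm_smul, he] using hζ
  have hdom : ∀ ζ : ℂ, ‖ζ‖ < R → ζ • e ∈ Blowup.dom p a := fun ζ hζ => by
    change a.f (ζ • e) • a.lift (ζ • e) + chartAt E p p ∈ (chartAt E p).target
    rw [haf, hlift]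
    exact hR (hball ζ hζ)
  have hmem : ∀ ζ : ℂ, ‖ζ‖ < R → Blowup.point p a (ζ • e) ∈ Blowup.excDom E p (some a) :=
    fun ζ hζ => (Blowup.excChart p a).map_target (hdom ζ hζ)
  have hmemL : ∀ ζ : ℂ, ‖ζ‖ < R → Blowup.down (Blowup.point p a (ζ • e)) ∈ L.U j := fun ζ hζ => by
    rw [Blowup.down_point, hbase]
    exact hRU _ (hball ζ hζ)
  -- the weight along the lift of the line, which is a disc through the exceptional divisor
  set G : ℂ → EReal := fun ζ =>
    h.φ (pairTriv (L := L.pullback (Blowup.down : Blowup E p → X) Blowup.contMDiff_down)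
      (D := Blowup.excBundle E p) c j (some a)) (Blowup.point p a (ζ • e)) with hG
  have hGpsh : PSHOn ℂ G (Metric.ball 0 R) := by
    have hV : IsOpen ((L.pullback (Blowup.down : Blowup E p → X) Blowup.contMDiff_down).U j ∩
        (Blowup.excBundle E p).U (some a)) :=
      ((L.pullback (Blowup.down : Blowup E p → X) Blowup.contMDiff_down).isOpen_U j).inter
      ((Blowup.excBundle E p).isOpen_U _)
    have hF : ContMDiffOn 𝓘(ℂ, ℂ) 𝓘(ℂ, E) ω (fun ζ : ℂ => Blowup.point p a (ζ • e))
        (Metric.ball 0 R) :=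
      (Blowup.contMDiffOn_point a).comp ((contDiff_id.smul contDiff_const).contMDiff.contMDiffOn)
        fun ζ hζ => hdom ζ (mem_ball_zero_iff.1 hζ)
    exact (psh_pair h j (some a)).comp hV Metric.isOpen_ball hF fun ζ hζ =>
      ⟨hmemL ζ (mem_ball_zero_iff.1 hζ), hmem ζ (mem_ball_zero_iff.1 hζ)⟩
  -- `ζ` is the equation of the exceptional divisor on this disc
  have hoff : ∀ ζ : ℂ, ζ ≠ 0 → ‖ζ‖ < R →
      offWeight b₀ h j ((chartAt E p).symm (ζ • e + chartAt E p p)) =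
        G ζ + ((c * Real.log (‖ζ‖ ^ 2) : ℝ) : EReal) := by
    intro ζ hζ0 hζ
    have hne : Blowup.base p a (ζ • e) ≠ p := by
      rw [Ne, Blowup.base_eq_iff (hdom ζ hζ), haf]
      exact hζ0
    have hd : Blowup.dir (Blowup.point p a (ζ • e)) = ζ • e := by
      rw [Blowup.dir_point_of_ne (hdom ζ hζ) (by rwa [haf]), haf, hlift]
    unfold offWeight
    rw [← hbase, ← Blowup.down_point, Blowup.offMap_down b₀ (by rwa [Blowup.down_point])]
    have hne' : Blowup.down (Blowup.point p a (ζ • e)) ≠ p := by rwa [Blowup.down_point]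
    have h1 := trans_pair h (x := Blowup.point p a (ζ • e)) (j := j) (j' := j) (o := none)
      (o' := some a) ⟨hmemL ζ hζ, hne'⟩ ⟨hmemL ζ hζ, hmem ζ hζ⟩
    have h2 : (L.pullback (Blowup.down : Blowup E p → X) Blowup.contMDiff_down).g j j
        (Blowup.point p a (ζ • e)) = 1 := L.g_self (hmemL ζ hζ)
    have h3 : (Blowup.excBundle E p).g none (some a) (Blowup.point p a (ζ • e)) = ζ⁻¹ := by
      change 1 / a.f (Blowup.dir (Blowup.point p a (ζ • e))) = _
      rw [hd, haf, one_div]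
    rw [h1, h2, h3, norm_one, one_pow, Real.log_one, norm_inv, inv_pow, Real.log_inv]
    congr 2
    ring
  have h0 : ∀ (l : ℙ ℂ E) (k : ℂ), l.rep = k • e →
      (Blowup.point p a ((0 : ℂ) • e) : Blowup E p) = Blowup.exc l := by
    intro l k hk
    have hb : Blowup.base p a ((0 : ℂ) • e) = p := by
      rw [Blowup.base_eq_iff (hdom 0 (by simpa using hr.trans hrR)), haf]
    rw [Blowup.point, dif_pos hb]
    congr 1
    conv_rhs => rw [← Projectivization.mk_rep l]
    have hk0 : k ≠ 0 := fun h0 => l.rep_nonzero (by rw [hk, h0, zero_smul])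
    refine (Projectivization.mk_eq_mk_iff' ℂ _ _ _ _).2 ⟨k⁻¹, ?_⟩
    rw [hlift, hk, smul_smul, inv_mul_cancel₀ hk0, one_smul]
  refine ⟨a, fun l k hk => h0 l k hk ▸ hmem 0 (by simpa using hr.trans hrR), fun B hB => ?_⟩
  have hGle : ∀ ζ : ℂ, ‖ζ‖ ≤ r → G ζ ≤ ((B - c * Real.log (r ^ 2) : ℝ) : EReal) := by
    refine hGpsh.le_of_sphere Metric.isOpen_ball hr (Metric.closedBall_subset_ball hrR) ?_
    intro ζ hζ
    have hζ0 : ζ ≠ 0 := fun h0 => by simp [h0] at hζ; linarith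
    have h1 := hB ζ hζ
    rw [hoff ζ hζ0 (hζ.trans_lt hrR), hζ] at h1
    induction hw : G ζ with
    | top =>
      rw [hw, EReal.top_add_coe] at h1
      exact absurd h1 (not_le.2 (EReal.coe_lt_top _))
    | bot => exact bot_le
    | coe t =>
      rw [hw, ← EReal.coe_add, EReal.coe_le_coe_iff] at h1
      rw [EReal.coe_le_coe_iff]
      linarith
  refine ⟨fun ζ hζ0 hζ => ?_, fun l k hk => ?_⟩
  · rw [hoff ζ hζ0 (hζ.trans_lt hrR)]
    refine (add_le_add_left (hGle ζ hζ) _).trans_eq ?_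
    rw [← EReal.coe_add, Real.log_div (by simpa using hζ0) (by positivity)]
    congr 1
    ring
  · rw [← h0 l k hk]
    exact hGle 0 (by simpa using hr.le)

omit [IsManifold 𝓘(ℂ, E) ω X] in
/-- A choice of trivializations at the points of a compact manifold, which is locally bounded with
respect to each trivialization. -/
theorem exists_bounded_choice [CompactSpace X] [T2Space X] (L : HolLineBundle E X) :
    ∃ i : X → L.ι, (∀ x, x ∈ L.U (i x)) ∧ ∀ x j, x ∈ L.U j → ∃ C : ℝ, ∀ᶠ y in 𝓝 x,
      |Real.log (‖L.g j (i y) y‖ ^ 2)| ≤ C := by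
  -- finitely many closed sets contained in trivializations cover the manifold; a closed set that
  -- misses `x` does not meet a neighbourhood of `x`
  choose i₀ hi₀ using L.exists_mem
  choose N hN hNc hNU using fun x => exists_mem_nhds_isClosed_subset
    ((L.isOpen_U (i₀ x)).mem_nhds (hi₀ x))
  obtain ⟨t, -, ht⟩ := isCompact_univ.elim_nhds_subcover N fun x _ => hN x
  have ht' : ∀ y, ∃ x ∈ t, y ∈ N x := fun y => by
    have := ht (mem_univ y)
    simpa using this
  choose τ hτ hτN using ht'
  refine ⟨fun y => i₀ (τ y), fun y => hNU _ (hτN y), fun x j hx => ?_⟩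
  have h1 : ∀ x' ∈ t, ∃ C : ℝ, ∀ᶠ y in 𝓝 x, y ∈ N x' →
      |Real.log (‖L.g j (i₀ x') y‖ ^ 2)| ≤ C := by
    intro x' _
    by_cases hxx : x ∈ N x'
    · have hxU := hNU x' hxx
      have h2 : ContinuousAt (fun y => |Real.log (‖L.g j (i₀ x') y‖ ^ 2)|) x := by
        have h3 : ContinuousAt (L.g j (i₀ x')) x := ((L.hol_g j (i₀ x')).contMDiffAt
          (((L.isOpen_U j).inter (L.isOpen_U _)).mem_nhds ⟨hx, hxU⟩)).continuousAt
        refine ((h3.norm.pow 2).log ?_).abs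
        have := L.g_ne_zero j (i₀ x') x ⟨hx, hxU⟩
        simpa using this
      refine ⟨|Real.log (‖L.g j (i₀ x') x‖ ^ 2)| + 1, ?_⟩
      filter_upwards [h2.eventually_lt_const (lt_add_one _)] with y hy _ using hy.le
    · refine ⟨0, ?_⟩
      filter_upwards [(hNc x').isOpen_compl.mem_nhds hxx] with y hy h using absurd h hy
  choose! C hC using h1
  refine ⟨∑ x' ∈ t, |C x'|, ?_⟩
  have h2 : ∀ᶠ y in 𝓝 x, ∀ x' ∈ t, y ∈ N x' → |Real.log (‖L.g j (i₀ x') y‖ ^ 2)| ≤ C x' :=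
    (Finset.eventually_all t).2 hC
  filter_upwards [h2] with y hy
  exact (hy _ (hτ y) (hτN y)).trans ((le_abs_self _).trans
    (Finset.single_le_sum (f := fun x' => |C x'|) (fun _ _ => abs_nonneg _) (hτ y)))

end Bound

/-! ### Propagation of bounds on a compact connected manifold -/

section Spread

variable {E : Type} [NormedAddCommGroup E] [NormedSpace ℂ E] {X : Type*} [TopologicalSpace X]
  [ChartedSpace E X]

omit [NormedSpace ℂ E] in
/-- Coordinate balls around a point whose points lie in a given neighbourhood. -/
theorem exists_chart_ball {x : X} {O : Set X} (hO : O ∈ 𝓝 x) : ∃ R > 0,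
    Metric.ball (chartAt E x x) R ⊆ (chartAt E x).target ∧
    ∀ y ∈ Metric.ball (chartAt E x x) R, (chartAt E x).symm y ∈ O := by
  have h1 : (chartAt E x).target ∈ 𝓝 (chartAt E x x) :=
    (chartAt E x).open_target.mem_nhds (mem_chart_target E x)
  have h2 : (chartAt E x).symm ⁻¹' O ∈ 𝓝 (chartAt E x x) :=
    ((chartAt E x).continuousAt_symm (mem_chart_target E x)).preimage_mem_nhds (by
      rwa [(chartAt E x).left_inv (mem_chart_source E x)])
  obtain ⟨R, hR, h⟩ := Metric.mem_nhds_iff.1 (inter_mem h1 h2)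
  exact ⟨R, hR, fun y hy => (h hy).1, fun y hy => (h hy).2⟩

omit [NormedSpace ℂ E] in
theorem mem_nhds_of_chart_ball {x : X} {R : ℝ} (hR : 0 < R) :
    (chartAt E x).source ∩ chartAt E x ⁻¹' Metric.ball (chartAt E x x) R ∈ 𝓝 x :=
  inter_mem (chart_source_mem_nhds E x)
    ((chartAt E x).continuousAt (mem_chart_source E x) |>.preimage_mem_nhds
      (Metric.ball_mem_nhds _ hR))

/-- The weights of a family of singular metrics of a line bundle on the complement of a point. -/
structure PuncturedMetric (L : HolLineBundle E X) (p : X) (w : L.ι → X → EReal) : Prop where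
  psh : ∀ j, PSHOn E (w j) (L.U j ∩ {x | x ≠ p})
  trans : ∀ j j' x, x ∈ L.U j → x ∈ L.U j' → x ≠ p →
    w j x = w j' x + (Real.log (‖L.g j j' x‖ ^ 2) : EReal)

variable {L : HolLineBundle E X} {p : X}

/-- Bounds of weights in different trivializations differ by a bound of the transition function. -/
theorem PuncturedMetric.le_add {w : L.ι → X → EReal} (hw : PuncturedMetric L p w) {j j' : L.ι}
    {x : X} (hj : x ∈ L.U j) (hj' : x ∈ L.U j') (hx : x ≠ p) {B C : ℝ} (h : w j' x ≤ B)
    (hC : |Real.log (‖L.g j j' x‖ ^ 2)| ≤ C) : w j x ≤ ((B + C : ℝ) : EReal) := by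
  rw [hw.trans j j' x hj hj' hx, EReal.coe_add]
  exact add_le_add h (EReal.coe_le_coe_iff.2 ((le_abs_self _).trans hC))

theorem PuncturedMetric.le_add' {w : L.ι → X → EReal} (hw : PuncturedMetric L p w) {j j' : L.ι}
    {x : X} (hj : x ∈ L.U j) (hj' : x ∈ L.U j') (hx : x ≠ p) {B C : ℝ} (h : w j x ≤ B)
    (hC : |Real.log (‖L.g j j' x‖ ^ 2)| ≤ C) : w j' x ≤ ((B + C : ℝ) : EReal) := by
  refine hw.le_add hj' hj hx h ?_
  have h1 : L.g j' j x * L.g j j' x = 1 := by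
    rw [L.cocycle j' j j' x ⟨⟨hj', hj⟩, hj'⟩, L.g_self hj']
  rwa [eq_inv_of_mul_eq_one_left h1, norm_inv, inv_pow, Real.log_inv, abs_neg]

/-- If normalized weights are uniformly bounded and tend to `-∞` near one point, then they tend
to `-∞` everywhere: the set of the points near which they do is open and closed, by
`PSHOn.propagate`. -/
theorem tendsto_bot_of_near [IsManifold 𝓘(ℂ, E) ω X] [T1Space X] [CompactSpace X]
    [PreconnectedSpace X] {i : X → L.ι}
    (hi : ∀ x, x ∈ L.U (i x)) (hib : ∀ x j, x ∈ L.U j → ∃ C : ℝ, ∀ᶠ y in 𝓝 x,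
      |Real.log (‖L.g j (i y) y‖ ^ 2)| ≤ C) {w : ℕ → L.ι → X → EReal}
    (hw : ∀ k, PuncturedMetric L p (w k)) {m : ℕ → ℝ} {C₁ : ℝ}
    (hle : ∀ k x, x ≠ p → w k (i x) x ≤ ((m k + C₁ : ℝ) : EReal))
    (hp : ∃ W ∈ 𝓝 p, ∀ N : ℝ, ∀ᶠ k in atTop, ∀ y ∈ W, y ≠ p →
      w k (i y) y ≤ ((m k - N : ℝ) : EReal)) (N : ℝ) :
    ∀ᶠ k in atTop, ∀ y, y ≠ p → w k (i y) y ≤ ((m k - N : ℝ) : EReal) := by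
  set Z : Set X := {x | ∃ W ∈ 𝓝 x, ∀ N : ℝ, ∀ᶠ k in atTop, ∀ y ∈ W, y ≠ p →
      w k (i y) y ≤ ((m k - N : ℝ) : EReal)} with hZ
  have hZo : IsOpen Z := by
    refine isOpen_iff_mem_nhds.2 ?_
    rintro x ⟨W, hW, h⟩
    obtain ⟨W', hW', hWo, hx⟩ := mem_nhds_iff.1 hW
    exact Filter.mem_of_superset (hWo.mem_nhds hx) fun y hy =>
      ⟨W', hWo.mem_nhds hy, fun N => (h N).mono fun k hk z hz => hk z (hW' hz)⟩
  have hZc : IsClosed Z := by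
    refine isClosed_of_closure_subset fun x hx => ?_
    by_cases hxp : x = p
    · rw [hxp]; exact hp
    obtain ⟨C, hC⟩ := hib x (i x) (hi x)
    have hO : {y | y ≠ p ∧ y ∈ L.U (i x) ∧ |Real.log (‖L.g (i x) (i y) y‖ ^ 2)| ≤ C} ∈ 𝓝 x :=
      inter_mem (isOpen_ne.mem_nhds hxp) (inter_mem ((L.isOpen_U _).mem_nhds (hi x)) hC)
    obtain ⟨R, hR, hRt, hRO⟩ := exists_chart_ball (E := E) hO
    have hR8 : 0 < R / 8 := by positivity
    obtain ⟨z, ⟨hzs, hzb⟩, W, hW, hWN⟩ := mem_closure_iff_nhds.1 hx _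
      (mem_nhds_of_chart_ball (E := E) (x := x) hR8)
    have hzt : chartAt E x z ∈ (chartAt E x).target := (chartAt E x).map_source hzs
    have hWz : (chartAt E x).symm ⁻¹' W ∈ 𝓝 (chartAt E x z) :=
      ((chartAt E x).continuousAt_symm hzt).preimage_mem_nhds (by
        rwa [(chartAt E x).left_inv hzs])
    obtain ⟨s, hs, hsW⟩ := Metric.mem_nhds_iff.1 (inter_mem hWz
      (Metric.isOpen_ball.mem_nhds (Metric.ball_subset_ball (by linarith : R / 8 ≤ R) hzb)))
    obtain ⟨κ, hκ, hprop⟩ := PSHOn.propagate (E := E) hR hs hzb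
    refine ⟨_, mem_nhds_of_chart_ball (E := E) (x := x) hR8, fun N => ?_⟩
    -- The propagation multiplies the gap between the bounds on the small and on the large ball by `κ`,
    -- and the two changes of trivialization cost `2 * C`: the gap `|C₁ + 2 * C + N| / κ` suffices.
    filter_upwards [hWN (|C₁ + 2 * C + N| / κ - C₁)] with k hk y hy hyp
    have hyt : chartAt E x y ∈ Metric.ball (chartAt E x x) R :=
      Metric.ball_subset_ball (by linarith : R / 8 ≤ R) hy.2
    have hpsh : PSHOn E (fun e => w k (i x) ((chartAt E x).symm e))
        (Metric.ball (chartAt E x x) R) :=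
      ((hw k).psh (i x)).comp ((L.isOpen_U _).inter isOpen_ne) Metric.isOpen_ball
        ((contMDiffOn_chart_symm (x := x)).mono hRt) fun e he =>
          ⟨(hRO e he).2.1, (hRO e he).1⟩
    have hM := hprop _ (m k - (|C₁ + 2 * C + N| / κ - C₁) + C) (m k + C₁ + C) hpsh (by
        have : 0 ≤ |C₁ + 2 * C + N| / κ := by positivity
        linarith)
      (fun e he => (hw k).le_add (hRO e he).2.1 (hi _) (hRO e he).1 (hle k _ (hRO e he).1)
        (hRO e he).2.2)
      (fun e he => (hw k).le_add (hRO e (hsW he).2).2.1 (hi _) (hRO e (hsW he).2).1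
        (hk _ (hsW he).1 (hRO e (hsW he).2).1) (hRO e (hsW he).2).2.2) _ hy.2
    have hyO := hRO _ hyt
    rw [(chartAt E x).left_inv hy.1] at hM hyO
    refine ((hw k).le_add' hyO.2.1 (hi y) hyp hM hyO.2.2).trans (EReal.coe_le_coe_iff.2 ?_)
    have h1 : (m k + C₁ + C - (m k - (|C₁ + 2 * C + N| / κ - C₁) + C)) * κ =
        |C₁ + 2 * C + N| := by
      field_simp
      ring
    rw [h1]
    have := le_abs_self (C₁ + 2 * C + N)
    linarith
  have hZu : Z = univ := IsClopen.eq_univ ⟨hZc, hZo⟩ ⟨p, hp⟩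
  choose W hW hWN using fun x => (hZu ▸ mem_univ x : x ∈ Z)
  obtain ⟨t, -, ht⟩ := isCompact_univ.elim_nhds_subcover W fun x _ => hW x
  filter_upwards [(Finset.eventually_all t).2 fun x _ => hWN x N] with k hk y hy
  have := ht (mem_univ y)
  obtain ⟨x, hx, hyx⟩ : ∃ x ∈ t, y ∈ W x := by simpa using this
  exact hk x hx y hyx hy

end Spread

/-! ### Finiteness of `C_max` -/

section Bounded

variable {E : Type} [NormedAddCommGroup E] [NormedSpace ℂ E] {X : Type*} [TopologicalSpace X]
  [ChartedSpace E X] [IsManifold 𝓘(ℂ, E) ω X] {L : HolLineBundle E X} {p : X} {c : ℝ}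

theorem puncturedMetric_offWeight (b₀ : Blowup E p) (h : (blowMinus L p c).SingPosMetric) :
    PuncturedMetric L p (offWeight b₀ h) :=
  ⟨offWeight_psh b₀ h, fun _ _ _ => offWeight_trans b₀ h⟩

/-- The vanishing of a metric of `π^*L - c E` (as a weight `-∞`) away from a coordinate ball around `p`
forces its vanishing everywhere. -/
theorem eq_bot_of_offWeight_eq_bot (b₀ : Blowup E p) (h : (blowMinus L p c).SingPosMetric) {j : L.ι}
    {R : ℝ} (hR : Metric.ball (chartAt E p p) R ⊆ (chartAt E p).target)
    (hRU : ∀ y ∈ Metric.ball (chartAt E p p) R, (chartAt E p).symm y ∈ L.U j) {r : ℝ} (hr : 0 < r)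
    (hrR : r < R) (hbot : ∀ x, x ≠ p → x ∉ (chartAt E p).source ∩
      chartAt E p ⁻¹' Metric.ball (chartAt E p p) r → ∀ j', x ∈ L.U j' → offWeight b₀ h j' x = ⊥)
    (i : (blowMinus L p c).Triv) (b : Blowup E p) (hb : b ∈ (blowMinus L p c).dom i) :
    h.φ i b = ⊥ := by
  obtain ⟨j₁, o₁, rfl⟩ := exists_pairTriv i
  have hb' := mem_dom_pairTriv.1 hb
  have key : ∀ j₂ o₂, b ∈ (L.pullback (Blowup.down : Blowup E p → X) Blowup.contMDiff_down).U j₂ ∩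
      (Blowup.excBundle E p).U o₂ → h.φ (pairTriv c j₂ o₂) b = ⊥ →
      h.φ (pairTriv c j₁ o₁) b = ⊥ := fun j₂ o₂ h2 h3 => by
    rw [trans_pair h hb' h2, h3, EReal.bot_add]
  have hsph : ∀ e : E, ‖e‖ = 1 → ∀ ζ : ℂ, ‖ζ‖ = r →
      offWeight b₀ h j ((chartAt E p).symm (ζ • e + chartAt E p p)) = ⊥ := by
    intro e he ζ hζ
    have hm : ζ • e + chartAt E p p ∈ Metric.ball (chartAt E p p) R := by
      simpa [norm_smul, he, hζ] using hrR
    have hnot : (chartAt E p).symm (ζ • e + chartAt E p p) ∉ (chartAt E p).source ∩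
        chartAt E p ⁻¹' Metric.ball (chartAt E p p) r := fun hx => by
      have := hx.2
      rw [mem_preimage, (chartAt E p).right_inv (hR hm)] at this
      simp [norm_smul, he, hζ] at this
    refine hbot _ (fun hx => hnot ?_) hnot j (hRU _ hm)
    rw [hx]
    exact ⟨mem_chart_source E p, Metric.mem_ball_self hr⟩
  -- the bounds along lines through `p` hold for every bound `B` on the sphere
  have hbotle : ∀ t : EReal, (∀ B : ℝ, t ≤ B) → t = ⊥ := fun t ht =>
    eq_bot_iff.2 (EReal.le_of_forall_lt_iff_le.1 fun z _ => ht z)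
  cases b with
  | off x hx =>
    have hoff : ∀ j₂, offWeight b₀ h j₂ x = h.φ (pairTriv c j₂ none) (Blowup.off x hx) := fun j₂ => by
      unfold offWeight
      rw [Blowup.offMap_of_ne b₀ hx]
    by_cases hxV : x ∈ (chartAt E p).source ∩ chartAt E p ⁻¹' Metric.ball (chartAt E p p) r
    · set v := chartAt E p x - chartAt E p p with hv
      have hv0 : v ≠ 0 := fun h0 => hx ((chartAt E p).injOn hxV.1 (mem_chart_source E p)
        (sub_eq_zero.1 h0))
      have hvr : ‖v‖ < r := by simpa [dist_eq_norm] using hxV.2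
      have hvn : (‖v‖ : ℂ) ≠ 0 := by simpa using hv0
      have he : ‖(‖v‖ : ℂ)⁻¹ • v‖ = 1 := by
        rw [norm_smul, norm_inv, Complex.norm_real, norm_norm,
          inv_mul_cancel₀ (norm_ne_zero_iff.2 hv0)]
      obtain ⟨a, -, hB⟩ := offWeight_le_of_sphere b₀ h hR hRU hr hrR _ he
      have hxe : (chartAt E p).symm ((‖v‖ : ℂ) • (‖v‖ : ℂ)⁻¹ • v + chartAt E p p) = x := by
        rw [smul_inv_smul₀ hvn, hv, sub_add_cancel, (chartAt E p).left_inv hxV.1]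
      have hxj : x ∈ L.U j := by
        have := hRU (chartAt E p x) (Metric.ball_subset_ball hrR.le hxV.2)
        rwa [(chartAt E p).left_inv hxV.1] at this
      refine key j none ⟨hxj, hx⟩ ?_
      rw [← hoff]
      refine hbotle _ fun B => ?_
      have h3 := (hB (B - c * Real.log (‖(‖v‖ : ℂ)‖ ^ 2 / r ^ 2)) fun ζ hζ => by
        rw [hsph _ he ζ hζ]; exact bot_le).1 ‖v‖ hvn (by simpa using hvr.le)
      rwa [hxe, sub_add_cancel] at h3
    · refine key j₁ none ⟨hb'.1, hx⟩ ?_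
      exact (hoff j₁).symm.trans (hbot x hx hxV j₁ hb'.1)
  | exc l =>
    have hvn : (‖l.rep‖ : ℂ) ≠ 0 := by simpa using l.rep_nonzero
    have he : ‖(‖l.rep‖ : ℂ)⁻¹ • l.rep‖ = 1 := by
      rw [norm_smul, norm_inv, Complex.norm_real, norm_norm,
        inv_mul_cancel₀ (norm_ne_zero_iff.2 l.rep_nonzero)]
    obtain ⟨a, ha, hB⟩ := offWeight_le_of_sphere b₀ h hR hRU hr hrR _ he
    have hl := (smul_inv_smul₀ hvn l.rep).symm
    have hpj : p ∈ L.U j := by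
      have := hRU (chartAt E p p) (Metric.mem_ball_self (hr.trans hrR))
      rwa [(chartAt E p).left_inv (mem_chart_source E p)] at this
    refine key j (some a) ⟨hpj, ha l _ hl⟩ (hbotle _ fun B => ?_)
    have h3 := (hB (B + c * Real.log (r ^ 2)) fun ζ hζ => by
      rw [hsph _ he ζ hζ]; exact bot_le).2 l _ hl
    rwa [add_sub_cancel_right] at h3

end Bounded

section Bounded

variable {E : Type} [NormedAddCommGroup E] [NormedSpace ℂ E] {X : Type*} [TopologicalSpace X]
  [ChartedSpace E X] {L : HolLineBundle E X} {p : X} {c : ℝ}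

/-- The supremum over a compact set of weights that are not identically `-∞` there. -/
theorem PuncturedMetric.exists_sup {i : X → L.ι}
    (hi : ∀ x, x ∈ L.U (i x)) (hib : ∀ x j, x ∈ L.U j → ∃ C : ℝ, ∀ᶠ y in 𝓝 x,
      |Real.log (‖L.g j (i y) y‖ ^ 2)| ≤ C) [T1Space X] {w : L.ι → X → EReal}
    (hw : PuncturedMetric L p w) {K : Set X} (hK : IsCompact K) (hpK : p ∉ K)
    (hne : ∃ x ∈ K, w (i x) x ≠ ⊥) :
    ∃ m : ℝ, (∀ x ∈ K, w (i x) x ≤ m) ∧ ∃ x ∈ K, ((m - 1 : ℝ) : EReal) < w (i x) x := by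
  have hloc : ∀ x ∈ K, ∃ C : ℝ, ∀ᶠ y in 𝓝 x, y ≠ p → w (i y) y ≤ C := by
    intro x hx
    have hxp : x ≠ p := fun h => hpK (h ▸ hx)
    obtain ⟨C, hC⟩ := hib x (i x) (hi x)
    have hO : IsOpen (L.U (i x) ∩ {y | y ≠ p}) := (L.isOpen_U _).inter isOpen_ne
    obtain ⟨t, ht, -⟩ := EReal.lt_iff_exists_real_btwn.1
      ((hw.psh (i x)).lt_top x ⟨hi x, hxp⟩)
    have h1 := (hw.psh (i x)).usc x ⟨hi x, hxp⟩ t ht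
    rw [hO.nhdsWithin_eq ⟨hi x, hxp⟩] at h1
    refine ⟨t + C, ?_⟩
    filter_upwards [h1, hC, hO.mem_nhds ⟨hi x, hxp⟩] with y h2 h3 h4 _
    exact hw.le_add' h4.1 (hi y) h4.2 h2.le h3
  choose! C hC using hloc
  obtain ⟨t, htK, ht⟩ := hK.elim_nhds_subcover _ fun x hx => hC x hx
  have hbd : ∀ y ∈ K, w (i y) y ≤ ((∑ x ∈ t, |C x| : ℝ) : EReal) := by
    intro y hy
    obtain ⟨x, hx, hyx⟩ : ∃ x ∈ t, y ∈ {y | y ≠ p → w (i y) y ≤ C x} := by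
      simpa using ht hy
    exact (hyx fun h => hpK (h ▸ hy)).trans (EReal.coe_le_coe_iff.2 ((le_abs_self _).trans
      (Finset.single_le_sum (f := fun x => |C x|) (fun _ _ => abs_nonneg _) hx)))
  set S : Set ℝ := {s | ∃ y ∈ K, w (i y) y = s} with hS
  have hcoe : ∀ y ∈ K, w (i y) y ≠ ⊥ → ∃ s : ℝ, w (i y) y = s := fun y hy h0 =>
    ⟨_, (EReal.coe_toReal ((hbd y hy).trans_lt (EReal.coe_lt_top _)).ne h0).symm⟩
  have hSne : S.Nonempty := by
    obtain ⟨y, hy, h0⟩ := hne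
    obtain ⟨s, hs⟩ := hcoe y hy h0
    exact ⟨s, y, hy, hs⟩
  have hSb : BddAbove S := by
    refine ⟨∑ x ∈ t, |C x|, ?_⟩
    rintro s ⟨y, hy, hs⟩
    exact EReal.coe_le_coe_iff.1 (hs ▸ hbd y hy)
  refine ⟨sSup S, fun y hy => ?_, ?_⟩
  · by_cases h0 : w (i y) y = ⊥
    · rw [h0]; exact bot_le
    · obtain ⟨s, hs⟩ := hcoe y hy h0
      rw [hs]
      exact EReal.coe_le_coe_iff.2 (le_csSup hSb ⟨y, hy, hs⟩)
  · obtain ⟨s, ⟨y, hy, hs⟩, hlt⟩ := exists_lt_of_lt_csSup hSne (sub_one_lt (sSup S))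
    exact ⟨y, hy, hs ▸ EReal.coe_lt_coe_iff.2 hlt⟩

variable [IsManifold 𝓘(ℂ, E) ω X]

/-- The estimate of the weights of a metric of `π^*L - c E` near `p` by their bound away from `p`. -/
theorem offWeight_le_near (b₀ : Blowup E p) (h : (blowMinus L p c).SingPosMetric) {j : L.ι}
    {R : ℝ} (hR : Metric.ball (chartAt E p p) R ⊆ (chartAt E p).target)
    {i : X → L.ι} (hi : ∀ x, x ∈ L.U (i x)) {C₀ : ℝ}
    (hRU : ∀ y ∈ Metric.ball (chartAt E p p) R, (chartAt E p).symm y ∈ L.U j ∧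
      |Real.log (‖L.g j (i ((chartAt E p).symm y)) ((chartAt E p).symm y)‖ ^ 2)| ≤ C₀)
    {r : ℝ} (hr : 0 < r) (hrR : r < R) {m : ℝ}
    (hm : ∀ x ∉ (chartAt E p).source ∩ chartAt E p ⁻¹' Metric.ball (chartAt E p p) r,
      offWeight b₀ h (i x) x ≤ m) {x : X} (hxp : x ≠ p)
    (hx : x ∈ (chartAt E p).source ∩ chartAt E p ⁻¹' Metric.ball (chartAt E p p) r) :
    offWeight b₀ h (i x) x ≤
      ((m + 2 * C₀ + c * Real.log (‖chartAt E p x - chartAt E p p‖ ^ 2 / r ^ 2) : ℝ) : EReal) := by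
  have hw := puncturedMetric_offWeight b₀ h
  set v := chartAt E p x - chartAt E p p with hv
  have hv0 : v ≠ 0 := fun h0 => hxp ((chartAt E p).injOn hx.1 (mem_chart_source E p)
    (sub_eq_zero.1 h0))
  have hvr : ‖v‖ < r := by simpa [dist_eq_norm] using hx.2
  have hvn : (‖v‖ : ℂ) ≠ 0 := by simpa using hv0
  have he : ‖(‖v‖ : ℂ)⁻¹ • v‖ = 1 := by
    rw [norm_smul, norm_inv, Complex.norm_real, norm_norm,
      inv_mul_cancel₀ (norm_ne_zero_iff.2 hv0)]
  obtain ⟨a, -, hB⟩ := offWeight_le_of_sphere b₀ h hR (fun y hy => (hRU y hy).1) hr hrR _ he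
  have hxe : (chartAt E p).symm ((‖v‖ : ℂ) • (‖v‖ : ℂ)⁻¹ • v + chartAt E p p) = x := by
    rw [smul_inv_smul₀ hvn, hv, sub_add_cancel, (chartAt E p).left_inv hx.1]
  have h3 := (hB (m + C₀) fun ζ hζ => by
    have hmR : ζ • (‖v‖ : ℂ)⁻¹ • v + chartAt E p p ∈ Metric.ball (chartAt E p p) R := by
      rw [mem_ball_iff_norm, add_sub_cancel_right, norm_smul, he, mul_one, hζ]
      exact hrR
    have hnot : (chartAt E p).symm (ζ • (‖v‖ : ℂ)⁻¹ • v + chartAt E p p) ∉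
        (chartAt E p).source ∩ chartAt E p ⁻¹' Metric.ball (chartAt E p p) r := fun hx => by
      have := hx.2
      rw [mem_preimage, (chartAt E p).right_inv (hR hmR), mem_ball_iff_norm,
        add_sub_cancel_right, norm_smul, he, mul_one, hζ] at this
      exact lt_irrefl _ this
    refine hw.le_add (hRU _ hmR).1 (hi _) (fun hx => hnot ?_) (hm _ hnot) (hRU _ hmR).2
    rw [hx]
    exact ⟨mem_chart_source E p, Metric.mem_ball_self hr⟩).1 ‖v‖ hvn (by simpa using hvr.le)
  rw [hxe] at h3
  have hxR := hRU _ (Metric.ball_subset_ball hrR.le hx.2)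
  rw [(chartAt E p).left_inv hx.1] at hxR
  refine (hw.le_add' hxR.1 (hi x) hxp h3 hxR.2).trans_eq (congrArg _ ?_)
  rw [Complex.norm_real, norm_norm]
  ring

/-- On a compact manifold, `π^*L - c E` is pseudoeffective for bounded `c` only. Metrics for
`c → ∞`, normalized to have supremum zero away from `p`, would tend to `-∞` near `p`, hence
everywhere. -/
theorem bddAbove_pseudoeffective [FiniteDimensional ℂ E] [Nontrivial E] [CompactSpace X] [T2Space X]
    [PreconnectedSpace X] (L : HolLineBundle E X) (p : X) :
    BddAbove {c : ℝ | (blowMinus L p c).IsPseudoeffective} := by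
  by_contra hnb
  rw [not_bddAbove_iff] at hnb
  choose c hc hck using fun k : ℕ => hnb k
  choose h hne using hc
  obtain ⟨b₀⟩ : Nonempty (Blowup E p) := by
    obtain ⟨v, hv⟩ := exists_ne (0 : E)
    exact ⟨.exc (Projectivization.mk ℂ v hv)⟩
  obtain ⟨i, hi, hib⟩ := exists_bounded_choice L
  obtain ⟨C₀, hC₀⟩ := hib p (i p) (hi p)
  obtain ⟨R, hR, hRt, hRO⟩ := exists_chart_ball (E := E)
    (inter_mem ((L.isOpen_U (i p)).mem_nhds (hi p)) hC₀)
  have hC₀0 : 0 ≤ C₀ := (abs_nonneg _).trans (hRO _ (Metric.mem_ball_self hR)).2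
  set r := R / 2 with hr
  have hr0 : 0 < r := half_pos hR
  have hrR : r < R := half_lt_self hR
  set V := (chartAt E p).source ∩ chartAt E p ⁻¹' Metric.ball (chartAt E p p) r with hV
  have hVo : IsOpen V := (chartAt E p).isOpen_inter_preimage Metric.isOpen_ball
  have hpV : p ∈ V := ⟨mem_chart_source E p, Metric.mem_ball_self hr0⟩
  have hw := fun k => puncturedMetric_offWeight b₀ (h k)
  -- the normalization by the supremum `m k` over the compact complement of a ball around `p`
  have hsup : ∀ k, ∃ m : ℝ, (∀ x ∈ Vᶜ, offWeight b₀ (h k) (i x) x ≤ m) ∧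
      ∃ x ∈ Vᶜ, ((m - 1 : ℝ) : EReal) < offWeight b₀ (h k) (i x) x := by
    intro k
    refine (hw k).exists_sup hi hib hVo.isClosed_compl.isCompact (fun h => h hpV) ?_
    by_contra! hbot
    obtain ⟨τ, b, hb, hφ⟩ := hne k
    refine hφ (eq_bot_of_offWeight_eq_bot b₀ (h k) hRt (fun y hy => (hRO y hy).1) hr0 hrR ?_ τ b hb)
    intro x hxp hxV j' hj'
    rw [(hw k).trans j' (i x) x hj' (hi x) hxp, hbot x hxV, EReal.bot_add]
  choose m hm hm1 using hsup
  have hck0 : ∀ k, 0 ≤ c k := fun k => (Nat.cast_nonneg k).trans (hck k).le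
  have hnear := fun k {x} => offWeight_le_near b₀ (h k) hRt hi hRO hr0 hrR (hm k) (x := x)
  have hle : ∀ k x, x ≠ p → offWeight b₀ (h k) (i x) x ≤ ((m k + 2 * C₀ : ℝ) : EReal) := by
    intro k x hxp
    by_cases hxV : x ∈ V
    · refine (hnear k hxp hxV).trans (EReal.coe_le_coe_iff.2 ?_)
      have hvr : ‖chartAt E p x - chartAt E p p‖ < r := by simpa [dist_eq_norm] using hxV.2
      have h1 : Real.log (‖chartAt E p x - chartAt E p p‖ ^ 2 / r ^ 2) ≤ 0 := by
        refine Real.log_nonpos (by positivity) ?_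
        rw [← div_pow]
        exact pow_le_one₀ (by positivity) ((div_le_one hr0).2 hvr.le)
      have := mul_nonpos_of_nonneg_of_nonpos (hck0 k) h1
      linarith
    · refine (hm k x hxV).trans (EReal.coe_le_coe_iff.2 ?_)
      linarith
  -- on the ball of half the radius the gain is at least `2 c log 2`, which tends to infinity
  have hp : ∃ W ∈ 𝓝 p, ∀ N : ℝ, ∀ᶠ k in atTop, ∀ y ∈ W, y ≠ p →
      offWeight b₀ (h k) (i y) y ≤ ((m k - N : ℝ) : EReal) := by
    refine ⟨_, mem_nhds_of_chart_ball (E := E) (x := p) (half_pos hr0), fun N => ?_⟩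
    have hl2 : 0 < Real.log 2 := Real.log_pos one_lt_two
    obtain ⟨n, hn⟩ := exists_nat_ge ((2 * C₀ + N) / (2 * Real.log 2))
    filter_upwards [eventually_ge_atTop n] with k hk y hy hyp
    have hyV : y ∈ V := ⟨hy.1, Metric.ball_subset_ball (by linarith) hy.2⟩
    refine (hnear k hyp hyV).trans (EReal.coe_le_coe_iff.2 ?_)
    have hvr : ‖chartAt E p y - chartAt E p p‖ < r / 2 := by simpa [dist_eq_norm] using hy.2
    have hv0 : 0 < ‖chartAt E p y - chartAt E p p‖ := norm_pos_iff.2 fun h0 =>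
      hyp ((chartAt E p).injOn hy.1 (mem_chart_source E p) (sub_eq_zero.1 h0))
    have h1 : Real.log (‖chartAt E p y - chartAt E p p‖ ^ 2 / r ^ 2) ≤ -(2 * Real.log 2) := by
      rw [← div_pow, Real.log_pow]
      have h2 : Real.log (‖chartAt E p y - chartAt E p p‖ / r) ≤ Real.log 2⁻¹ :=
        Real.log_le_log (by positivity) (by rw [div_le_iff₀ hr0]; linarith)
      rw [Real.log_inv] at h2
      push_cast
      linarith
    have h3 := mul_le_mul_of_nonneg_left h1 (hck0 k)
    have h4 : (2 * C₀ + N) / (2 * Real.log 2) ≤ c k :=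
      hn.trans ((Nat.cast_le.2 hk).trans (hck k).le)
    rw [div_le_iff₀ (by positivity)] at h4
    linarith
  -- weights below `m k - 1` contradict the choice of `m k` as a supremum
  obtain ⟨k, hk⟩ := (tendsto_bot_of_near hi hib hw hle hp 1).exists
  obtain ⟨x, hx, hlt⟩ := hm1 k
  exact absurd (hk x fun h0 => hx (h0 ▸ hpV)) (not_le.2 hlt)

end Bounded

/-! ### Positivity of `C_max` -/

section Twist

variable {E : Type*} [NormedAddCommGroup E] [NormedSpace ℂ E] {M : Type*}
  [TopologicalSpace M] [ChartedSpace E M]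

/-- The weights of a smooth metric in two trivializations differ by a pluriharmonic function. -/
theorem SmoothMetric.supportedAt_sub {L : HolLineBundle E M} (ψ : SmoothMetric L) {i j : L.ι} {x : M}
    (hi : x ∈ L.U i) (hj : x ∈ L.U j) (c : ℝ) :
    SupportedAt E (fun y => c * (ψ.ψ i y - ψ.ψ j y)) x := by
  refine (L.supportedAt_log ⟨hi, hj⟩ c).congr ?_
  filter_upwards [((L.isOpen_U i).inter (L.isOpen_U j)).mem_nhds ⟨hi, hj⟩] with y hy
  rw [ψ.trans i j y hy, add_sub_cancel_left]

/-- On a compact manifold, strictly positive singular metrics can be perturbed by small powers of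
a smooth metric. -/
theorem RLineBundle.SingPosMetric.IsStrictlyPositive.exists_psh_add [IsManifold 𝓘(ℂ, E) ω M]
    [FiniteDimensional ℂ E] [CompactSpace M] {F : RLineBundle E M} {h : F.SingPosMetric}
    (hs : h.IsStrictlyPositive) {A : HolLineBundle E M} (ψ : SmoothMetric A) :
    ∃ ε > 0, ∀ s : ℝ, |s| < ε → ∀ i j,
      PSHOn E (fun x => h.φ i x + ((s * ψ.ψ j x : ℝ) : EReal)) (F.dom i ∩ A.U j) := by
  obtain ⟨θ, hθ⟩ := hs
  obtain ⟨ε, hε, H⟩ := θ.exists_add_pos ψ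
  refine ⟨ε, hε, fun s hsε i j => ?_⟩
  refine pshOn_add_of_dominates θ ((F.isOpen_dom i).inter (A.isOpen_U j))
    (fun a => (hθ i a).mono fun x hx => ⟨hx.1.1, hx.2⟩) fun a x hx => ?_
  exact (H s hsε a j x ⟨hx.2, hx.1.2⟩).supportedAt
    ((θ.smoothAt hx.2).add (contMDiffAt_const.mul (ψ.smoothAt hx.1.2)))

theorem ereal_add_coe_ne_bot {u : EReal} (hu : u ≠ ⊥) (a : ℝ) : u + (a : EReal) ≠ ⊥ := by
  rw [EReal.add_ne_bot_iff]
  exact ⟨hu, EReal.coe_ne_bot a⟩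

end Twist

section Positive

variable {E : Type} [NormedAddCommGroup E] [NormedSpace ℂ E] {X : Type*} [TopologicalSpace X]
  [ChartedSpace E X] [IsManifold 𝓘(ℂ, E) ω X] {L : HolLineBundle E X} {p : X}

/-- If `p` is in the ample locus of `L`, then `π^*L - δ E` is pseudoeffective for small `δ`: the
curvature of a strictly positive metric absorbs the negative part of the curvature of `-δ E`. -/
theorem exists_pseudoeffective [FiniteDimensional ℂ E] [Nontrivial E] [CompactSpace X]
    {B : HolLineBundle E X} {κ : Type*} [Fintype κ] {s : κ → B.PowSection 1} (hs : B.EmbedsBy s)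
    {h : (of L).SingPosMetric} (hh : h.IsStrictlyPositive) (hp : h.IsSmoothNear p) :
    ∃ δ > 0, (blowMinus L p δ).IsPseudoeffective := by
  obtain ⟨-, σ, η, hσ, hση⟩ := Blowup.exists_metrics hs p
  set α := fsMetric s hs.base_point_free with hα
  -- `h - δ η = (h - 2 δ α) + δ σ`, and both summands are plurisubharmonic if `2 δ < ε`
  obtain ⟨ε, hε, H⟩ := hh.exists_psh_add α
  set δ := ε / 4 with hδ
  have hδ0 : 0 < δ := by positivity
  have hH := H (-(2 * δ)) (by rw [abs_neg, abs_of_pos (by positivity)]; linarith)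
  set D : HolLineBundle E (Blowup E p) :=
    L.pullback (Blowup.down : Blowup E p → X) Blowup.contMDiff_down with hD
  set H' : (of D).SingPosMetric := h.transfer (of D) Blowup.down Blowup.contMDiff_down
    (fun i => ofTriv (ofIdx i)) (fun i x hx => mem_dom_of.2 ((mem_dom_of (L := D)).1 hx))
    (fun i j x hx => by rw [logTrans_of, logTrans_of]; rfl) with hH'
  have hpsh : ∀ (i : (of D).Triv) (o : Option (AffDir E)), PSHOn E
      (fun b => H'.φ i b + ((-δ * η.ψ o b : ℝ) : EReal)) ((of D).dom i ∩ Blowup.excDom E p o) := by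
    intro i o
    have hO : IsOpen ((of D).dom i ∩ Blowup.excDom E p o) :=
      ((of D).isOpen_dom i).inter ((Blowup.excBundle E p).isOpen_U o)
    have hV : ∀ j, IsOpen ((Blowup.down : Blowup E p → X) ⁻¹' B.U j) := fun j =>
      (B.isOpen_U j).preimage Blowup.contMDiff_down.continuous
    refine PSHOn.of_cover hO hV (by rw [← preimage_iUnion, B.iUnion_U, preimage_univ]) fun j => ?_
    have hO' := hO.inter (hV j)
    have h1 : PSHOn E (fun b : Blowup E p => h.φ (ofTriv (ofIdx i)) (Blowup.down b) +
        ((-(2 * δ) * α.ψ j (Blowup.down b) : ℝ) : EReal)) ((of D).dom i ∩ Blowup.excDom E p o ∩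
          Blowup.down ⁻¹' B.U j) :=
      (hH (ofTriv (ofIdx i)) j).comp (((of L).isOpen_dom _).inter (B.isOpen_U j)) hO'
        Blowup.contMDiff_down.contMDiffOn fun b hb =>
          ⟨mem_dom_of.2 ((mem_dom_of (L := D)).1 hb.1.1), hb.2⟩
    refine (h1.add_supported (f := fun b => δ * σ.ψ (j, (j, o)) b) hO' fun b hb => ?_).congr hO'
      fun b hb => ?_
    · have hb' : b ∈ (Blowup.blowBundle p B).U (j, (j, o)) := ⟨hb.2, hb.2, hb.1.2⟩
      exact ((hσ _ b hb').supportedAt (σ.smoothAt hb')).const_mul hδ0.le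
    · change _ + _ + _ = h.φ (ofTriv (ofIdx i)) (Blowup.down b) + _
      rw [hση j j o b hb.2 hb.2 hb.1.2, add_assoc, ← EReal.coe_add]
      congr 2
      ring
  obtain ⟨v, hv⟩ := exists_ne (0 : E)
  obtain ⟨i, hi⟩ := (blowMinus L p δ).exists_mem_dom (.exc (Projectivization.mk ℂ v hv))
  refine ⟨δ, hδ0, H'.twist η δ hpsh, i, _, hi, ereal_add_coe_ne_bot ?_ _⟩
  exact SingPosMetric.ne_bot_of_isSmoothNear hp
    (mem_dom_of.2 ((mem_dom_of (L := D)).1 (mem_dom_sub.1 hi).1))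

end Positive

/-! ### Trivializations of `totalBundle` -/

section Trivializations

variable {E : Type} [NormedAddCommGroup E] [NormedSpace ℂ E] {X : Type*} [TopologicalSpace X]
  [ChartedSpace E X] [IsManifold 𝓘(ℂ, E) ω X] {L : HolLineBundle E X} {p : X}

variable (E p) in
/-- The line bundle of the exceptional divisor of the blowup of `X × ℙ¹`. -/
noncomputable abbrev totalExc : HolLineBundle (E × ℂ) (TotalSpace E p) :=
  Blowup.excBundle (E × ℂ) ((p, ProjLine.zero) : X × ProjLine)

/-- The trivialization of `L` in a trivialization of `totalBundle L p`. -/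
noncomputable def totL (I : (totalBundle L p).Triv) : L.ι :=
  ofIdx (L := L.pullback Prod.fst contMDiff_prFst) (addFst (F := of (L.pullback Prod.fst
    contMDiff_prFst)) (G := (cMax L p + 1) • of (hyperplanePullback E X))
    (subFst (F := (baseBundle L p).pullback Blowup.down Blowup.contMDiff_down)
      (G := cMax L p • of (totalExc E p)) I))

/-- The homogeneous coordinate in a trivialization of `totalBundle L p`. -/
noncomputable def totP (I : (totalBundle L p).Triv) : Bool :=
  ofIdx (L := hyperplanePullback E X) (addSnd (F := of (L.pullback Prod.fst
    contMDiff_prFst)) (G := (cMax L p + 1) • of (hyperplanePullback E X))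
    (subFst (F := (baseBundle L p).pullback Blowup.down Blowup.contMDiff_down)
      (G := cMax L p • of (totalExc E p)) I))

/-- The local equation of the exceptional divisor in a trivialization of `totalBundle L p`. -/
noncomputable def totE (I : (totalBundle L p).Triv) : Option (AffDir (E × ℂ)) :=
  ofIdx (L := totalExc E p) (smulTriv (F := of (totalExc E p))
    (subSnd (F := (baseBundle L p).pullback Blowup.down Blowup.contMDiff_down)
      (G := cMax L p • of (totalExc E p)) I))

/-- A trivialization of `totalBundle L p` consists of trivializations of `L`, `𝒪(1)` and `𝓔`. -/
theorem mem_dom_total {I : (totalBundle L p).Triv} {b : TotalSpace E p} :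
    b ∈ (totalBundle L p).dom I ↔ (Blowup.down b).1 ∈ L.U (totL I) ∧
      ProjLine.hom (Blowup.down b).2 (totP I) ≠ 0 ∧ b ∈ Blowup.excDom (E × ℂ) _ (totE I) := by
  refine (mem_dom_sub (F := (baseBundle L p).pullback Blowup.down Blowup.contMDiff_down)
    (G := cMax L p • of (totalExc E p)) (i := I)).trans ?_
  have h1 : ∀ (i : (baseBundle L p).Triv) (z : X × ProjLine), z ∈ (baseBundle L p).dom i ↔
      z.1 ∈ L.U (i (.inl ())) ∧ ProjLine.hom z.2 (i (.inr ())) ≠ 0 := fun i z =>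
    (mem_dom_add (F := of (L.pullback Prod.fst contMDiff_prFst))
      (G := (cMax L p + 1) • of (hyperplanePullback E X))).trans
      (and_congr mem_dom_of (mem_dom_of (L := hyperplanePullback E X)))
  refine (and_congr (mem_dom_pullback (F := baseBundle L p) (hf := Blowup.contMDiff_down))
    (mem_dom_of (L := totalExc E p))).trans ?_
  exact (and_congr (h1 _ _) Iff.rfl).trans and_assoc

theorem logTrans_total (I J : (totalBundle L p).Triv) (b : TotalSpace E p) :
    (totalBundle L p).logTrans I J b = Real.log (‖L.g (totL I) (totL J) (Blowup.down b).1‖ ^ 2) +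
      (cMax L p + 1) * Real.log (‖hyperplaneBundle.g (totP I) (totP J) (Blowup.down b).2‖ ^ 2) -
      cMax L p * Real.log (‖(totalExc E p).g (totE I) (totE J) b‖ ^ 2) := by
  refine (logTrans_sub (F := (baseBundle L p).pullback Blowup.down Blowup.contMDiff_down)
    (G := cMax L p • of (totalExc E p)) I J b).trans (congrArg₂ (· - ·) ?_ ?_)
  · refine (logTrans_add (F := of (L.pullback Prod.fst contMDiff_prFst))
      (G := (cMax L p + 1) • of (hyperplanePullback E X)) _ _ (Blowup.down b)).trans
      (congrArg₂ (· + ·) (logTrans_of _ _ _) ?_)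
    exact (logTrans_smul (F := of (hyperplanePullback E X)) _ _ _).trans
      (congrArg _ (logTrans_of _ _ _))
  · exact (logTrans_smul (F := of (totalExc E p)) _ _ _).trans (congrArg _ (logTrans_of _ _ _))

variable (L p) in
/-- The trivialization of `totalBundle L p` with given components. -/
noncomputable def totTriv (j : L.ι) (β : Bool) (o : Option (AffDir (E × ℂ))) : (totalBundle L p).Triv :=
  subTriv (F := (baseBundle L p).pullback Blowup.down Blowup.contMDiff_down)
    (G := cMax L p • of (totalExc E p))
    (fun k => match k with
      | .inl _ => j
      | .inr _ => β)
    (ofTriv (L := totalExc E p) o)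

end Trivializations

/-! ### The weights of a metric of `totalBundle` -/

section TotalMetric

variable {E : Type} [NormedAddCommGroup E] [NormedSpace ℂ E] {X : Type*} [TopologicalSpace X]
  [ChartedSpace E X] [IsManifold 𝓘(ℂ, E) ω X] {L : HolLineBundle E X} {p : X}

/-- The Fubini–Study metric of the projective line. -/
noncomputable abbrev lineMetric : SmoothMetric hyperplaneBundle :=
  fsMetric homSection hyperplaneBundle_embedsBy.base_point_free

/-- The metric of `B ⊠ 𝒪(1)` defined by the products of sections is the product metric. -/
theorem prodMetric_ψ {B : HolLineBundle E X} {κ : Type*} [Fintype κ] {s : κ → B.PowSection 1}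
    (hs : B.EmbedsBy s) {j : B.ι} {β : Bool} {z : X × ProjLine} (hj : z.1 ∈ B.U j)
    (hβ : ProjLine.hom z.2 β ≠ 0) :
    (fsMetric (prodSection s) (prodBundle_embedsBy hs).base_point_free).ψ (j, β) z =
      (fsMetric s hs.base_point_free).ψ j z.1 + lineMetric.ψ β z.2 := by
  refine (fsMetric_ψ (prodSection s) _ (j, β) z).trans (Eq.trans ?_
    (congrArg₂ (· + ·) (fsMetric_ψ s _ j z.1) (fsMetric_ψ homSection _ β z.2)).symm)
  obtain ⟨a, ha⟩ := hs.base_point_free j z.1 hj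
  obtain ⟨c, hc⟩ := hyperplaneBundle_embedsBy.base_point_free β z.2 hβ
  exact log_sumSq_mul (u := fun a => (s a).s j z.1) (v := fun c => (homSection c).s β z.2)
    (Function.ne_iff.2 ⟨a, ha⟩) (Function.ne_iff.2 ⟨c, hc⟩)

/-- The smooth part of the weights of the metric of `totalBundle L p`. -/
noncomputable def totalWeight (η : SmoothMetric (totalExc E p)) (δ : ℝ)
    (I : (totalBundle L p).Triv) (b : TotalSpace E p) : ℝ :=
  (1 + δ) * lineMetric.ψ (totP I) (Blowup.down b).2 - δ * η.ψ (totE I) b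

/-- The weights of the metric of `totalBundle L p`: a strictly positive metric of `L`, a metric of
`(1 + δ) 𝒪(1) - δ 𝓔`, and the multiple `C_max - δ` of the divisor `X̃` of `𝒪(1) - 𝓔`. -/
noncomputable def totalPhi (h : (of L).SingPosMetric) (η : SmoothMetric (totalExc E p)) (δ : ℝ)
    (I : (totalBundle L p).Triv) : TotalSpace E p → EReal :=
  addLogSq (fun b => h.φ (ofTriv (totL I)) (Blowup.down b).1 + (totalWeight η δ I b : EReal))
    (cMax L p - δ) ((stSection E p).s (totP I, totE I))

theorem mem_st_U {I : (totalBundle L p).Triv} {b : TotalSpace E p}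
    (hb : b ∈ (totalBundle L p).dom I) : b ∈ (Blowup.quotBundle ((p, ProjLine.zero) : X × ProjLine)
      (hyperplanePullback E X)).U (totP I, totE I) :=
  ⟨(mem_dom_total.1 hb).2.1, (mem_dom_total.1 hb).2.2⟩

theorem ereal_add_add_congr (u : EReal) {a b c d : ℝ} (h : a + b = c + d) :
    u + (a : EReal) + (b : EReal) = u + (c : EReal) + (d : EReal) := by
  rw [add_assoc, add_assoc, ← EReal.coe_add, ← EReal.coe_add, h]

theorem addLogSq_add {M : Type*} (u : M → EReal) (c : ℝ) (w : M → ℂ) (x : M) (a : ℝ) :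
    addLogSq u c w x + (a : EReal) = addLogSq (fun y => u y + (a : EReal)) c w x := by
  unfold addLogSq
  split_ifs
  · exact EReal.bot_add _
  · rw [add_assoc, add_assoc, add_comm (a : EReal)]

/-- The weights transform as required: `(1 + δ) + (C_max - δ) = C_max + 1` for `𝒪(1)` and
`δ + (C_max - δ) = C_max` for `𝓔`. -/
theorem totalPhi_trans (h : (of L).SingPosMetric) (η : SmoothMetric (totalExc E p)) (δ : ℝ)
    (I J : (totalBundle L p).Triv) {b : TotalSpace E p} (hI : b ∈ (totalBundle L p).dom I)
    (hJ : b ∈ (totalBundle L p).dom J) :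
    totalPhi h η δ I b = totalPhi h η δ J b + ((totalBundle L p).logTrans I J b : EReal) := by
  have hIm := mem_dom_total.1 hI
  have hJm := mem_dom_total.1 hJ
  have hst := (stSection E p).trans _ _ b ⟨mem_st_U hI, mem_st_U hJ⟩
  have hg := (Blowup.quotBundle ((p, ProjLine.zero) : X × ProjLine)
    (hyperplanePullback E X)).g_ne_zero _ _ b ⟨mem_st_U hI, mem_st_U hJ⟩
  rw [pow_one] at hst
  unfold totalPhi addLogSq
  by_cases h0 : (stSection E p).s (totP J, totE J) b = 0
  · rw [if_pos h0, if_pos (by rw [hst, h0, mul_zero]), EReal.bot_add]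
  have hlog : Real.log (‖(stSection E p).s (totP I, totE I) b‖ ^ 2) =
      Real.log (‖hyperplaneBundle.g (totP I) (totP J) (Blowup.down b).2‖ ^ 2) -
        Real.log (‖(totalExc E p).g (totE I) (totE J) b‖ ^ 2) +
        Real.log (‖(stSection E p).s (totP J, totE J) b‖ ^ 2) := by
    have hg' : (Blowup.quotBundle ((p, ProjLine.zero) : X × ProjLine)
        (hyperplanePullback E X)).g (totP I, totE I) (totP J, totE J) b =
        hyperplaneBundle.g (totP I) (totP J) (Blowup.down b).2 *
          ((totalExc E p).g (totE I) (totE J) b)⁻¹ := rfl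
    rw [hst, hg']
    have h1 := hyperplaneBundle.g_ne_zero (totP I) (totP J) (Blowup.down b).2 ⟨hIm.2.1, hJm.2.1⟩
    have h2 := (totalExc E p).g_ne_zero (totE I) (totE J) b ⟨hIm.2.2, hJm.2.2⟩
    rw [norm_mul, mul_pow, Real.log_mul (by simpa using ⟨h1, h2⟩) (by simpa using h0), norm_mul,
      mul_pow, Real.log_mul (by simpa using h1) (by simpa using h2), norm_inv, inv_pow,
      Real.log_inv]
    ring
  rw [if_neg h0, if_neg (by rw [hst]; exact mul_ne_zero hg h0),
    logTrans_total, hlog]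
  beta_reduce
  rw [h.trans (ofTriv (totL I)) (ofTriv (totL J)) (Blowup.down b).1
    ⟨mem_dom_of.2 hIm.1, mem_dom_of.2 hJm.1⟩, logTrans_of]
  have h3 := lineMetric.trans (totP I) (totP J) (Blowup.down b).2 ⟨hIm.2.1, hJm.2.1⟩
  have h4 := η.trans (totE I) (totE J) b ⟨hIm.2.2, hJm.2.2⟩
  have h5 : ∀ (u : EReal) (a₁ a₂ a₃ a₄ a₅ a₆ : ℝ), a₁ + a₂ + a₃ = a₄ + a₅ + a₆ →
      u + (a₁ : EReal) + (a₂ : EReal) + (a₃ : EReal) =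
      u + (a₄ : EReal) + (a₅ : EReal) + (a₆ : EReal) := by
    intro u a₁ a₂ a₃ a₄ a₅ a₆ h
    rw [add_assoc, add_assoc, ← EReal.coe_add, ← EReal.coe_add, add_assoc, add_assoc,
      ← EReal.coe_add, ← EReal.coe_add, ← add_assoc, h, ← add_assoc]
  refine h5 _ _ _ _ _ _ _ ?_
  unfold totalWeight
  rw [h3, h4]
  change Real.log (‖L.g (totL I) (totL J) (Blowup.down b).1‖ ^ 2) + _ + _ = _
  ring

/-- The metric of `totalBundle L p` dominates the metric `σ` of an ample line bundle. -/
theorem totalPhi_psh_sub {B : HolLineBundle E X} {κ : Type*} [Fintype κ]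
    {s : κ → B.PowSection 1} (hs : B.EmbedsBy s) {h : (of L).SingPosMetric} {δ : ℝ}
    (hδ1 : δ ≤ 1) (hδC : δ < cMax L p)
    (hh : ∀ i j, PSHOn E (fun x => h.φ i x +
      ((-(2 * δ) * (fsMetric s hs.base_point_free).ψ j x : ℝ) : EReal)) ((of L).dom i ∩ B.U j))
    {σ : SmoothMetric (Blowup.blowBundle ((p, ProjLine.zero) : X × ProjLine) (prodBundle B))}
    {η : SmoothMetric (totalExc E p)}
    (hση : ∀ j j' o (b : TotalSpace E p), Blowup.down b ∈ (prodBundle B).U j →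
      Blowup.down b ∈ (prodBundle B).U j' → b ∈ Blowup.excDom (E × ℂ) _ o → σ.ψ (j, (j', o)) b =
        (fsMetric (prodSection s) (prodBundle_embedsBy hs).base_point_free).ψ j (Blowup.down b) +
        (fsMetric (prodSection s) (prodBundle_embedsBy hs).base_point_free).ψ j' (Blowup.down b) -
        η.ψ o b) (I : (totalBundle L p).Triv)
    (k : (Blowup.blowBundle ((p, ProjLine.zero) : X × ProjLine) (prodBundle B)).ι) :
    PSHOn (E × ℂ) (fun b => totalPhi h η δ I b + ((-δ * σ.ψ k b : ℝ) : EReal))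
      ((totalBundle L p).dom I ∩ (Blowup.blowBundle _ (prodBundle B)).U k) := by
  obtain ⟨⟨j, β⟩, ⟨⟨j', β'⟩, o⟩⟩ := k
  set α := fsMetric s hs.base_point_free with hα
  set O := (totalBundle L p).dom I ∩ (Blowup.blowBundle ((p, ProjLine.zero) : X × ProjLine)
    (prodBundle B)).U ((j, β), ((j', β'), o)) with hO'
  have hO : IsOpen O := ((totalBundle L p).isOpen_dom I).inter (HolLineBundle.isOpen_U _ _)
  have hmem : ∀ b ∈ O, (Blowup.down b).1 ∈ L.U (totL I) ∧
      ProjLine.hom (Blowup.down b).2 (totP I) ≠ 0 ∧ b ∈ Blowup.excDom (E × ℂ) _ (totE I) ∧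
      (Blowup.down b).1 ∈ B.U j ∧ ProjLine.hom (Blowup.down b).2 β ≠ 0 ∧
      (Blowup.down b).1 ∈ B.U j' ∧ ProjLine.hom (Blowup.down b).2 β' ≠ 0 ∧
      b ∈ Blowup.excDom (E × ℂ) _ o := fun b hb =>
    ⟨(mem_dom_total.1 hb.1).1, (mem_dom_total.1 hb.1).2.1, (mem_dom_total.1 hb.1).2.2,
      hb.2.1.1, hb.2.1.2, hb.2.2.1.1, hb.2.2.1.2, hb.2.2.2⟩
  have hF1 : ContMDiff 𝓘(ℂ, E × ℂ) 𝓘(ℂ, E) ω (fun b : TotalSpace E p => (Blowup.down b).1) :=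
    contMDiff_prFst.comp Blowup.contMDiff_down
  have hF2 : ContMDiff 𝓘(ℂ, E × ℂ) 𝓘(ℂ, ℂ) ω (fun b : TotalSpace E p => (Blowup.down b).2) :=
    contMDiff_prSnd.comp Blowup.contMDiff_down
  have h1 : PSHOn (E × ℂ) (fun b : TotalSpace E p => h.φ (ofTriv (totL I)) (Blowup.down b).1 +
      ((-(2 * δ) * α.ψ j (Blowup.down b).1 : ℝ) : EReal)) O :=
    (hh (ofTriv (totL I)) j).comp (((of L).isOpen_dom _).inter (B.isOpen_U j)) hO hF1.contMDiffOn
      fun b hb => ⟨mem_dom_of.2 (hmem b hb).1, (hmem b hb).2.2.2.1⟩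
  -- Up to changes of trivialization, the smooth part of the weight minus `δ σ` is `-2 δ α` plus
  -- `(1 - δ)` times the Fubini–Study metric of the projective line.
  have h2 := h1.add_supported (f := fun b : TotalSpace E p =>
      δ * (α.ψ j (Blowup.down b).1 - α.ψ j' (Blowup.down b).1) +
      (1 - δ) * lineMetric.ψ (totP I) (Blowup.down b).2 +
      δ * (lineMetric.ψ (totP I) (Blowup.down b).2 - lineMetric.ψ β (Blowup.down b).2) +
      δ * (lineMetric.ψ (totP I) (Blowup.down b).2 - lineMetric.ψ β' (Blowup.down b).2) +
      δ * (η.ψ o b - η.ψ (totE I) b)) hO fun b hb => by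
    obtain ⟨m1, m2, m3, m4, m5, m6, m7, m8⟩ := hmem b hb
    have hpos := HolLineBundle.sectionMetric_isPositive hyperplaneBundle_embedsBy one_pos
    have e1 := SupportedAt.comp (x := b) (α.supportedAt_sub m4 m6 δ) hF1.contMDiffAt
    have e2 := SupportedAt.comp (x := b) (((hpos (totP I) _ m2).supportedAt
      (lineMetric.smoothAt m2)).const_mul (sub_nonneg.2 hδ1)) hF2.contMDiffAt
    have e3 := SupportedAt.comp (x := b) (lineMetric.supportedAt_sub m2 m5 δ) hF2.contMDiffAt
    have e4 := SupportedAt.comp (x := b) (lineMetric.supportedAt_sub m2 m7 δ) hF2.contMDiffAt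
    exact (((e1.add e2).add e3).add e4).add (η.supportedAt_sub m8 m3 δ)
  refine (h2.addLogSq hO (((stSection E p).hol (totP I, totE I)).mono fun b hb =>
    mem_st_U hb.1) (sub_pos.2 hδC)).congr hO fun b hb => ?_
  obtain ⟨m1, m2, m3, m4, m5, m6, m7, m8⟩ := hmem b hb
  unfold totalPhi
  rw [addLogSq_add]
  unfold addLogSq
  refine congrArg (ite _ _) (congrArg (· + _) ?_)
  beta_reduce
  refine ereal_add_add_congr _ ?_
  have e1 := hση (j, β) (j', β') o b ⟨m4, m5⟩ ⟨m6, m7⟩ m8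
  have e2 := prodMetric_ψ hs m4 m5
  have e3 := prodMetric_ψ hs m6 m7
  unfold totalWeight
  linear_combination δ * e1 + δ * e2 + δ * e3

end TotalMetric

/-! ### The ample locus of `totalBundle` -/

section AmpleLocus

variable {E : Type} [NormedAddCommGroup E] [NormedSpace ℂ E] {X : Type*} [TopologicalSpace X]
  [ChartedSpace E X] [IsManifold 𝓘(ℂ, E) ω X] {L : HolLineBundle E X} {p : X}

/-- The weights are smooth away from the zeros of the section, where the metric of `L` is smooth. -/
theorem totalPhi_smooth {h : (of L).SingPosMetric} (η : SmoothMetric (totalExc E p)) (δ : ℝ)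
    {W : Set (TotalSpace E p)} (hW : ∀ b ∈ W, b ∉ range (stMap E p)) (I : (totalBundle L p).Triv)
    {V : Set X} (hV : IsOpen V) (hWV : ∀ b ∈ W, (Blowup.down b).1 ∈ V) {f : X → ℝ}
    (hf : ContMDiffOn 𝓘(ℝ, E) 𝓘(ℝ, ℝ) ∞ f (V ∩ (of L).dom (ofTriv (totL I))))
    (hhf : ∀ y ∈ V ∩ (of L).dom (ofTriv (totL I)), h.φ (ofTriv (totL I)) y = f y) :
    ∃ g : TotalSpace E p → ℝ,
      ContMDiffOn 𝓘(ℝ, E × ℂ) 𝓘(ℝ, ℝ) ∞ g (W ∩ (totalBundle L p).dom I) ∧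
      ∀ y ∈ W ∩ (totalBundle L p).dom I, totalPhi h η δ I y = g y := by
  have hmem : ∀ b ∈ W ∩ (totalBundle L p).dom I,
      (Blowup.down b).1 ∈ V ∩ (of L).dom (ofTriv (totL I)) := fun b hb =>
    ⟨hWV b hb.1, mem_dom_of.2 (mem_dom_total.1 hb.2).1⟩
  have hst : ∀ b ∈ W ∩ (totalBundle L p).dom I, (stSection E p).s (totP I, totE I) b ≠ 0 :=
    fun b hb => mt (stSection_eq_zero_iff (mem_dom_total.1 hb.2).2.1
      (mem_dom_total.1 hb.2).2.2).1 (hW b hb.1)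
  refine ⟨fun b => f (Blowup.down b).1 + totalWeight η δ I b +
    (cMax L p - δ) * Real.log (‖(stSection E p).s (totP I, totE I) b‖ ^ 2), fun b hb => ?_,
    fun b hb => ?_⟩
  · have m := mem_dom_total.1 hb.2
    have hF1 : ContMDiffAt 𝓘(ℝ, E × ℂ) 𝓘(ℝ, E) ∞ (fun b : TotalSpace E p => (Blowup.down b).1) b :=
      contMDiffAt_real (contMDiff_prFst.comp Blowup.contMDiff_down).contMDiffAt
    have hF2 : ContMDiffAt 𝓘(ℝ, E × ℂ) 𝓘(ℝ, ℂ) ∞ (fun b : TotalSpace E p => (Blowup.down b).2) b :=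
      contMDiffAt_real (contMDiff_prSnd.comp Blowup.contMDiff_down).contMDiffAt
    have h1 : ContMDiffAt 𝓘(ℝ, E × ℂ) 𝓘(ℝ, ℝ) ∞
        (fun b : TotalSpace E p => f (Blowup.down b).1) b :=
      (hf.contMDiffAt ((hV.inter ((of L).isOpen_dom _)).mem_nhds (hmem b hb))).comp b hF1
    have h2 : ContMDiffAt 𝓘(ℝ, E × ℂ) 𝓘(ℝ, ℝ) ∞
        (fun b : TotalSpace E p => lineMetric.ψ (totP I) (Blowup.down b).2) b :=
      (lineMetric.smoothAt m.2.1).comp b hF2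
    have h3 := η.smoothAt (i := totE I) m.2.2
    have h4 := contMDiffAt_real ((stSection E p).holAt (mem_st_U hb.2))
    have h5 : ContMDiffAt 𝓘(ℝ, E × ℂ) 𝓘(ℝ, ℝ) ∞ (fun b : TotalSpace E p =>
        Real.log (‖(stSection E p).s (totP I, totE I) b‖ ^ 2)) b := by
      have h6 : ContDiffAt ℝ ∞ (fun z : ℂ => Real.log (‖z‖ ^ 2))
          ((stSection E p).s (totP I, totE I) b) :=
        ((contDiff_norm_sq ℝ).contDiffAt).log (by simpa using hst b hb)
      exact h6.contMDiffAt.comp b h4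
    exact ((h1.add ((contMDiffAt_const.mul h2).sub (contMDiffAt_const.mul h3))).add
      (contMDiffAt_const.mul h5)).contMDiffWithinAt
  · unfold totalPhi addLogSq
    rw [if_neg (hst b hb), EReal.coe_add, EReal.coe_add, ← hhf _ (hmem b hb)]

/-- A strictly positive metric of `L` induces a strictly positive metric of `totalBundle L p`, which
is smooth away from `X̃` and the points over which the given metric is not smooth. -/
theorem exists_total_metric [FiniteDimensional ℂ E] [CompactSpace X]
    {B : HolLineBundle E X} {κ : Type*} [Fintype κ] {s : κ → B.PowSection 1} (hs : B.EmbedsBy s)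
    (hC : 0 < cMax L p) {h : (of L).SingPosMetric} (hh : h.IsStrictlyPositive) :
    ∃ H : (totalBundle L p).SingPosMetric, H.IsStrictlyPositive ∧
      (∀ b ∉ range (stMap E p), h.IsSmoothNear (Blowup.down b).1 → H.IsSmoothNear b) ∧
      ∃ A : HolLineBundle (E × ℂ) (TotalSpace E p), A.IsAmple ∧ ∃ (σ : SmoothMetric A) (δ : ℝ),
        0 < δ ∧ ∀ I k, PSHOn (E × ℂ) (fun b => H.φ I b + ((-δ * σ.ψ k b : ℝ) : EReal))
          ((totalBundle L p).dom I ∩ A.U k) := by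
  obtain ⟨hA, σ, η, hσ, hση⟩ := Blowup.exists_metrics (prodBundle_embedsBy hs)
    ((p, ProjLine.zero) : X × ProjLine)
  obtain ⟨ε, hε, hpert⟩ := hh.exists_psh_add (fsMetric s hs.base_point_free)
  -- `δ ≤ 1` and `δ < C_max` keep the coefficients nonnegative; `2 δ < ε` keeps `h - 2 δ α`
  -- plurisubharmonic
  obtain ⟨δ, hδ0, hδ⟩ := exists_between (show (0 : ℝ) < min (min 1 (cMax L p)) (ε / 2) from
    lt_min (lt_min one_pos hC) (half_pos hε))
  have hδ1 : δ < 1 := hδ.trans_le ((min_le_left _ _).trans (min_le_left _ _))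
  have hδC : δ < cMax L p := hδ.trans_le ((min_le_left _ _).trans (min_le_right _ _))
  have hδε : δ < ε / 2 := hδ.trans_le (min_le_right _ _)
  have key := totalPhi_psh_sub hs hδ1.le hδC
    (hpert (-(2 * δ)) (by rw [abs_neg, abs_of_pos (by positivity)]; linarith)) hση
  have hpsh : ∀ I, PSHOn (E × ℂ) (totalPhi h η δ I) ((totalBundle L p).dom I) := by
    intro I
    have hO := (totalBundle L p).isOpen_dom I
    refine PSHOn.of_cover hO (Blowup.blowBundle ((p, ProjLine.zero) : X × ProjLine)
      (prodBundle B)).isOpen_U (HolLineBundle.iUnion_U _) fun k => ?_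
    have hO' := hO.inter (HolLineBundle.isOpen_U _ k)
    refine ((key I k).add_supported (f := fun b => δ * σ.ψ k b) hO' fun b hb =>
      ((hσ k b hb.2).supportedAt (σ.smoothAt hb.2)).const_mul hδ0.le).congr hO' fun b _ => ?_
    rw [add_assoc, ← EReal.coe_add, neg_mul, neg_add_cancel, EReal.coe_zero, add_zero]
  refine ⟨⟨totalPhi h η δ, hpsh, fun I J b hb => totalPhi_trans h η δ I J hb.1 hb.2⟩,
    ⟨σ.toKahler hσ δ hδ0, fun I k => ?_⟩, fun b hb hsm => ?_, _, hA, σ, δ, hδ0, key⟩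
  · refine (key I k).congr ((RLineBundle.isOpen_dom _ I).inter (HolLineBundle.isOpen_U _ k))
      fun b _ => ?_
    change _ = totalPhi h η δ I b - ((δ * σ.ψ k b : ℝ) : EReal)
    rw [sub_eq_add_neg, ← EReal.coe_neg, neg_mul]
  · obtain ⟨V, hV, hbV, H⟩ := hsm
    have hcl : IsClosed (range (stMap E p)) := by
      rw [← fiberTransform_eq]
      exact isClosed_closure
    have hF1 : Continuous fun b : TotalSpace E p => (Blowup.down b).1 :=
      (contMDiff_prFst.comp Blowup.contMDiff_down).continuous
    refine ⟨(range (stMap E p))ᶜ ∩ (fun b => (Blowup.down b).1) ⁻¹' V,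
      hcl.isOpen_compl.inter (hV.preimage hF1), ⟨hb, hbV⟩, fun I => ?_⟩
    obtain ⟨f, hf, hhf⟩ := H (ofTriv (totL I))
    exact totalPhi_smooth η δ (fun b hb => hb.1) I hV (fun b hb => hb.2) hf hhf

/-- The points over `X × (ℙ¹ ∖ {0})` in the ample locus lie over the ample locus of `L`, by
restriction to the fiber `X × {τ}`. -/
theorem fst_mem_ampleLocus {x : X} {τ : ProjLine} (hτ : τ ≠ ProjLine.zero)
    (hx : fiberMap E p hτ x ∈ (totalBundle L p).ampleLocus) : x ∈ (of L).ampleLocus := by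
  obtain ⟨H, hH, hsm⟩ := hx
  obtain ⟨β, hβ⟩ := hyperplaneBundle.exists_mem τ
  refine ⟨H.transfer (of L) (fiberMap E p hτ) (contMDiff_fiberMap hτ)
    (fun i => totTriv L p (ofIdx i) β none) (fun i x hx => ?_) (fun i j x hx => ?_),
    SingPosMetric.transfer_isStrictlyPositive hH _ (injective_mfderiv_fiberMap hτ),
    SingPosMetric.transfer_isSmoothNear hsm _⟩
  · exact mem_dom_total.2 ⟨mem_dom_of.1 hx, hβ, mk_ne_center hτ x⟩
  · rw [logTrans_of, logTrans_total]
    have h1 : hyperplaneBundle.g β β τ = 1 := hyperplaneBundle.g_self hβ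
    have h2 : (totalExc E p).g none none (fiberMap E p hτ x) = 1 :=
      (totalExc E p).g_self (i := (none : Option (AffDir (E × ℂ)))) (mk_ne_center hτ x)
    have h3 : (cMax L p + 1) * Real.log (‖hyperplaneBundle.g β β τ‖ ^ 2) = 0 := by
      rw [h1]; simp
    have h4 : cMax L p * Real.log (‖(totalExc E p).g none none (fiberMap E p hτ x)‖ ^ 2) = 0 := by
      rw [h2]; simp
    exact ((congrArg₂ (fun a b => Real.log (‖L.g (ofIdx i) (ofIdx j) x‖ ^ 2) + a - b) h3 h4).trans
      (by ring)).symm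

omit [IsManifold 𝓘(ℂ, E) ω X] in
/-- The local equations of the exceptional divisors correspond to each other. -/
theorem excFactor_stMap (b : Blowup E p) : ∃ k : ℂ, k ≠ 0 ∧ ∀ o, b ∈ Blowup.excDom E p o →
    stMap E p b ∈ Blowup.excDom (E × ℂ) (p, ProjLine.zero) (o.map AffDir.prodZero) ∧
    Blowup.excFactor (stMap E p b) (o.map AffDir.prodZero) = k * Blowup.excFactor b o := by
  obtain ⟨k, hk, hk1, hd⟩ := dir_stMap b
  refine ⟨k, hk, fun o ho => ?_⟩
  cases o with
  | none =>
    have ho : Blowup.down b ≠ p := ho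
    refine ⟨?_, ?_⟩
    · change Blowup.down (stMap E p b) ≠ _
      rw [down_stMap]
      exact fun h => ho (Prod.mk.inj h).1
    · rw [hk1 ho]
      exact (one_mul _).symm
  | some a =>
    refine ⟨mem_excDom_stMap ho, ?_⟩
    change a.prodZero.f (Blowup.dir (stMap E p b)) = k * a.f (Blowup.dir b)
    rw [hd, AffDir.prodZero_f, Prod.smul_fst, map_smul, smul_eq_mul]

/-- The restriction of `totalBundle L p` to `X̃` is `π^*L - C_max E`. A strictly positive metric which
is finite at a point of `X̃` would make `π^*L - (C_max + ε) E` pseudoeffective. -/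
theorem stMap_not_mem_ampleLocus [FiniteDimensional ℂ E] [Nontrivial E] [CompactSpace X] [T2Space X]
    [PreconnectedSpace X] {B : HolLineBundle E X} {κ : Type*} [Fintype κ] {s : κ → B.PowSection 1}
    (hs : B.EmbedsBy s) (b : Blowup E p) : stMap E p b ∉ (totalBundle L p).ampleLocus := by
  rintro ⟨H, hH, hsm⟩
  have := Blowup.compactSpace (E := E) (q := p)
  obtain ⟨-, σ, η, -, -⟩ := Blowup.exists_metrics hs p
  set D : HolLineBundle E (Blowup E p) :=
    L.pullback (Blowup.down : Blowup E p → X) Blowup.contMDiff_down with hD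
  -- `𝒪(1)` is trivial on `X × {0}`, and `𝓔` restricts to `E`
  set T : (blowMinus L p (cMax L p)).Triv → (totalBundle L p).Triv := fun i =>
    totTriv L p (ofIdx (L := D) (subFst i)) false
      (Option.map AffDir.prodZero (ofIdx (L := Blowup.excBundle E p) (smulTriv (subSnd i)))) with hT
  have hzero : ProjLine.hom ProjLine.zero false ≠ 0 := hom_zero_false
  have hdom : ∀ i, ∀ x ∈ (blowMinus L p (cMax L p)).dom i,
      stMap E p x ∈ (totalBundle L p).dom (T i) := by
    intro i x hx
    obtain ⟨j, o, rfl⟩ := exists_pairTriv i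
    obtain ⟨h1, h2⟩ := mem_dom_pairTriv.1 hx
    obtain ⟨k, -, hk⟩ := excFactor_stMap x
    refine mem_dom_total.2 ⟨?_, ?_, (hk _ h2).1⟩
    · rw [down_stMap]
      exact h1
    · rw [down_stMap]
      exact hzero
  have hlog : ∀ i j, ∀ x ∈ (blowMinus L p (cMax L p)).dom i ∩ (blowMinus L p (cMax L p)).dom j,
      (blowMinus L p (cMax L p)).logTrans i j x =
        (totalBundle L p).logTrans (T i) (T j) (stMap E p x) := by
    intro i i' x hx
    obtain ⟨j, o, rfl⟩ := exists_pairTriv i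
    obtain ⟨j', o', rfl⟩ := exists_pairTriv i'
    obtain ⟨h1, h2⟩ := mem_dom_pairTriv.1 hx.1
    obtain ⟨h1', h2'⟩ := mem_dom_pairTriv.1 hx.2
    obtain ⟨k, hk0, hk⟩ := excFactor_stMap x
    rw [logTrans_pairTriv, logTrans_total, down_stMap]
    have e1 : hyperplaneBundle.g false false ProjLine.zero = 1 := hyperplaneBundle.g_self hzero
    have e2 : (cMax L p + 1) * Real.log (‖hyperplaneBundle.g false false ProjLine.zero‖ ^ 2) = 0 := by
      rw [e1]; simp
    have e3 : (totalExc E p).g (Option.map AffDir.prodZero o) (Option.map AffDir.prodZero o')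
        (stMap E p x) = (Blowup.excBundle E p).g o o' x := by
      change _ / _ = _ / _
      rw [(hk o h2).2, (hk o' h2').2, mul_div_mul_left _ _ hk0]
    exact ((congrArg₂ (fun a b => Real.log (‖L.g j j' (Blowup.down x)‖ ^ 2) + a -
      cMax L p * Real.log (‖b‖ ^ 2)) e2 e3).trans (by rw [add_zero]; rfl)).symm
  set h' := H.transfer (blowMinus L p (cMax L p)) (stMap E p) contMDiff_stMap T hdom hlog with hh'
  have hs' : h'.IsStrictlyPositive :=
    SingPosMetric.transfer_isStrictlyPositive hH _ injective_mfderiv_stMap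
  have hsm' : h'.IsSmoothNear b := SingPosMetric.transfer_isSmoothNear hsm _
  -- strict positivity leaves room for the curvature of `-(ε / 2) E`
  obtain ⟨ε, hε, hpert⟩ := hs'.exists_psh_add η
  have hε2 : 0 < ε / 2 := half_pos hε
  set h₂ := h'.twist η (ε / 2) (hpert (-(ε / 2))
    (by rw [abs_neg, abs_of_pos hε2]; exact half_lt_self hε)) with hh₂
  -- the formal combinations `π^*L - (C_max + ε / 2) E` and `(π^*L - C_max E) - (ε / 2) E` have the same
  -- transition functions if `E` is trivialized in the same way in both terms
  set T₂ : (blowMinus L p (cMax L p + ε / 2)).Triv →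
      (blowMinus L p (cMax L p) - (ε / 2) • of (Blowup.excBundle E p)).Triv := fun i =>
    subTriv (pairTriv (L := D) (D := Blowup.excBundle E p) (cMax L p) (ofIdx (subFst i))
      (ofIdx (smulTriv (subSnd i)))) (G := (ε / 2) • of (Blowup.excBundle E p))
      (ofTriv (ofIdx (smulTriv (subSnd i)))) with hT₂
  have hpe : (blowMinus L p (cMax L p + ε / 2)).IsPseudoeffective := by
    obtain ⟨i, hi⟩ := (blowMinus L p (cMax L p + ε / 2)).exists_mem_dom b
    obtain ⟨j, o, rfl⟩ := exists_pairTriv i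
    refine ⟨h₂.transfer _ id contMDiff_id T₂ (fun i x hx => ?_) (fun i i' x hx => ?_), _, b, hi,
      ereal_add_coe_ne_bot (SingPosMetric.ne_bot_of_isSmoothNear hsm'
        (mem_dom_pairTriv.2 (mem_dom_pairTriv.1 hi))) _⟩
    · obtain ⟨j, o, rfl⟩ := exists_pairTriv i
      have hx := mem_dom_pairTriv.1 hx
      exact mem_dom_sub.2 ⟨mem_dom_pairTriv.2 hx, mem_dom_of.2 hx.2⟩
    · obtain ⟨j, o, rfl⟩ := exists_pairTriv i
      obtain ⟨j', o', rfl⟩ := exists_pairTriv i'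
      rw [logTrans_pairTriv, logTrans_sub]
      refine Eq.trans ?_ (congrArg₂ (· - ·) (logTrans_pairTriv (L := D)
        (D := Blowup.excBundle E p) (j := j) (j' := j') (o := o) (o' := o')).symm
        ((logTrans_smul (F := of (Blowup.excBundle E p)) _ _ _).trans
          (congrArg _ (logTrans_of (L := Blowup.excBundle E p) _ _ _))).symm)
      rw [add_mul, sub_add_eq_sub_sub]
      rfl
  exact absurd (le_csSup (bddAbove_pseudoeffective L p) hpe) (by
    change ¬ (cMax L p + ε / 2 ≤ cMax L p)
    linarith)

omit [IsManifold 𝓘(ℂ, E) ω X] in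
/-- The strict transform meets the exceptional divisor in the hyperplane at infinity `ℙ(T_pX)`. -/
theorem tangentInclusion_not_mem (v : TangentSpace 𝓘(ℂ, E) p) :
    tangentInclusion E p v ∉ range (stMap E p) := by
  rintro ⟨b, hb⟩
  cases b with
  | off x hx => exact nomatch hb
  | exc l =>
    obtain ⟨a, ha⟩ := (Projectivization.mk_eq_mk_iff' ℂ _ _ _ _).1 (Blowup.exc.inj hb)
    have h2 : a * 1 = 0 := congrArg Prod.snd ha
    have h1 : a • v = l.rep := congrArg Prod.fst ha
    rw [mul_one] at h2
    rw [h2, zero_smul] at h1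
    exact l.rep_nonzero h1.symm

end AmpleLocus

end CxGeom

theorem mainTheorem9 {E : Type} [NormedAddCommGroup E] [NormedSpace ℂ E] [FiniteDimensional ℂ E]
    [Nontrivial E] {X : Type*} [TopologicalSpace X] [ChartedSpace E X] [IsManifold 𝓘(ℂ, E) ω X]
    [CompactSpace X] [T2Space X] [ConnectedSpace X] (hX : IsProjective E X)
    (L : HolLineBundle E X) (p : X)
    (hL : L.IsAmple ∨ ((RLineBundle.of L).IsBig ∧ p ∈ (RLineBundle.of L).ampleLocus)) :
    (totalBundle L p).IsBig ∧
    (totalBundle L p).augBaseLocus =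
      fiberTransform E p ∪
        (fun b : TotalSpace E p => (Blowup.down b).1) ⁻¹' (RLineBundle.of L).augBaseLocus ∧
    ∀ v : TangentSpace 𝓘(ℂ, E) p, tangentInclusion E p v ∈ (totalBundle L p).ampleLocus := by
  -- the positive metric of an ample line bundle is smooth everywhere
  have hp : p ∈ (RLineBundle.of L).ampleLocus := hL.elim
    (fun h => let ⟨_, hψ⟩ := h.exists_metric; hψ.mem_ampleLocus p) fun h => h.2
  obtain ⟨A, m, hm, k, t, ht⟩ := hX
  have hs := ht.embedsBy.toPow
  -- a strictly positive metric of `L` induces one of `totalBundle L p` because `0 < C_max`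
  obtain ⟨h, hh, hsm⟩ := hp
  obtain ⟨δ, hδ, hpe⟩ := exists_pseudoeffective hs hh hsm
  have hC : 0 < cMax L p := hδ.trans_le (le_csSup (bddAbove_pseudoeffective L p) hpe)
  have htan : ∀ v : TangentSpace 𝓘(ℂ, E) p,
      tangentInclusion E p v ∈ (totalBundle L p).ampleLocus := by
    obtain ⟨H, hH, hHsm, -⟩ := exists_total_metric (p := p) hs hC hh
    exact fun v => ⟨H, hH, hHsm _ (tangentInclusion_not_mem v) hsm⟩
  refine ⟨?_, ?_, htan⟩
  · obtain ⟨H, hH, hHsm, B, hB, σ, ε, hε, hpsh⟩ := exists_total_metric (p := p) hs hC hh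
    obtain ⟨i, hi⟩ := ((totalBundle L p) - ε • RLineBundle.of B).exists_mem_dom
      (tangentInclusion E p 0)
    exact ⟨B, hB, ε, hε, H.twist σ ε hpsh, i, _, hi, ereal_add_coe_ne_bot
      (RLineBundle.SingPosMetric.ne_bot_of_isSmoothNear
        (hHsm _ (tangentInclusion_not_mem 0) hsm) (RLineBundle.mem_dom_sub.1 hi).1) _⟩
  · rw [fiberTransform_eq]
    ext b
    constructor
    · intro hb
      by_contra hnot
      rw [mem_union, not_or] at hnot
      obtain ⟨h', hh', hsm'⟩ := not_not.1 hnot.2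
      obtain ⟨H, hH, hHsm, -⟩ := exists_total_metric (p := p) hs hC hh'
      exact hb ⟨H, hH, hHsm b hnot.1 hsm'⟩
    · rintro (⟨b', rfl⟩ | hb) hb'
      · exact stMap_not_mem_ampleLocus hs b' hb'
      · by_cases hst : b ∈ range (stMap E p)
        · obtain ⟨b', rfl⟩ := hst
          exact stMap_not_mem_ampleLocus hs b' hb'
        cases b with
        -- the exceptional divisor lies over `p`, which is in the ample locus of `L`
        | exc l => exact hb ⟨h, hh, hsm⟩
        | off z hz =>
          obtain ⟨x, τ⟩ := z
          by_cases hτ : τ = ProjLine.zero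
          · subst hτ
            exact hst ⟨.off x fun h => hz (Prod.ext h rfl), rfl⟩
          · exact hb (fst_mem_ampleLocus hτ hb')
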